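/- **Setting.** The group $\mathsf{PGL}_2(\mathbb R)$ acts on $\mathbb H^2$ by isometries and on $\partial\mathbb H^2=\mathbb R\cup\{\infty\}$ by Möbius transformations. The limit set $\Lambda(\Gamma)\subset\partial\mathbb H^2$ of a discrete subgroup $\Gamma\subset\mathsf{PGL}_2(\mathbb R)$ is the set of accumulation points in $\partial\mathbb H^2$ of a (equivalently, any) $\Gamma$-orbit in $\mathbb H^2$; $\Gamma$ is non-elementary if $\Lambda(\Gamma)$ is infinite. Let $\mathcal F(\mathbb R^d)$ be the manifold of complete flags $F=(F^1\subset\dots\subset F^{d-1})$, $\dim F^k=k$ (with $F^d=\mathbb R^d$). Flags $F,G$ are transverse if $F^k+G^{d-k}=\mathbb R^d$ for all $k\in\{1,\dots,d-1\}$. For a basis $\mathcal B$ of $\mathbb R^d$ let $U_{>0}(\mathcal B)\subset\mathsf{PGL}_d(\mathbb R)$ be the set of elements represented in $\mathcal B$ by an upper triangular unipotent matrix all of whose minors that are not forced to vanish by upper triangularity are positive. For $n\ge3$, a tuple $(F_1,\dots,F_n)$ of complete flags is positive if $F_1$ and $F_n$ are transverse and there are a basis $\mathcal B=(e_1,\dots,e_d)$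 with $e_i\in F_1^i\cap F_n^{d-i+1}$ for all $i$, and $u_2,\dots,u_{n-1}\in U_{>0}(\mathcal B)$, such that $F_j=(u_{n-1}\cdots u_j)\cdot F_n$ for $2\le j\le n-1$. A map $\xi:\Lambda\to\mathcal F(\mathbb R^d)$, $\Lambda\subset\partial\mathbb H^2$, is positive if $(\xi(a_1),\dots,\xi(a_n))$ is positive for every $n\ge3$ and all pairwise distinct $a_1,\dots,a_n\in\Lambda$ in clockwise cyclic order. Let $\Gamma\subset\mathsf{PGL}_2(\mathbb R)$ be discrete and non-elementary. A representation $\rho:\Gamma\to\mathsf{PGL}_d(\mathbb R)$ is *Hitchin* if there is a continuous, $\rho$-equivariant, positive map $\xi:\Lambda(\Gamma)\to\mathcal F(\mathbb R^d)$. It is *Borel transverse* if there is a continuous, $\rho$-equivariant map $\xi:\Lambda(\Gamma)\to\mathcal F(\mathbb R^d)$ such that $\xi(x)$ and $\xi(y)$ are transverse for all distinct $x,y\in\Lambda(\Gamma)$ and which is strongly dynamics preserving: whenever $\gamma_n\in\Gamma$, $b_0\in\mathbb H^2$ and $x,y\in\Lambda(\Gamma)$ satisfy $\gamma_n b_0\to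 x$ and $\gamma_n^{-1}b_0\to y$, then $\rho(\gamma_n)F\to\xi(x)$ for every flag $F$ transverse to $\xi(y)$. **Theorem.** Let $\Gamma\subset\mathsf{PGL}_2(\mathbb R)$ be a discrete subgroup with $\Lambda(\Gamma)=\partial\mathbb H^2$. 1. Let $\Gamma'\subset\Gamma$ be a non-elementary subgroup. If $\rho:\Gamma\to\mathsf{PGL}_d(\mathbb R)$ is a Borel transverse representation such that $\rho|_{\Gamma'}$ is Hitchin, then $\rho$ is Hitchin. 2. Consequently, let $\Gamma_1,\Gamma_2\subset\Gamma$ be non-elementary subgroups (for instance, the two factors when $\Gamma=\Gamma_1*_{\langle\gamma\rangle}\Gamma_2$ is an amalgamated product over a cyclic subgroup), let $\rho_1:\Gamma_1\to\mathsf{PGL}_d(\mathbb R)$ be a representation that is not Hitchin (for instance, a Borel Anosov one), and let $\rho_2:\Gamma_2\to\mathsf{PGL}_d(\mathbb R)$ be a Hitchin representation. Then no representation $\rho:\Gamma\to\mathsf{PGL}_d(\mathbb R)$ with $\rho|_{\Gamma_1}=\rho_1$ and $\rho|_{\Gamma_2}=\rho_2$ is Borel transverse. -/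

import Mathlib

open Filter Topology Set

noncomputable section

/-! ### Projective linear groups and their actions -/

/-- The group `PGL_d(ℝ)`, the quotient of `GL_d(ℝ)` by its center. -/
abbrev ProjGL (d : ℕ) : Type := Matrix.ProjGenLinGroup (Fin d) ℝ

/-- The quotient topology on `PGL_d(ℝ)`. -/
instance ProjGL.instTopology (d : ℕ) : TopologicalSpace (ProjGL d) :=
  TopologicalSpace.coinduced
    (Matrix.ProjGenLinGroup.mk : Matrix.GeneralLinearGroup (Fin d) ℝ → ProjGL d) inferInstance

theorem scalar_smul_onePoint (u : ℝˣ) (x : OnePoint ℝ) :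
    Matrix.GeneralLinearGroup.scalar (Fin 2) u • x = x := by
  cases x with
  | infty => simp [OnePoint.smul_infty_eq_ite]
  | coe c => simp [OnePoint.smul_some_eq_ite]

/-- The action of `PGL_2(ℝ)` on `∂ℍ² = ℝ ∪ {∞}` by Möbius transformations. -/
instance ProjGL.instActionBoundary : MulAction (ProjGL 2) (OnePoint ℝ) :=
  Matrix.ProjGenLinGroup.mulActionOfGL scalar_smul_onePoint

/-! ### The compactification of the hyperbolic plane and limit sets -/

/-- The closed hyperbolic plane `ℍ² ∪ ∂ℍ²` is the closed disk in the Riemann sphere `ℂ ∪ {∞}`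
formed by the upper half-plane, the real line and `∞`. This is the inclusion of the interior. -/
def interiorPoint (z : UpperHalfPlane) : OnePoint ℂ := ((z : ℂ) : OnePoint ℂ)

/-- The inclusion of `∂ℍ² = ℝ ∪ {∞}` in the Riemann sphere. -/
def boundaryPoint (x : OnePoint ℝ) : OnePoint ℂ := OnePoint.map (fun t : ℝ => (t : ℂ)) x

/-- The limit set: the accumulation points in `∂ℍ²` of the orbits of `Γ` in `ℍ²`. -/
def limitSet (Γ : Subgroup (ProjGL 2)) : Set (OnePoint ℝ) :=
  {x | ∃ z : UpperHalfPlane,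
    AccPt (boundaryPoint x) (𝓟 (range fun γ : Γ => interiorPoint ((γ : ProjGL 2) • z)))}

/-- A (discrete) subgroup is non-elementary if its limit set is infinite. -/
def IsNonElementary (Γ : Subgroup (ProjGL 2)) : Prop := (limitSet Γ).Infinite

/-! ### Complete flags -/

/-- Complete flags `0 = F⁰ ⊂ F¹ ⊂ ⋯ ⊂ Fᵈ = ℝᵈ` with `dim Fᵏ = k`. -/
@[ext]
structure CompleteFlag (d : ℕ) where
  space : Fin (d + 1) → Submodule ℝ (Fin d → ℝ)
  mono : Monotone space
  finrank_space : ∀ k, Module.finrank ℝ (space k) = k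

namespace CompleteFlag

variable {d : ℕ}

theorem mulVecLin_injective (g : Matrix.GeneralLinearGroup (Fin d) ℝ) :
    Function.Injective (Matrix.mulVecLin (g : Matrix (Fin d) (Fin d) ℝ)) := by
  intro v w h
  have h' := congrArg (Matrix.mulVec ((g⁻¹ : Matrix.GeneralLinearGroup (Fin d) ℝ) :
    Matrix (Fin d) (Fin d) ℝ)) h
  simpa [Matrix.mulVec_mulVec, ← Units.val_mul, -Matrix.coe_units_inv] using h'

/-- `GL_d(ℝ)` acts on flags by taking images of subspaces. -/
instance instActionGL : MulAction (Matrix.GeneralLinearGroup (Fin d) ℝ) (CompleteFlag d) where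
  smul g F :=
    { space := fun k => (F.space k).map (Matrix.mulVecLin (g : Matrix (Fin d) (Fin d) ℝ))
      mono := fun _ _ h => Submodule.map_mono (F.mono h)
      finrank_space := fun k => by
        rw [← F.finrank_space k]
        exact (Submodule.equivMapOfInjective _ (mulVecLin_injective g) _).finrank_eq.symm }
  one_smul F := by
    apply CompleteFlag.ext
    funext k
    change (F.space k).map (Matrix.mulVecLin 1) = F.space k
    simp
  mul_smul g h F := by
    apply CompleteFlag.ext
    funext k
    change (F.space k).map (Matrix.mulVecLin (g.1 * h.1)) =
      ((F.space k).map (Matrix.mulVecLin h.1)).map (Matrix.mulVecLin g.1)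
    rw [Matrix.mulVecLin_mul, Submodule.map_comp]

theorem scalar_smul (u : ℝˣ) (F : CompleteFlag d) :
    Matrix.GeneralLinearGroup.scalar (Fin d) u • F = F := by
  apply CompleteFlag.ext
  funext k
  change (F.space k).map (Matrix.mulVecLin (Matrix.scalar (Fin d) (u : ℝ))) = F.space k
  have h : Matrix.mulVecLin (Matrix.scalar (Fin d) (u : ℝ)) =
      (u : ℝ) • (LinearMap.id : (Fin d → ℝ) →ₗ[ℝ] (Fin d → ℝ)) := by
    ext v i
    simp [Pi.single_apply]
  rw [h, Submodule.map_smul _ _ _ u.ne_zero, Submodule.map_id]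

/-- The induced action of `PGL_d(ℝ)` on flags. -/
instance instActionPGL : MulAction (ProjGL d) (CompleteFlag d) :=
  Matrix.ProjGenLinGroup.mulActionOfGL scalar_smul

variable (d) in
/-- The flag of the standard basis of `ℝᵈ`. -/
def standard : CompleteFlag d where
  space := (Pi.basisFun ℝ (Fin d)).flag
  mono := (Pi.basisFun ℝ (Fin d)).flag_mono
  finrank_space k := by
    classical
    have h := finrank_span_set_eq_card (R := ℝ)
      (s := (Pi.basisFun ℝ (Fin d)) '' {i | i.castSucc < k})
      (by
        have hli := (Pi.basisFun ℝ (Fin d)).linearIndependent.linearIndepOn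
          {i : Fin d | i.castSucc < k}
        exact hli.id_image)
    rw [Module.Basis.flag, h, Set.toFinset_card,
      Set.card_image_of_injective _ (Pi.basisFun ℝ (Fin d)).injective, Fintype.card_subtype]
    have hk : (k : ℕ) ≤ d := Nat.lt_succ_iff.mp k.2
    have : (Finset.univ.filter fun i : Fin d => i ∈ {i : Fin d | i.castSucc < k}) =
        Finset.univ.filter fun i : Fin d => (i : ℕ) < (k : ℕ) := by
      ext i
      simp [Fin.lt_def]
    rw [this, Fin.card_filter_val_lt]
    exact min_eq_right hk

/-- The usual topology of the flag manifold, as the quotient of `GL_d(ℝ)` by the stabilizer of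
the standard flag. -/
instance instTopology : TopologicalSpace (CompleteFlag d) :=
  TopologicalSpace.coinduced
    (fun g : Matrix.GeneralLinearGroup (Fin d) ℝ => g • standard d) inferInstance

/-- `F` and `G` are transverse: `Fᵏ + Gᵈ⁻ᵏ = ℝᵈ` for all `k` (this is automatic for
`k = 0` and `k = d`). Here `k.rev = d - k`. -/
def IsTransverse (F G : CompleteFlag d) : Prop :=
  ∀ k : Fin (d + 1), F.space k ⊔ G.space k.rev = ⊤

end CompleteFlag

/-! ### Positivity of tuples of flags -/

/-- A totally positive upper triangular unipotent matrix: every minor that is not forced to vanish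
by upper triangularity is positive. The minor with rows `I 0 < I 1 < ⋯` and columns
`J 0 < J 1 < ⋯` vanishes for every upper triangular matrix exactly when `J p < I p` for
some `p`. -/
def IsTotallyPositive {d : ℕ} (M : Matrix (Fin d) (Fin d) ℝ) : Prop :=
  (∀ i j, j < i → M i j = 0) ∧ (∀ i, M i i = 1) ∧
  ∀ (k : ℕ) (I J : Fin k → Fin d), StrictMono I → StrictMono J → (∀ p, I p ≤ J p) →
    0 < (M.submatrix I J).det

/-- `U_{>0}(B)`: the elements of `PGL_d(ℝ)` that are represented in the basis `B` by a totally
positive, upper triangular unipotent matrix. -/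
def positiveUnipotents {d : ℕ} (B : Module.Basis (Fin d) ℝ (Fin d → ℝ)) : Set (ProjGL d) :=
  {u | ∃ A : Matrix.GeneralLinearGroup (Fin d) ℝ, Matrix.ProjGenLinGroup.mk A = u ∧
    IsTotallyPositive
      (LinearMap.toMatrix B B (Matrix.mulVecLin (A : Matrix (Fin d) (Fin d) ℝ)))}

/-- Positivity of an `n`-tuple of complete flags, `n = m + 3 ≥ 3`, with the flags numbered
`F 0, …, F (m + 2)`: the first and the last flag are transverse, and there are a basis
`B = (e_i)` adapted to both and `u_1, …, u_{m+1} ∈ U_{>0}(B)` such that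
`F j = (u_{m+1} ⋯ u_j) • F (m + 2)` for `1 ≤ j ≤ m + 1`. With indices starting at `0`, the
vector `e_i` lies in `(F 0)^{i+1} ∩ (F (m+2))^{d-i}`. -/
def IsPositiveTuple {d m : ℕ} (F : Fin (m + 3) → CompleteFlag d) : Prop :=
  (F 0).IsTransverse (F (Fin.last (m + 2))) ∧
  ∃ (B : Module.Basis (Fin d) ℝ (Fin d → ℝ)) (u : ℕ → ProjGL d),
    (∀ j, 1 ≤ j → j ≤ m + 1 → u j ∈ positiveUnipotents B) ∧
    (∀ i : Fin d, B i ∈ (F 0).space i.succ ∧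
      B i ∈ (F (Fin.last (m + 2))).space i.castSucc.rev) ∧
    ∀ j : Fin (m + 3), 1 ≤ (j : ℕ) → (j : ℕ) ≤ m + 1 →
      F j = ((List.Ico (j : ℕ) (m + 2)).reverse.map u).prod • F (Fin.last (m + 2))

/-! ### Positive maps -/

/-- The position of a point of `ℝ ∪ {∞}` on the line, with `∞` put after all real numbers. -/
def boundaryPosition (x : OnePoint ℝ) : EReal := x.elim ⊤ (fun t => (t : EReal))

/-- The points `a`, `b`, `c` of the circle `∂ℍ² = ℝ ∪ {∞}` are pairwise distinct and in
counterclockwise cyclic order (the direction of increasing real numbers). -/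
def IsCounterclockwise (a b c : OnePoint ℝ) : Prop :=
  (boundaryPosition a < boundaryPosition b ∧ boundaryPosition b < boundaryPosition c) ∨
  (boundaryPosition b < boundaryPosition c ∧ boundaryPosition c < boundaryPosition a) ∨
  (boundaryPosition c < boundaryPosition a ∧ boundaryPosition a < boundaryPosition b)

/-- The tuple `a` of at least three points of the circle is pairwise distinct and in clockwise
cyclic order. -/
def IsClockwiseTuple {m : ℕ} (a : Fin (m + 3) → OnePoint ℝ) : Prop :=
  ∀ i j k, i < j → j < k → IsCounterclockwise (a k) (a j) (a i)

/-- The restriction of `ξ` to `Λ` is a positive map. -/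
def IsPositiveMapOn {d : ℕ} (ξ : OnePoint ℝ → CompleteFlag d) (Λ : Set (OnePoint ℝ)) : Prop :=
  ∀ (m : ℕ) (a : Fin (m + 3) → OnePoint ℝ), (∀ i, a i ∈ Λ) → IsClockwiseTuple a →
    IsPositiveTuple fun i => ξ (a i)

/-! ### Hitchin and Borel transverse representations

A map on the limit set is given as the restriction of a map on `∂ℍ²`, whose values outside the
limit set are irrelevant. -/

/-- The restriction of `ξ` to the limit set of `Γ` is `ρ`-equivariant. -/
def IsEquivariantOnLimitSet {d : ℕ} {Γ : Subgroup (ProjGL 2)} (ρ : Γ →* ProjGL d)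
    (ξ : OnePoint ℝ → CompleteFlag d) : Prop :=
  ∀ γ : Γ, ∀ x ∈ limitSet Γ, ξ ((γ : ProjGL 2) • x) = ρ γ • ξ x

/-- A representation of a non-elementary discrete subgroup `Γ` is Hitchin if there is a
continuous, `ρ`-equivariant, positive map from the limit set to the flag manifold. -/
def IsHitchin {d : ℕ} {Γ : Subgroup (ProjGL 2)} (ρ : Γ →* ProjGL d) : Prop :=
  ∃ ξ : OnePoint ℝ → CompleteFlag d, ContinuousOn ξ (limitSet Γ) ∧
    IsEquivariantOnLimitSet ρ ξ ∧ IsPositiveMapOn ξ (limitSet Γ)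

/-- The strongly dynamics preserving property of `ξ` on the limit set of `Γ`. -/
def IsStronglyDynamicsPreserving {d : ℕ} {Γ : Subgroup (ProjGL 2)} (ρ : Γ →* ProjGL d)
    (ξ : OnePoint ℝ → CompleteFlag d) : Prop :=
  ∀ (γ : ℕ → Γ) (b : UpperHalfPlane), ∀ x ∈ limitSet Γ, ∀ y ∈ limitSet Γ,
    Tendsto (fun n => interiorPoint ((γ n : ProjGL 2) • b)) atTop (𝓝 (boundaryPoint x)) →
    Tendsto (fun n => interiorPoint ((γ n : ProjGL 2)⁻¹ • b)) atTop (𝓝 (boundaryPoint y)) →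
    ∀ F : CompleteFlag d, F.IsTransverse (ξ y) →
      Tendsto (fun n => ρ (γ n) • F) atTop (𝓝 (ξ x))

/-- A representation of a non-elementary discrete subgroup `Γ` is Borel transverse if there is a
continuous, `ρ`-equivariant, transverse and strongly dynamics preserving map from the limit set
to the manifold of complete flags. -/
def IsBorelTransverse {d : ℕ} {Γ : Subgroup (ProjGL 2)} (ρ : Γ →* ProjGL d) : Prop :=
  ∃ ξ : OnePoint ℝ → CompleteFlag d, ContinuousOn ξ (limitSet Γ) ∧
    IsEquivariantOnLimitSet ρ ξ ∧
    (∀ x ∈ limitSet Γ, ∀ y ∈ limitSet Γ, x ≠ y → (ξ x).IsTransverse (ξ y)) ∧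
    IsStronglyDynamicsPreserving ρ ξ

end

/-!
# Borel transverse representations whose restriction to a subgroup is Hitchin

Let `ξ` be the limit map of the Borel transverse representation `ρ` of `Γ`, defined on the whole
circle, and let `ξ'` be the positive limit map of the restriction of `ρ` to `Γ'`.

*The two maps agree on an infinite set.* Let `γ ∈ Γ'` be hyperbolic with attracting and repelling
fixed points `x` and `y`, and let `z` be a third point of the limit set of `Γ'`. Since the triple of
values of `ξ'` at `x, z, y` (or at `y, z, x`) is positive, there is a frame adapted to `ξ' x` and
`ξ' y` in which `ξ' z` is the image of the opposite flag under a totally positive matrix. In this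
frame `ρ γ` is diagonal, and its dynamics near `ξ x` shows that its eigenvalues are simple. Hence
`ξ y` is a coordinate flag of the frame, and it is transverse to `ξ' z` because minors of a totally
positive matrix are nonzero (`CompleteFlag.isTransverse_of_isPositiveTuple`). By the strong dynamics
of `ρ`, the iterates `ρ γⁿ (ξ' z)` converge to `ξ x`; by continuity and equivariance of `ξ'` they
converge to `ξ' x`, so `ξ x = ξ' x` (`limitMap_eq_at_attracting`), and likewise at `y`. The set on
which the two maps agree is therefore a `Γ'`-invariant set with at least two points. If it were
finite, it would contain the limit set of `Γ'` (`limitSet_subset_of_finite`), which is infinite.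
Limit points are handled as images of the rank one matrices which are limits of multiples of
elements of the group (`mem_limitSet_iff`).

*Positivity propagates.* By the first part, `ξ` takes a positive tuple of values on at least one
clockwise tuple of each size. Among tuples of pairwise transverse flags positivity is an open and
closed condition (`CompleteFlag.isClopen_isPositiveTuple`). In the affine chart of flags transverse
to a given one, it says that certain upper unipotent matrices are totally positive up to signs. This
is visibly open. It is also closed: a limit of totally positive unipotent matrices is totally
nonnegative, transversality says that its corner minors do not vanish, and then no minor vanishes
except the forced ones (`TotalPositivity.isTotallyPositive_of_corner_ne_zero`, by Sylvester's
identity for bordered minors).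
Since the space of clockwise tuples is connected, as the image of a convex set of tuples of angles,
`ξ` is positive on all clockwise tuples (`isPositiveMapOn_univ`).

The second part follows since restrictions of Hitchin representations to subgroups are Hitchin: a
Borel transverse `ρ` with Hitchin restriction to `Γ₂` is Hitchin, hence so is its restriction to
`Γ₁`.
-/

open scoped MatrixGroups

namespace CompleteFlag

variable {d : ℕ}

open Matrix

/-! ### Flags in coordinates -/

theorem inv_mulVec_mulVec (g : GL (Fin d) ℝ) (v : Fin d → ℝ) :
    ((g⁻¹ : GL (Fin d) ℝ) : Matrix (Fin d) (Fin d) ℝ) *ᵥ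
      ((g : Matrix (Fin d) (Fin d) ℝ) *ᵥ v) = v := by
  rw [mulVec_mulVec, ← Units.val_mul, inv_mul_cancel, Units.val_one, one_mulVec]

theorem mulVec_inv_mulVec (g : GL (Fin d) ℝ) (v : Fin d → ℝ) :
    (g : Matrix (Fin d) (Fin d) ℝ) *ᵥ
      (((g⁻¹ : GL (Fin d) ℝ) : Matrix (Fin d) (Fin d) ℝ) *ᵥ v) = v := by
  rw [mulVec_mulVec, ← Units.val_mul, mul_inv_cancel, Units.val_one, one_mulVec]

theorem mulVec_mem_smul_space {g : GL (Fin d) ℝ} {F : CompleteFlag d} {k : Fin (d + 1)}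
    {v : Fin d → ℝ} (hv : v ∈ F.space k) :
    (g : Matrix (Fin d) (Fin d) ℝ) *ᵥ v ∈ (g • F).space k :=
  ⟨v, hv, rfl⟩

theorem mem_smul_space {g : GL (Fin d) ℝ} {F : CompleteFlag d} {k : Fin (d + 1)}
    {v : Fin d → ℝ} :
    v ∈ (g • F).space k ↔
      ((g⁻¹ : GL (Fin d) ℝ) : Matrix (Fin d) (Fin d) ℝ) *ᵥ v ∈ F.space k := by
  constructor
  · rintro ⟨w, hw, rfl⟩
    rw [mulVecLin_apply, inv_mulVec_mulVec]
    exact hw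
  · intro h
    exact ⟨_, h, mulVec_inv_mulVec g v⟩

theorem eq_of_le {F G : CompleteFlag d} (h : ∀ k, F.space k ≤ G.space k) : F = G := by
  ext1
  funext k
  exact Submodule.eq_of_le_of_finrank_eq (h k) (by rw [F.finrank_space, G.finrank_space])

theorem mem_standard_space {k : Fin (d + 1)} {v : Fin d → ℝ} :
    v ∈ (standard d).space k ↔ ∀ i : Fin d, (k : ℕ) ≤ i → v i = 0 := by
  change v ∈ Submodule.span ℝ ((Pi.basisFun ℝ (Fin d)) '' {i | i.castSucc < k}) ↔ _
  rw [Module.Basis.mem_span_image]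
  constructor
  · intro h i hi
    by_contra hv
    have := h (a := i) (by simpa using hv)
    simp [Fin.lt_def] at this
    omega
  · intro h i hi
    simp only [Finsupp.mem_support_iff, Pi.basisFun_repr, Finset.mem_coe] at hi
    by_contra hk
    simp only [mem_ofPred_eq, Fin.lt_def, Fin.val_castSucc, not_lt] at hk
    exact hi (h i hk)

/-- The linear map reversing the order of the standard basis. -/
noncomputable def reversal (d : ℕ) : GL (Fin d) ℝ :=
  let M : Matrix (Fin d) (Fin d) ℝ := (Fin.revPerm.toPEquiv : Fin d ≃. Fin d).toMatrix
  have h : M * M = 1 := by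
    rw [← PEquiv.toMatrix_trans, ← Equiv.toPEquiv_trans]
    have : (Fin.revPerm : Equiv.Perm (Fin d)).trans Fin.revPerm = Equiv.refl _ := by
      ext; simp
    rw [this, Equiv.toPEquiv_refl, PEquiv.toMatrix_refl]
  ⟨M, M, h, h⟩

theorem reversal_inv : (reversal d)⁻¹ = reversal d := rfl

theorem reversal_mul_self : reversal d * reversal d = 1 := by
  nth_rw 1 [← reversal_inv]
  exact inv_mul_cancel _

theorem reversal_mulVec (v : Fin d → ℝ) (i : Fin d) :
    ((reversal d : Matrix (Fin d) (Fin d) ℝ) *ᵥ v) i = v i.rev := by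
  change ((Fin.revPerm.toPEquiv : Fin d ≃. Fin d).toMatrix *ᵥ v) i = _
  rw [PEquiv.toMatrix_toPEquiv_mulVec]
  rfl

variable (d) in
/-- The flag of the standard basis of `ℝᵈ` in reversed order. -/
noncomputable def opposite : CompleteFlag d := reversal d • standard d

theorem reversal_smul_opposite : reversal d • opposite d = standard d := by
  rw [opposite, smul_smul, reversal_mul_self, one_smul]

theorem mem_opposite_space {k : Fin (d + 1)} {v : Fin d → ℝ} :
    v ∈ (opposite d).space k ↔ ∀ i : Fin d, (i : ℕ) + k < d → v i = 0 := by
  rw [opposite, mem_smul_space, reversal_inv, mem_standard_space]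
  simp only [reversal_mulVec]
  constructor
  · intro h i hi
    simpa using h i.rev (by simp [Fin.val_rev]; omega)
  · intro h i hi
    exact h i.rev (by simp [Fin.val_rev]; omega)

/-! ### Transversality -/

theorem isTransverse_iff {F G : CompleteFlag d} :
    F.IsTransverse G ↔ ∀ k : Fin (d + 1), ∀ v ∈ F.space k, v ∈ G.space k.rev → v = 0 := by
  refine forall_congr' fun k => ?_
  have h := Submodule.finrank_sup_add_finrank_inf_eq (F.space k) (G.space k.rev)
  rw [F.finrank_space, G.finrank_space, Fin.val_rev] at h
  have hk := k.is_lt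
  have h2 : (∀ v ∈ F.space k, v ∈ G.space k.rev → v = 0) ↔ F.space k ⊓ G.space k.rev = ⊥ := by
    rw [Submodule.eq_bot_iff]
    simp
  rw [h2, ← Submodule.finrank_eq_zero]
  constructor
  · intro h1
    rw [h1, finrank_top, Module.finrank_fin_fun] at h
    omega
  · intro h1
    apply Submodule.eq_top_of_finrank_eq
    rw [Module.finrank_fin_fun]
    omega

theorem IsTransverse.symm {F G : CompleteFlag d} (h : F.IsTransverse G) : G.IsTransverse F := by
  intro k
  have := h k.rev
  rwa [Fin.rev_rev, sup_comm] at this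

theorem IsTransverse.smul {F G : CompleteFlag d} (h : F.IsTransverse G) (g : GL (Fin d) ℝ) :
    (g • F).IsTransverse (g • G) := by
  rw [isTransverse_iff] at h ⊢
  intro k v hF hG
  rw [mem_smul_space] at hF hG
  rw [← mulVec_inv_mulVec g v, h k _ hF hG, mulVec_zero]

theorem isTransverse_smul_iff {F G : CompleteFlag d} (g : GL (Fin d) ℝ) :
    (g • F).IsTransverse (g • G) ↔ F.IsTransverse G :=
  ⟨fun h => by simpa using h.smul g⁻¹, fun h => h.smul g⟩

theorem isTransverse_standard_opposite : (standard d).IsTransverse (opposite d) := by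
  rw [isTransverse_iff]
  intro k v h1 h2
  rw [mem_standard_space] at h1
  rw [mem_opposite_space] at h2
  funext i
  by_cases hi : (k : ℕ) ≤ i
  · exact h1 i hi
  · exact h2 i (by have := k.is_lt; simp only [Fin.val_rev]; omega)

/-! ### Homogeneity and stabilizers -/

/-- A family of vectors `vᵢ ∈ Fⁱ⁺¹` outside `Fⁱ` is a basis adapted to the flag. -/
theorem exists_smul_standard (F : CompleteFlag d) : ∃ g : GL (Fin d) ℝ, g • standard d = F := by
  have hex : ∀ i : Fin d, ∃ v ∈ F.space i.succ, v ∉ F.space i.castSucc := by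
    intro i
    by_contra! hcon
    have := Submodule.finrank_mono (show F.space i.succ ≤ F.space i.castSucc from hcon)
    rw [F.finrank_space, F.finrank_space] at this
    simp at this
  choose e he he' using hex
  let M : Matrix (Fin d) (Fin d) ℝ := Matrix.of fun i j => e j i
  have hM : ∀ w, M *ᵥ w = ∑ j, w j • e j := by
    intro w
    funext i
    simp [M, mulVec, dotProduct, mul_comm]
  have hdet : M.det ≠ 0 := by
    intro h0
    obtain ⟨w, hw, hMw⟩ := exists_mulVec_eq_zero_iff.2 h0
    obtain ⟨j0, hj0⟩ := Function.ne_iff.1 hw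
    obtain ⟨j, hj, hmax⟩ := (Finset.univ.filter fun j => w j ≠ 0).exists_max_image id
      ⟨j0, by simpa using hj0⟩
    simp only [Finset.mem_filter, Finset.mem_univ, true_and, id] at hj hmax
    rw [hM, ← Finset.add_sum_erase _ _ (Finset.mem_univ j)] at hMw
    apply he' j
    have h1 : w j • e j ∈ F.space j.castSucc := by
      rw [eq_neg_of_add_eq_zero_left hMw]
      refine Submodule.neg_mem _ (Submodule.sum_mem _ fun i hi => ?_)
      by_cases hwi : w i = 0
      · simp [hwi]
      · have hlt : i < j := lt_of_le_of_ne (hmax i hwi) (Finset.ne_of_mem_erase hi)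
        exact Submodule.smul_mem _ _ (F.mono (Fin.succ_le_castSucc_iff.2 hlt) (he i))
    exact (Submodule.smul_mem_iff _ hj).1 h1
  refine ⟨GeneralLinearGroup.mkOfDetNeZero M hdet, eq_of_le fun k => ?_⟩
  rintro _ ⟨w, hw, rfl⟩
  rw [SetLike.mem_coe, mem_standard_space] at hw
  change M *ᵥ w ∈ _
  rw [hM]
  refine Submodule.sum_mem _ fun i _ => ?_
  by_cases hi : (k : ℕ) ≤ i
  · simp [hw i hi]
  · exact Submodule.smul_mem _ _ (F.mono (by rw [Fin.le_def, Fin.val_succ]; omega) (he i))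

theorem exists_smul_opposite (F : CompleteFlag d) : ∃ g : GL (Fin d) ℝ, g • opposite d = F := by
  obtain ⟨g, rfl⟩ := exists_smul_standard F
  exact ⟨g * reversal d, by rw [mul_smul, reversal_smul_opposite]⟩

theorem smul_standard_eq_iff {g : GL (Fin d) ℝ} :
    g • standard d = standard d ↔ ∀ i j, j < i → g i j = 0 := by
  constructor
  · intro h i j hij
    have h1 : Pi.single j (1 : ℝ) ∈ (standard d).space j.succ := by
      rw [mem_standard_space]
      intro l hl
      rw [Fin.val_succ] at hl
      exact Pi.single_eq_of_ne (by rintro rfl; omega) _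
    have h2 := mulVec_mem_smul_space (g := g) h1
    rw [h, mem_standard_space] at h2
    simpa using h2 i (by simpa [Nat.succ_le_iff] using hij)
  · intro h
    refine eq_of_le fun k => ?_
    rintro _ ⟨w, hw, rfl⟩
    rw [SetLike.mem_coe, mem_standard_space] at hw
    rw [mem_standard_space]
    intro i hi
    change ∑ j, g i j * w j = 0
    refine Finset.sum_eq_zero fun j _ => ?_
    by_cases hj : (k : ℕ) ≤ j
    · simp [hw j hj]
    · simp [h i j (by rw [Fin.lt_def]; omega)]

theorem smul_opposite_eq_iff {g : GL (Fin d) ℝ} :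
    g • opposite d = opposite d ↔ ∀ i j, i < j → g i j = 0 := by
  constructor
  · intro h i j hij
    have h1 : Pi.single j (1 : ℝ) ∈ (opposite d).space j.castSucc.rev := by
      rw [mem_opposite_space]
      intro l hl
      simp only [Fin.val_rev, Fin.val_castSucc] at hl
      exact Pi.single_eq_of_ne (by rintro rfl; omega) _
    have h2 := mulVec_mem_smul_space (g := g) h1
    rw [h, mem_opposite_space] at h2
    simpa using h2 i (by simp only [Fin.val_rev, Fin.val_castSucc]; rw [Fin.lt_def] at hij; omega)
  · intro h
    refine eq_of_le fun k => ?_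
    rintro _ ⟨w, hw, rfl⟩
    rw [SetLike.mem_coe, mem_opposite_space] at hw
    rw [mem_opposite_space]
    intro i hi
    change ∑ j, g i j * w j = 0
    refine Finset.sum_eq_zero fun j _ => ?_
    by_cases hj : (j : ℕ) + k < d
    · simp [hw j hj]
    · simp [h i j (by rw [Fin.lt_def]; omega)]

end CompleteFlag

namespace TotalPositivity

open Matrix

variable {d : ℕ}

/-! ### Totally nonnegative unipotent matrices -/

/-- The Schur complement of the square block `u[K, N]` in `u`. -/
noncomputable def schurComplement {n : ℕ} (u : Matrix (Fin d) (Fin d) ℝ) (K N : Fin n → Fin d) :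
    Matrix (Fin d) (Fin d) ℝ :=
  u - u.submatrix id N * (u.submatrix K N)⁻¹ * u.submatrix K id

/-- Sylvester's identity on bordered minors. -/
theorem det_submatrix_append {n m : ℕ} (u : Matrix (Fin d) (Fin d) ℝ) (K N : Fin n → Fin d)
    (R C : Fin m → Fin d) (h : (u.submatrix K N).det ≠ 0) :
    (u.submatrix (Fin.append K R) (Fin.append N C)).det =
      (u.submatrix K N).det * ((schurComplement u K N).submatrix R C).det := by
  have hinv : Invertible (u.submatrix K N) :=
    Matrix.invertibleOfIsUnitDet _ (isUnit_iff_ne_zero.2 h)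
  have h1 : u.submatrix (Fin.append K R) (Fin.append N C) =
      (fromBlocks (u.submatrix K N) (u.submatrix K C) (u.submatrix R N)
        (u.submatrix R C)).submatrix finSumFinEquiv.symm finSumFinEquiv.symm := by
    ext i j
    refine Fin.addCases (fun i => ?_) (fun i => ?_) i <;>
    refine Fin.addCases (fun j => ?_) (fun j => ?_) j <;> simp
  rw [h1, det_submatrix_equiv_self, det_fromBlocks₁₁, invOf_eq_nonsing_inv]
  rfl

theorem schurComplement_apply_right {n : ℕ} {u : Matrix (Fin d) (Fin d) ℝ} {K N : Fin n → Fin d}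
    (h : (u.submatrix K N).det ≠ 0) (r : Fin d) (a : Fin n) :
    schurComplement u K N r (N a) = 0 := by
  have h1 : (schurComplement u K N).submatrix id N = 0 := by
    change u.submatrix id N -
      u.submatrix id N * (u.submatrix K N)⁻¹ * u.submatrix K N = 0
    rw [Matrix.mul_assoc, nonsing_inv_mul _ (isUnit_iff_ne_zero.2 h), Matrix.mul_one, sub_self]
  exact congrFun (congrFun h1 r) a

theorem schurComplement_apply_left {n : ℕ} {u : Matrix (Fin d) (Fin d) ℝ} {K N : Fin n → Fin d}
    (h : (u.submatrix K N).det ≠ 0) (a : Fin n) (c : Fin d) :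
    schurComplement u K N (K a) c = 0 := by
  have h1 : (schurComplement u K N).submatrix K id = 0 := by
    change u.submatrix K id -
      u.submatrix K N * (u.submatrix K N)⁻¹ * u.submatrix K id = 0
    rw [mul_nonsing_inv _ (isUnit_iff_ne_zero.2 h), Matrix.one_mul, sub_self]
  exact congrFun (congrFun h1 a) c

/-- The Vandermonde product `∏_{a < b} (I b - I a)`, whose sign is that of the permutation
sorting `I`. -/
noncomputable def vand {n : ℕ} (I : Fin n → Fin d) : ℝ :=
  (vandermonde fun a => ((I a : ℕ) : ℝ)).det

theorem vand_eq {n : ℕ} (I : Fin n → Fin d) :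
    vand I = ∏ a, ∏ b, if a < b then ((I b : ℕ) : ℝ) - (I a : ℕ) else 1 := by
  rw [vand, det_vandermonde]
  refine Finset.prod_congr rfl fun a _ => ?_
  rw [← Finset.prod_filter]
  congr 1
  ext b
  simp

theorem vand_pos {n : ℕ} {I : Fin n → Fin d} (hI : StrictMono I) : 0 < vand I := by
  rw [vand_eq]
  refine Finset.prod_pos fun a _ => Finset.prod_pos fun b _ => ?_
  split_ifs with h
  · exact sub_pos.2 (Nat.cast_lt.2 (hI h))
  · exact one_pos

theorem vand_append {n m : ℕ} (K : Fin n → Fin d) (R : Fin m → Fin d) :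
    vand (Fin.append K R) =
      vand K * vand R * ∏ b, ∏ a, (((R b : ℕ) : ℝ) - (K a : ℕ)) := by
  rw [vand_eq, vand_eq, vand_eq, Fin.prod_univ_add]
  simp only [Fin.prod_univ_add, Fin.append_left, Fin.append_right]
  have h1 : ∀ (a : Fin n) (b : Fin m), Fin.castAdd m a < Fin.natAdd n b := fun a b => by
    rw [Fin.lt_def, Fin.val_castAdd, Fin.val_natAdd]; omega
  simp only [h1, fun a b => (h1 a b).not_gt, if_true, if_false, Finset.prod_const_one, one_mul,
    Finset.prod_mul_distrib, (Fin.strictMono_castAdd m).lt_iff_lt,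
    (Fin.strictMono_natAdd n).lt_iff_lt]
  rw [Finset.prod_comm (f := fun a b => ((R b : ℕ) : ℝ) - (K a : ℕ))]
  ring

theorem vand_comp_perm {n : ℕ} (I : Fin n → Fin d) (σ : Equiv.Perm (Fin n)) :
    vand (I ∘ σ) = (Equiv.Perm.sign σ : ℤ) * vand I := by
  rw [vand, vand, ← det_permute]
  rfl

/-- All minors of `u` are nonnegative. -/
def IsTotallyNonneg (u : Matrix (Fin d) (Fin d) ℝ) : Prop :=
  ∀ (n : ℕ) (I J : Fin n → Fin d), StrictMono I → StrictMono J → 0 ≤ (u.submatrix I J).det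

/-- The minors along unsorted families of indices are nonnegative after correction of their sign
by Vandermonde products. -/
theorem IsTotallyNonneg.vand_mul_nonneg {u : Matrix (Fin d) (Fin d) ℝ} (hu : IsTotallyNonneg u)
    {n : ℕ} (I J : Fin n → Fin d) : 0 ≤ vand I * vand J * (u.submatrix I J).det := by
  have key : ∀ I : Fin n → Fin d, Function.Injective I →
      ∃ σ : Equiv.Perm (Fin n), StrictMono (I ∘ σ) := fun I hI =>
    ⟨Tuple.sort I, (Tuple.monotone_sort I).strictMono_of_injective
      (hI.comp (Tuple.sort I).injective)⟩
  have hz : ∀ I : Fin n → Fin d, ¬ Function.Injective I → vand I = 0 := by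
    intro I hI
    rw [vand]
    by_contra h
    apply hI
    have := det_vandermonde_ne_zero_iff.1 h
    intro a b hab
    exact this (by simp [hab])
  by_cases hI : Function.Injective I
  swap
  · simp [hz I hI]
  by_cases hJ : Function.Injective J
  swap
  · simp [hz J hJ]
  obtain ⟨σ, hσ⟩ := key I hI
  obtain ⟨τ, hτ⟩ := key J hJ
  have h1 := mul_nonneg (mul_pos (vand_pos hσ) (vand_pos hτ)).le (hu n _ _ hσ hτ)
  rw [vand_comp_perm, vand_comp_perm] at h1
  have h2 : (u.submatrix (I ∘ σ) (J ∘ τ)).det =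
      (Equiv.Perm.sign σ : ℤ) * ((Equiv.Perm.sign τ : ℤ) * (u.submatrix I J).det) := by
    rw [← det_permute' τ, ← det_permute σ]
    rfl
  rw [h2] at h1
  have h3 : ∀ σ : Equiv.Perm (Fin n), ((Equiv.Perm.sign σ : ℤ) : ℝ) * (Equiv.Perm.sign σ : ℤ) = 1 := by
    intro σ
    rw [← Int.cast_mul, ← Units.val_mul, Int.units_mul_self]
    simp
  have h4 := h3 σ
  have h5 := h3 τ
  calc (0 : ℝ) ≤ _ := h1
    _ = (((Equiv.Perm.sign σ : ℤ) : ℝ) * (Equiv.Perm.sign σ : ℤ)) *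
        (((Equiv.Perm.sign τ : ℤ) : ℝ) * (Equiv.Perm.sign τ : ℤ)) *
        (vand I * vand J * (u.submatrix I J).det) := by ring
    _ = _ := by rw [h4, h5]; ring

theorem det_of_last_row {n : ℕ} (M : Matrix (Fin (n + 1)) (Fin (n + 1)) ℝ)
    (h0 : ∀ a : Fin n, M (Fin.last n) a.castSucc = 0) (h1 : M (Fin.last n) (Fin.last n) = 1) :
    M.det = (M.submatrix Fin.castSucc Fin.castSucc).det := by
  rw [det_succ_row M (Fin.last n), Fin.sum_univ_castSucc]
  simp [h0, h1, ← two_mul]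

theorem det_of_first_column {n : ℕ} (M : Matrix (Fin (n + 1)) (Fin (n + 1)) ℝ)
    (h0 : ∀ a : Fin n, M a.succ 0 = 0) (h1 : M 0 0 = 1) :
    M.det = (M.submatrix Fin.succ Fin.succ).det := by
  rw [det_succ_column_zero, Fin.sum_univ_succ]
  simp [h0, h1]

theorem add_val_le_of_strictMono {n : ℕ} {J : Fin (n + 1) → Fin d} (hJ : StrictMono J)
    (p : Fin (n + 1)) : (J 0 : ℕ) + p ≤ J p := by
  induction p using Fin.induction with
  | zero => simp
  | succ i ih =>
    have := Fin.lt_def.1 (hJ (Fin.castSucc_lt_succ (i := i)))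
    simp only [Fin.val_castSucc, Fin.val_succ] at *
    omega

/-- Inductive step on the size of the minors. If a minor `u[I, J]` with `I ≤ J` vanishes, let `K` be
`I` without its last element and `N` be `J` without its first one. The `2 × 2` minors of the Schur
complement of `u[K, N]` have known signs, which makes the Schur complement vanish above and to the
right of the position `(last I, first J)`. The corner minor is to be found there, so it vanishes. -/
theorem det_pos_of_corner_ne_zero_succ {u : Matrix (Fin d) (Fin d) ℝ} (hu : IsTotallyNonneg u)
    (hup : ∀ i j, j < i → u i j = 0) (hone : ∀ i, u i i = 1) {n : ℕ}
    (ih : ∀ K N : Fin n → Fin d, StrictMono K → StrictMono N → (∀ p, K p ≤ N p) →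
      0 < (u.submatrix K N).det)
    (hcorner : ∀ I J : Fin (n + 1) → Fin d, (∀ p, (I p : ℕ) = p) →
      (∀ p, (J p : ℕ) + (n + 1) = d + p) → (u.submatrix I J).det ≠ 0)
    {I J : Fin (n + 1) → Fin d} (hI : StrictMono I) (hJ : StrictMono J) (hIJ : ∀ p, I p ≤ J p) :
    0 < (u.submatrix I J).det := by
  by_contra hcon
  have hzero : (u.submatrix I J).det = 0 := le_antisymm (not_lt.1 hcon) (hu _ _ _ hI hJ)
  clear hcon
  set K : Fin n → Fin d := I ∘ Fin.castSucc with hKdef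
  set N : Fin n → Fin d := J ∘ Fin.succ with hNdef
  have hK : StrictMono K := hI.comp Fin.strictMono_castSucc
  have hN : StrictMono N := hJ.comp Fin.strictMono_succ
  have hKN : ∀ p, K p ≤ N p := fun p =>
    (hIJ p.castSucc).trans (hJ (Fin.castSucc_lt_succ (i := p))).le
  have hP : 0 < (u.submatrix K N).det := ih K N hK hN hKN
  have hPn := hP.ne'
  set S := schurComplement u K N with hS
  let πK : Fin d → ℝ := fun r => ∏ a, (((r : ℕ) : ℝ) - (K a : ℕ))
  let πN : Fin d → ℝ := fun c => ∏ a, (((c : ℕ) : ℝ) - (N a : ℕ))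
  have hv1 : ∀ r : Fin d, vand ![r] = 1 := fun r => by simp [vand_eq]
  have hv2 : ∀ r l : Fin d, vand ![r, l] = ((l : ℕ) : ℝ) - (r : ℕ) := fun r l => by
    simp [vand_eq, Fin.prod_univ_two]
  have hdet1 : ∀ r c, (u.submatrix (Fin.append K ![r]) (Fin.append N ![c])).det =
      (u.submatrix K N).det * S r c := fun r c => by
    rw [det_submatrix_append u K N _ _ hPn, det_fin_one]; rfl
  have hVK := vand_pos hK
  have hVN := vand_pos hN
  -- `T` is the Schur complement with signs that make its minors of sizes 1 and 2 nonnegative.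
  let T : Fin d → Fin d → ℝ := fun r c => πK r * πN c * S r c
  have hT : ∀ r c, 0 ≤ T r c := by
    intro r c
    have h := hu.vand_mul_nonneg (Fin.append K ![r]) (Fin.append N ![c])
    rw [hdet1, vand_append, vand_append, hv1, hv1, Fin.prod_univ_one, Fin.prod_univ_one] at h
    have h2 : 0 ≤ (vand K * vand N * (u.submatrix K N).det) * T r c := by
      refine h.trans_eq ?_
      simp only [T, πK, πN, Matrix.cons_val_zero]
      ring
    exact nonneg_of_mul_nonneg_right h2 (by positivity)
  have hT2 : ∀ r l c c', r < l → c < c' → T r c' * T l c ≤ T r c * T l c' := by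
    intro r l c c' hrl hcc
    have h := hu.vand_mul_nonneg (Fin.append K ![r, l]) (Fin.append N ![c, c'])
    rw [det_submatrix_append u K N _ _ hPn, det_fin_two, vand_append, vand_append, hv2, hv2,
      Fin.prod_univ_two, Fin.prod_univ_two] at h
    have hrl' : (0 : ℝ) < ((l : ℕ) : ℝ) - (r : ℕ) := sub_pos.2 (Nat.cast_lt.2 hrl)
    have hcc' : (0 : ℝ) < ((c' : ℕ) : ℝ) - (c : ℕ) := sub_pos.2 (Nat.cast_lt.2 hcc)
    have h2 : 0 ≤ (vand K * vand N * (u.submatrix K N).det * (((l : ℕ) : ℝ) - (r : ℕ)) *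
        (((c' : ℕ) : ℝ) - (c : ℕ))) * (T r c * T l c' - T r c' * T l c) := by
      refine h.trans_eq ?_
      simp only [T, πK, πN, Matrix.cons_val_zero, Matrix.cons_val_one, Matrix.submatrix_apply]
      ring
    exact sub_nonneg.1 (nonneg_of_mul_nonneg_right h2 (by positivity))
  have hπK : ∀ r, πK r = 0 → ∃ a, r = K a := by
    intro r hr
    obtain ⟨a, -, ha⟩ := Finset.prod_eq_zero_iff.1 hr
    exact ⟨a, Fin.ext (Nat.cast_injective (sub_eq_zero.1 ha))⟩
  have hπN : ∀ c, πN c = 0 → ∃ a, c = N a := by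
    intro c hc
    obtain ⟨a, -, ha⟩ := Finset.prod_eq_zero_iff.1 hc
    exact ⟨a, Fin.ext (Nat.cast_injective (sub_eq_zero.1 ha))⟩
  have hST : ∀ r c, T r c = 0 → S r c = 0 := by
    intro r c h
    rcases mul_eq_zero.1 h with h | h
    · rcases mul_eq_zero.1 h with h | h
      · obtain ⟨a, rfl⟩ := hπK r h
        exact schurComplement_apply_left hPn a c
      · obtain ⟨a, rfl⟩ := hπN c h
        exact schurComplement_apply_right hPn r a
    · exact h
  have hTpos : ∀ r c, (∀ a, r ≠ K a) → (∀ a, c ≠ N a) →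
      (u.submatrix (Fin.append K ![r]) (Fin.append N ![c])).det ≠ 0 → 0 < T r c := by
    intro r c hr hc hd
    refine lt_of_le_of_ne (hT r c) (Ne.symm (mul_ne_zero (mul_ne_zero ?_ ?_) ?_))
    · intro h
      obtain ⟨a, ha⟩ := hπK r h
      exact hr a ha
    · intro h
      obtain ⟨a, ha⟩ := hπN c h
      exact hc a ha
    · rw [hdet1] at hd
      exact right_ne_zero_of_mul hd
  have happI : Fin.append K ![I (Fin.last n)] = I := by
    rw [Fin.append_right_eq_snoc]
    exact Fin.snoc_init_self I
  -- moving the first column to the last place changes at most the sign of a minor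
  have happN : ∀ (L : Fin (n + 1) → Fin d) (c : Fin d),
      (u.submatrix L (Fin.append N ![c])).det ≠ 0 ↔ (u.submatrix L (Fin.cons c N)).det ≠ 0 := by
    intro L c
    have h1 : Fin.append N ![c] = (Fin.cons c N : Fin (n + 1) → Fin d) ∘ finRotate (n + 1) := by
      rw [Fin.append_right_eq_snoc]
      funext i
      refine Fin.lastCases ?_ (fun i => ?_) i
      · simp
      · rw [Function.comp_apply, finRotate_apply]
        simp
    have h2 : (u.submatrix L (Fin.append N ![c])).det =
        (Equiv.Perm.sign (finRotate (n + 1)) : ℤ) * (u.submatrix L (Fin.cons c N)).det := by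
      rw [h1, ← det_permute']
      rfl
    rw [h2, mul_ne_zero_iff, and_iff_right]
    exact_mod_cast (Equiv.Perm.sign (finRotate (n + 1))).ne_zero
  have hconsJ : (Fin.cons (J 0) N : Fin (n + 1) → Fin d) = J := Fin.cons_self_tail J
  have hlast : I (Fin.last n) ≠ J (Fin.last n) := by
    intro h
    rw [det_of_last_row] at hzero
    · exact (ih K (J ∘ Fin.castSucc) hK (hJ.comp Fin.strictMono_castSucc)
        fun p => hIJ p.castSucc).ne' hzero
    · intro a
      rw [submatrix_apply, h]
      exact hup _ _ (hJ (Fin.castSucc_lt_last a))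
    · rw [submatrix_apply, h, hone]
  have hfirst : I 0 ≠ J 0 := by
    intro h
    rw [det_of_first_column] at hzero
    · exact (ih (I ∘ Fin.succ) N (hI.comp Fin.strictMono_succ) hN fun p => hIJ p.succ).ne' hzero
    · intro a
      rw [submatrix_apply, ← h]
      exact hup _ _ (hI (Fin.succ_pos a))
    · rw [submatrix_apply, h, hone]
  replace hlast := lt_of_le_of_ne (hIJ _) hlast
  replace hfirst := lt_of_le_of_ne (hIJ _) hfirst
  have hKlast : ∀ a, K a < I (Fin.last n) := fun a => hI (Fin.castSucc_lt_last a)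
  have hNfirst : ∀ a, J 0 < N a := fun a => hJ (Fin.succ_pos a)
  have hT0 : T (I (Fin.last n)) (J 0) = 0 := by
    have h : S (I (Fin.last n)) (J 0) = 0 := by
      have h1 : (u.submatrix I (Fin.append N ![J 0])).det = 0 := by
        by_contra h2
        rw [← ne_eq, happN, hconsJ] at h2
        exact h2 hzero
      have h2 := hdet1 (I (Fin.last n)) (J 0)
      rw [happI, h1] at h2
      exact (mul_eq_zero.1 h2.symm).resolve_left hPn
    simp only [T, h, mul_zero]
  have hT1 : 0 < T (J (Fin.last n)) (J 0) := by
    refine hTpos _ _ (fun a => ((hKlast a).trans hlast).ne') (fun a => (hNfirst a).ne) ?_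
    rw [happN, hconsJ, det_of_last_row]
    · have h1 : (Fin.append K ![J (Fin.last n)]) ∘ Fin.castSucc = K := by
        rw [Fin.append_right_eq_snoc]
        funext i
        simp
      rw [submatrix_submatrix, h1]
      exact (ih K (J ∘ Fin.castSucc) hK (hJ.comp Fin.strictMono_castSucc)
        fun p => hIJ p.castSucc).ne'
    · intro a
      rw [submatrix_apply, Fin.append_right_eq_snoc, Fin.snoc_last]
      exact hup _ _ (hJ (Fin.castSucc_lt_last a))
    · rw [submatrix_apply, Fin.append_right_eq_snoc, Fin.snoc_last]
      exact hone _
  have hT2' : 0 < T (I (Fin.last n)) (I 0) := by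
    refine hTpos _ _ (fun a => (hKlast a).ne') (fun a => (hfirst.trans (hNfirst a)).ne) ?_
    rw [happN, happI, det_of_first_column]
    · rw [submatrix_submatrix]
      exact (ih (I ∘ Fin.succ) N (hI.comp Fin.strictMono_succ) hN fun p => hIJ p.succ).ne'
    · intro a
      rw [submatrix_apply, Fin.cons_zero]
      exact hup _ _ (hI (Fin.succ_pos a))
    · rw [submatrix_apply, Fin.cons_zero, hone]
  have hrow : ∀ c, J 0 ≤ c → T (I (Fin.last n)) c = 0 := by
    intro c hc
    rcases hc.eq_or_lt with rfl | hc
    · exact hT0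
    · have h := hT2 _ _ _ _ hlast hc
      rw [hT0, zero_mul] at h
      exact le_antisymm (nonpos_of_mul_nonpos_left h hT1) (hT _ _)
  have hS0 : ∀ r c, r ≤ I (Fin.last n) → J 0 ≤ c → S r c = 0 := by
    intro r c hr hc
    apply hST
    rcases hr.eq_or_lt with rfl | hr
    · exact hrow c hc
    · have h := hT2 _ _ _ _ hr (hfirst.trans_le hc)
      rw [hrow c hc, mul_zero] at h
      exact le_antisymm (nonpos_of_mul_nonpos_left h hT2') (hT _ _)
  -- the corner minor is therefore a product of matrices of rank at most `n`
  have hI' := add_val_le_of_strictMono hI (Fin.last n)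
  have hJ' := add_val_le_of_strictMono hJ (Fin.last n)
  have hJd := (J (Fin.last n)).is_lt
  rw [Fin.val_last] at hI' hJ'
  let I₀ : Fin (n + 1) → Fin d := fun p => ⟨p, by omega⟩
  let J₀ : Fin (n + 1) → Fin d := fun p => ⟨d - (n + 1) + p, by omega⟩
  refine hcorner I₀ J₀ (fun p => rfl) (fun p => by simp only [J₀]; omega) ?_
  have hprod : u.submatrix I₀ J₀ =
      u.submatrix I₀ N * ((u.submatrix K N)⁻¹ * u.submatrix K J₀) := by
    ext p q
    have h1 : S (I₀ p) (J₀ q) = 0 :=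
      hS0 _ _ (by simp only [I₀, Fin.le_def]; omega) (by simp only [J₀, Fin.le_def]; omega)
    rw [hS, schurComplement, Matrix.sub_apply, sub_eq_zero, Matrix.mul_assoc] at h1
    exact h1
  by_contra hne
  have hrank := rank_of_isUnit _ ((isUnit_iff_isUnit_det _).2 (isUnit_iff_ne_zero.2 hne))
  rw [hprod] at hrank
  have h1 := (rank_mul_le_left (u.submatrix I₀ N)
    ((u.submatrix K N)⁻¹ * u.submatrix K J₀)).trans (rank_le_width _)
  rw [hrank, Fintype.card_fin] at h1
  omega

/-- A totally nonnegative upper triangular unipotent matrix with nonzero upper right corner minors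
is totally positive. -/
theorem isTotallyPositive_of_corner_ne_zero {u : Matrix (Fin d) (Fin d) ℝ} (hu : IsTotallyNonneg u)
    (hup : ∀ i j, j < i → u i j = 0) (hone : ∀ i, u i i = 1)
    (hcorner : ∀ (n : ℕ) (I J : Fin n → Fin d), (∀ p, (I p : ℕ) = p) →
      (∀ p, (J p : ℕ) + n = d + p) → (u.submatrix I J).det ≠ 0) :
    IsTotallyPositive u := by
  refine ⟨hup, hone, fun n => ?_⟩
  induction n with
  | zero => intro I J _ _ _; simp
  | succ n ih =>
    intro I J hI hJ hIJ
    exact det_pos_of_corner_ne_zero_succ hu hup hone ih (hcorner (n + 1)) hI hJ hIJ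

theorem det_submatrix_eq_zero_of_lt {u : Matrix (Fin d) (Fin d) ℝ}
    (hup : ∀ i j, j < i → u i j = 0) {n : ℕ} {I J : Fin n → Fin d} (hI : StrictMono I)
    (hJ : StrictMono J) {p : Fin n} (hp : J p < I p) : (u.submatrix I J).det = 0 := by
  rw [det_apply]
  refine Finset.sum_eq_zero fun σ _ => ?_
  obtain ⟨i, hip, hσ⟩ : ∃ i ≤ p, p ≤ σ i := by
    by_contra! hcon
    have h := Finset.card_le_card_of_injOn (s := Finset.Iic p) (t := Finset.Iio p) σ
      (fun i hi => by simpa using hcon i (by simpa using hi)) σ.injective.injOn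
    rw [Fin.card_Iic, Fin.card_Iio] at h
    omega
  rw [Finset.prod_eq_zero (Finset.mem_univ i), smul_zero]
  exact hup _ _ ((hJ.monotone hip).trans_lt (hp.trans_le (hI.monotone hσ)))

end TotalPositivity

namespace CompleteFlag

variable {d : ℕ}

open Matrix

/-! ### The topology of the flag manifold -/

theorem isOpenQuotientMap_smul_standard :
    IsOpenQuotientMap fun g : GL (Fin d) ℝ => g • standard d := by
  refine IsOpenQuotientMap.of_isOpenMap_isQuotientMap ?_ ⟨⟨rfl⟩, exists_smul_standard⟩
  intro U hU
  refine isOpen_coinduced.2 ?_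
  have h : (fun g : GL (Fin d) ℝ => g • standard d) ⁻¹'
      ((fun g : GL (Fin d) ℝ => g • standard d) '' U) =
      ⋃ s ∈ MulAction.stabilizer (GL (Fin d) ℝ) (standard d), (fun g => g * s) ⁻¹' U := by
    ext g
    simp only [mem_preimage, mem_image, mem_iUnion, exists_prop]
    constructor
    · rintro ⟨a, ha, hag⟩
      refine ⟨g⁻¹ * a, ?_, by simpa using ha⟩
      rw [MulAction.mem_stabilizer_iff, mul_smul, hag, inv_smul_smul]
    · rintro ⟨s, hs, hgs⟩
      refine ⟨g * s, hgs, ?_⟩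
      rw [mul_smul, MulAction.mem_stabilizer_iff.1 hs]
  rw [h]
  exact isOpen_biUnion fun s _ => hU.preimage (continuous_mul_const s)

theorem isOpenQuotientMap_smul_opposite :
    IsOpenQuotientMap fun g : GL (Fin d) ℝ => g • opposite d := by
  have h := (isOpenQuotientMap_smul_standard (d := d)).comp
    (Homeomorph.mulRight (reversal d)).isOpenQuotientMap
  convert h using 2 with g
  simp [opposite, mul_smul]

instance : ContinuousSMul (GL (Fin d) ℝ) (CompleteFlag d) where
  continuous_smul := by
    rw [← (IsOpenQuotientMap.id.prodMap
      (isOpenQuotientMap_smul_standard (d := d))).continuous_comp_iff]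
    have : (fun p : GL (Fin d) ℝ × CompleteFlag d => p.1 • p.2) ∘
        Prod.map id (fun g : GL (Fin d) ℝ => g • standard d) =
        (fun g : GL (Fin d) ℝ => g • standard d) ∘ fun p => p.1 * p.2 := by
      funext p
      simp [mul_smul]
    rw [this]
    exact isOpenQuotientMap_smul_standard.continuous.comp continuous_mul

theorem continuous_entry (i j : Fin d) :
    Continuous fun g : GL (Fin d) ℝ => (g : Matrix (Fin d) (Fin d) ℝ) i j :=
  (Units.continuous_val).matrix_elem i j

instance : T2Space (CompleteFlag d) := by
  rw [t2Space_iff_of_isOpenQuotientMap isOpenQuotientMap_smul_standard]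
  have : {q : GL (Fin d) ℝ × GL (Fin d) ℝ | q.1 • standard d = q.2 • standard d} =
      ⋂ (i : Fin d) (j : Fin d) (_ : j < i), {q | (q.1⁻¹ * q.2 : GL (Fin d) ℝ) i j = 0} := by
    ext q
    simp only [mem_ofPred_eq, mem_iInter]
    rw [← smul_standard_eq_iff, mul_smul, inv_smul_eq_iff, eq_comm]
  rw [this]
  refine isClosed_iInter fun i => isClosed_iInter fun j => isClosed_iInter fun _ => ?_
  exact isClosed_eq ((continuous_entry i j).comp (by fun_prop)) continuous_const

theorem continuousAt_inv_matrix {n : Type*} [Fintype n] [DecidableEq n] {X : Type*}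
    [TopologicalSpace X] {f : X → Matrix n n ℝ} {x : X} (hf : ContinuousAt f x)
    (h : (f x).det ≠ 0) : ContinuousAt (fun y => (f y)⁻¹) x := by
  have h1 : Continuous fun A : Matrix n n ℝ => A.det := Continuous.matrix_det continuous_id
  have h2 : Continuous fun A : Matrix n n ℝ => A.adjugate := Continuous.matrix_adjugate continuous_id
  simp only [inv_def, Ring.inverse_eq_inv']
  exact ((h1.continuousAt.comp hf).inv₀ h).smul (h2.continuousAt.comp hf)

theorem continuousAt_of_continuousAt_val {X : Type*} [TopologicalSpace X] {f : X → GL (Fin d) ℝ}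
    {x : X} (hf : ContinuousAt (fun y => (f y : Matrix (Fin d) (Fin d) ℝ)) x) :
    ContinuousAt f x := by
  rw [Units.isEmbedding_embedProduct.continuousAt_iff]
  refine hf.prodMk (MulOpposite.continuous_op.continuousAt.comp ?_)
  have h := continuousAt_inv_matrix hf (f x).det_ne_zero
  simpa only [← coe_units_inv] using h

/-! ### The affine chart of flags transverse to the standard flag -/

variable (d) in
/-- The group of upper triangular unipotent matrices. -/
def upperUnipotent : Subgroup (GL (Fin d) ℝ) where
  carrier := {y | (∀ i j, j < i → y i j = 0) ∧ ∀ i, y i i = 1}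
  one_mem' := ⟨fun i j h => one_apply_ne h.ne', fun i => one_apply_eq i⟩
  mul_mem' {a b} ha hb := by
    refine ⟨smul_standard_eq_iff.1 ?_, fun i => ?_⟩
    · rw [mul_smul, smul_standard_eq_iff.2 hb.1, smul_standard_eq_iff.2 ha.1]
    · rw [Units.val_mul, mul_apply, Finset.sum_eq_single i, ha.2, hb.2, one_mul]
      · intro j _ hj
        rcases lt_or_gt_of_ne hj with h | h
        · rw [ha.1 i j h, zero_mul]
        · rw [hb.1 j i h, mul_zero]
      · simp
  inv_mem' {a} ha := by
    have h1 := smul_standard_eq_iff.1 (inv_smul_eq_iff.2 (smul_standard_eq_iff.2 ha.1).symm)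
    refine ⟨h1, fun i => ?_⟩
    have h2 : ((a * a⁻¹ : GL (Fin d) ℝ) : Matrix (Fin d) (Fin d) ℝ) i i = 1 := by simp
    rw [Units.val_mul, mul_apply, Finset.sum_eq_single i, ha.2, one_mul] at h2
    · exact h2
    · intro j _ hj
      rcases lt_or_gt_of_ne hj with h | h
      · rw [ha.1 i j h, zero_mul]
      · rw [h1 j i h, mul_zero]
    · simp

theorem smul_standard_of_mem {y : GL (Fin d) ℝ} (hy : y ∈ upperUnipotent d) :
    y • standard d = standard d := smul_standard_eq_iff.2 hy.1

theorem eq_of_smul_opposite_eq {y y' : GL (Fin d) ℝ} (hy : y ∈ upperUnipotent d)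
    (hy' : y' ∈ upperUnipotent d) (h : y • opposite d = y' • opposite d) : y = y' := by
  have h1 : (y'⁻¹ * y) • opposite d = opposite d := by rw [mul_smul, h, inv_smul_smul]
  have h2 := smul_opposite_eq_iff.1 h1
  have h3 := mul_mem (inv_mem hy') hy
  have h4 : y'⁻¹ * y = 1 := by
    ext i j
    rw [Units.val_one]
    rcases lt_trichotomy i j with hij | rfl | hij
    · rw [h2 i j hij, one_apply_ne hij.ne]
    · rw [h3.2, one_apply_eq]
    · rw [h3.1 i j hij, one_apply_ne hij.ne']
  exact (inv_mul_eq_one.1 h4).symm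

theorem isTransverse_of_mem {y : GL (Fin d) ℝ} (hy : y ∈ upperUnipotent d) :
    (standard d).IsTransverse (y • opposite d) := by
  have := isTransverse_standard_opposite.smul y
  rwa [smul_standard_of_mem hy] at this

/-- The square block of `g` with rows and columns after `i`. -/
def tailBlock (g : Matrix (Fin d) (Fin d) ℝ) (i : Fin d) :
    Matrix {l // i < l} {l // i < l} ℝ :=
  g.submatrix (↑) (↑)

/-- The upper triangular unipotent matrix `z` for which `z * g` is lower triangular. It is obtained
by solving one linear system for each row, and it is meaningful only if all the blocks
`tailBlock g i` are invertible. Its entries are visibly continuous functions of `g`. -/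
noncomputable def clearing (g : Matrix (Fin d) (Fin d) ℝ) : Matrix (Fin d) (Fin d) ℝ :=
  Matrix.of fun i j =>
    if h : i < j then -((fun l : {l // i < l} => g i l) ᵥ* (tailBlock g i)⁻¹) ⟨j, h⟩
    else if i = j then 1 else 0

theorem clearing_apply_self (g : Matrix (Fin d) (Fin d) ℝ) (i : Fin d) : clearing g i i = 1 := by
  simp [clearing]

theorem clearing_apply_of_lt (g : Matrix (Fin d) (Fin d) ℝ) {i j : Fin d} (h : j < i) :
    clearing g i j = 0 := by
  simp [clearing, h.not_gt, h.ne']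

theorem clearing_mul_apply_of_lt {g : Matrix (Fin d) (Fin d) ℝ} {i : Fin d}
    (hg : (tailBlock g i).det ≠ 0) {l : Fin d} (h : i < l) : (clearing g * g) i l = 0 := by
  have h1 : (((fun l : {l // i < l} => g i l) ᵥ* (tailBlock g i)⁻¹) ᵥ* tailBlock g i) ⟨l, h⟩ =
      g i l := by
    rw [vecMul_vecMul, nonsing_inv_mul _ (isUnit_iff_ne_zero.2 hg), vecMul_one]
  rw [mul_apply, ← Finset.sum_filter_add_sum_filter_not _ (fun j => i < j),
    ← Finset.sum_subtype_eq_sum_filter, Finset.sum_eq_single_of_mem (s := Finset.filter _ _) i]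
  · rw [clearing_apply_self, one_mul, ← h1]
    have h2 : ∀ x : {j // i < j}, clearing g i x =
        -((fun l : {l // i < l} => g i l) ᵥ* (tailBlock g i)⁻¹) x := fun x => by
      simp [clearing, x.2]
    simp only [vecMul, dotProduct, tailBlock, submatrix_apply] at h2 ⊢
    rw [show Finset.subtype (fun j => i < j) Finset.univ = Finset.univ by ext; simp]
    simp only [h2, neg_mul, Finset.sum_neg_distrib]
    ring
  · simp
  · intro j hj hne
    simp only [Finset.mem_filter, Finset.mem_univ, true_and, not_lt] at hj
    rw [clearing_apply_of_lt g (lt_of_le_of_ne hj hne), zero_mul]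

theorem det_clearing (g : Matrix (Fin d) (Fin d) ℝ) : (clearing g).det = 1 := by
  rw [det_of_isUpperTriangular]
  · simp [clearing_apply_self]
  · intro i j h
    exact clearing_apply_of_lt g h

/-- The matrix `clearing g` as an invertible matrix. -/
noncomputable def clearingGL (g : Matrix (Fin d) (Fin d) ℝ) : GL (Fin d) ℝ :=
  GeneralLinearGroup.mkOfDetNeZero (clearing g) (by rw [det_clearing]; exact one_ne_zero)

theorem clearingGL_mem (g : Matrix (Fin d) (Fin d) ℝ) : clearingGL g ∈ upperUnipotent d :=
  ⟨fun _ _ h => clearing_apply_of_lt g h, clearing_apply_self g⟩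

theorem clearingGL_smul {g : GL (Fin d) ℝ} (hg : ∀ i, (tailBlock g.1 i).det ≠ 0) :
    (clearingGL g.1)⁻¹ • opposite d = g • opposite d := by
  rw [inv_smul_eq_iff, smul_smul, eq_comm, smul_opposite_eq_iff]
  intro i j hij
  exact clearing_mul_apply_of_lt (hg i) hij

theorem det_tailBlock_ne_zero {g : GL (Fin d) ℝ}
    (hg : (standard d).IsTransverse (g • opposite d)) (i : Fin d) :
    (tailBlock g.1 i).det ≠ 0 := by
  intro h0
  obtain ⟨w, hw, hGw⟩ := exists_mulVec_eq_zero_iff.2 h0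
  let W : Fin d → ℝ := fun j => if h : i < j then w ⟨j, h⟩ else 0
  have hW : W ∈ (opposite d).space i.succ.rev := by
    rw [mem_opposite_space]
    intro j hj
    have : ¬ i < j := by rw [Fin.lt_def]; simp only [Fin.val_rev, Fin.val_succ] at hj; omega
    simp [W, this]
  have hgW : g.1 *ᵥ W ∈ (standard d).space i.succ := by
    rw [mem_standard_space]
    intro j hj
    rw [Fin.val_succ] at hj
    have hij : i < j := Fin.lt_def.2 hj
    refine Eq.trans ?_ (congrFun hGw ⟨j, hij⟩)
    change ∑ l, g.1 j l * W l = ∑ l : {l // i < l}, g.1 j l * w l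
    rw [← Finset.sum_filter_of_ne (p := fun l => i < l)]
    · rw [← Finset.sum_subtype_eq_sum_filter,
        show Finset.subtype (fun j => i < j) Finset.univ = Finset.univ by ext; simp]
      refine Finset.sum_congr rfl fun l _ => ?_
      simp [W, l.2]
    · intro l _ hl
      by_contra h
      simp [W, h] at hl
  have h1 := isTransverse_iff.1 hg i.succ _ hgW (mulVec_mem_smul_space hW)
  have h2 : W = 0 := by rw [← inv_mulVec_mulVec g W, h1, mulVec_zero]
  apply hw
  funext ⟨j, hj⟩
  have := congrFun h2 j
  simpa [W, hj] using this

theorem exists_mem_smul_opposite {F : CompleteFlag d} (hF : (standard d).IsTransverse F) :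
    ∃ y ∈ upperUnipotent d, y • opposite d = F := by
  obtain ⟨g, rfl⟩ := exists_smul_opposite F
  exact ⟨_, inv_mem (clearingGL_mem g.1), clearingGL_smul (det_tailBlock_ne_zero hF)⟩

open Classical in
/-- The coordinate of a flag `F` transverse to the standard flag: the unipotent upper triangular
matrix taking the opposite flag to `F`. Its value on other flags is irrelevant. -/
noncomputable def chart (F : CompleteFlag d) : GL (Fin d) ℝ :=
  if h : ∃ y ∈ upperUnipotent d, y • opposite d = F then h.choose else 1

theorem chart_smul {y : GL (Fin d) ℝ} (hy : y ∈ upperUnipotent d) :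
    chart (y • opposite d) = y := by
  have h : ∃ y' ∈ upperUnipotent d, y' • opposite d = y • opposite d := ⟨y, hy, rfl⟩
  rw [chart, dif_pos h]
  exact eq_of_smul_opposite_eq h.choose_spec.1 hy h.choose_spec.2

theorem chart_mem {F : CompleteFlag d} (hF : (standard d).IsTransverse F) :
    chart F ∈ upperUnipotent d := by
  obtain ⟨y, hy, rfl⟩ := exists_mem_smul_opposite hF
  rwa [chart_smul hy]

theorem chart_smul_opposite {F : CompleteFlag d} (hF : (standard d).IsTransverse F) :
    chart F • opposite d = F := by
  obtain ⟨y, hy, rfl⟩ := exists_mem_smul_opposite hF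
  rw [chart_smul hy]

theorem continuous_tailBlock (i : Fin d) :
    Continuous fun g : GL (Fin d) ℝ => tailBlock g.1 i :=
  continuous_matrix fun _ _ => continuous_entry _ _

theorem eventually_det_tailBlock_ne_zero {g : GL (Fin d) ℝ}
    (hg : (standard d).IsTransverse (g • opposite d)) :
    ∀ᶠ g' : GL (Fin d) ℝ in 𝓝 g, ∀ i, (tailBlock g'.1 i).det ≠ 0 := by
  rw [eventually_all]
  intro i
  have h : Continuous fun g : GL (Fin d) ℝ => (tailBlock g.1 i).det :=
    (continuous_tailBlock i).matrix_det
  exact h.continuousAt.eventually_ne (det_tailBlock_ne_zero hg i)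

theorem eventually_isTransverse {F : CompleteFlag d} (hF : (standard d).IsTransverse F) :
    ∀ᶠ G in 𝓝 F, (standard d).IsTransverse G := by
  obtain ⟨g, rfl⟩ := exists_smul_opposite F
  rw [← isOpenQuotientMap_smul_opposite.map_nhds_eq, eventually_map]
  filter_upwards [eventually_det_tailBlock_ne_zero hF] with g' hg'
  rw [← clearingGL_smul hg']
  exact isTransverse_of_mem (inv_mem (clearingGL_mem _))

theorem continuousAt_chart {F : CompleteFlag d} (hF : (standard d).IsTransverse F) :
    ContinuousAt chart F := by
  obtain ⟨g, rfl⟩ := exists_smul_opposite F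
  rw [← isOpenQuotientMap_smul_opposite.continuousAt_comp_iff]
  have h1 : (fun g' : GL (Fin d) ℝ => (clearingGL g'.1)⁻¹) =ᶠ[𝓝 g]
      chart ∘ fun g : GL (Fin d) ℝ => g • opposite d := by
    filter_upwards [eventually_det_tailBlock_ne_zero hF] with g' hg'
    rw [Function.comp_apply, ← clearingGL_smul hg', chart_smul (inv_mem (clearingGL_mem _))]
  refine ContinuousAt.congr ?_ h1
  refine ContinuousAt.inv (continuousAt_of_continuousAt_val ?_)
  refine continuousAt_pi.2 fun i => continuousAt_pi.2 fun j => ?_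
  change ContinuousAt (fun g' : GL (Fin d) ℝ => clearing g'.1 i j) g
  by_cases h : i < j
  · simp only [clearing, of_apply, dif_pos h, vecMul, dotProduct]
    refine ContinuousAt.neg (tendsto_finsetSum _ fun l _ => ?_)
    refine (continuous_entry i l).continuousAt.mul ?_
    have h2 := continuousAt_inv_matrix (continuous_tailBlock i).continuousAt
      (det_tailBlock_ne_zero hF i)
    exact continuousAt_pi.1 (continuousAt_pi.1 h2 l) ⟨j, h⟩
  · simp only [clearing, of_apply, dif_neg h]
    exact continuousAt_const

/-- A continuous family of flags locally lifts to the general linear group. -/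
theorem exists_continuousAt_lift {X : Type*} [TopologicalSpace X] {f : X → CompleteFlag d} {x : X}
    (hf : ContinuousAt f x) :
    ∃ h : X → GL (Fin d) ℝ, ContinuousAt h x ∧ ∀ᶠ t in 𝓝 x, h t • standard d = f t := by
  obtain ⟨k, hk⟩ := exists_smul_opposite (f x)
  have hc : ContinuousAt (fun t => k⁻¹ • f t) x := hf.const_smul k⁻¹
  have htr : (standard d).IsTransverse (k⁻¹ • f x) := by
    rw [← hk, inv_smul_smul]
    exact isTransverse_standard_opposite
  refine ⟨fun t => k * chart (k⁻¹ • f t) * reversal d, ?_, ?_⟩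
  · have h1 : ContinuousAt (fun t => chart (k⁻¹ • f t)) x :=
      ContinuousAt.comp (f := fun t => k⁻¹ • f t) (continuousAt_chart htr) hc
    exact (continuousAt_const.mul h1).mul continuousAt_const
  · filter_upwards [hc.eventually (eventually_isTransverse htr)] with t ht
    rw [mul_smul, mul_smul]
    change k • chart (k⁻¹ • f t) • opposite d = f t
    rw [chart_smul_opposite ht, smul_inv_smul]

end CompleteFlag

/-! ### Positive tuples in a frame -/

namespace CompleteFlag

open Matrix TotalPositivity

variable {d : ℕ}

theorem exists_frame_of_basis (B : Module.Basis (Fin d) ℝ (Fin d → ℝ)) :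
    ∃ g : GL (Fin d) ℝ, ∀ i, B i = g.1 *ᵥ Pi.single i 1 := by
  have hdet : ((Pi.basisFun ℝ (Fin d)).toMatrix B).det ≠ 0 :=
    ((Pi.basisFun ℝ (Fin d)).isUnit_det B).ne_zero
  refine ⟨GeneralLinearGroup.mkOfDetNeZero _ hdet, fun i => ?_⟩
  rw [mulVec_single_one]
  rfl

theorem exists_basis_of_frame (g : GL (Fin d) ℝ) :
    ∃ B : Module.Basis (Fin d) ℝ (Fin d → ℝ), ∀ i, B i = g.1 *ᵥ Pi.single i 1 := by
  refine ⟨(Pi.basisFun ℝ (Fin d)).map (LinearEquiv.ofBijective (mulVecLin g.1)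
    ⟨mulVecLin_injective g, fun v => ⟨_, mulVec_inv_mulVec g v⟩⟩), fun i => ?_⟩
  rw [Module.Basis.map_apply, Pi.basisFun_apply]
  rfl

theorem toMatrix_eq_conj {B : Module.Basis (Fin d) ℝ (Fin d → ℝ)} {g : GL (Fin d) ℝ}
    (hg : ∀ i, B i = g.1 *ᵥ Pi.single i 1) (A : Matrix (Fin d) (Fin d) ℝ) :
    LinearMap.toMatrix B B (mulVecLin A) = (g⁻¹ : GL (Fin d) ℝ).1 * A * g.1 := by
  have hrepr : ∀ v, (B.repr v : Fin d → ℝ) = (g⁻¹ : GL (Fin d) ℝ).1 *ᵥ v := by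
    intro v
    have h1 : g.1 *ᵥ (B.repr v : Fin d → ℝ) = v := by
      conv_rhs => rw [← B.sum_repr v]
      simp only [hg, ← mulVec_smul, ← mulVec_sum]
      congr 1
      funext i
      simp [Finset.sum_apply, Pi.single_apply]
    rw [← h1, inv_mulVec_mulVec, h1]
  ext i j
  rw [LinearMap.toMatrix_apply, hrepr, hg, mulVecLin_apply, mulVec_mulVec, mulVec_mulVec,
    mulVec_single_one, Matrix.mul_assoc]
  rfl

/-- The product `M_n ⋯ M_j`. -/
def descProd {G : Type*} [Monoid G] (M : ℕ → G) (j n : ℕ) : G :=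
  ((List.Ico j (n + 1)).reverse.map M).prod

theorem descProd_succ_self {G : Type*} [Monoid G] (M : ℕ → G) (n : ℕ) :
    descProd M (n + 1) n = 1 := by
  simp [descProd]

theorem descProd_eq_mul {G : Type*} [Monoid G] (M : ℕ → G) {j n : ℕ} (h : j ≤ n) :
    descProd M j n = descProd M (j + 1) n * M j := by
  rw [descProd, descProd, List.Ico.eq_cons (Nat.lt_succ_of_le h)]
  simp

theorem descProd_mk_conj (g : GL (Fin d) ℝ) {M : ℕ → GL (Fin d) ℝ} {u : ℕ → ProjGL d} {j n : ℕ}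
    (h : ∀ i, j ≤ i → i ≤ n → u i = ProjGenLinGroup.mk (g * M i * g⁻¹)) :
    descProd u j n = ProjGenLinGroup.mk (g * descProd M j n * g⁻¹) := by
  have h1 : ∀ l : List ℕ, (∀ i ∈ l, u i = ProjGenLinGroup.mk (g * M i * g⁻¹)) →
      (l.map u).prod = ProjGenLinGroup.mk (g * (l.map M).prod * g⁻¹) := by
    intro l hl
    induction l with
    | nil => simp
    | cons a l ih =>
      rw [List.map_cons, List.prod_cons, List.map_cons, List.prod_cons, hl a (by simp),
        ih fun i hi => hl i (by simp [hi]), ← map_mul]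
      congr 1
      group
  refine h1 _ fun i hi => ?_
  rw [List.mem_reverse, List.Ico.mem] at hi
  exact h i hi.1 (by omega)

/-- Positivity of a tuple in terms of a frame `g` of the first and the last flag. -/
theorem isPositiveTuple_iff_frame {m : ℕ} {F : Fin (m + 3) → CompleteFlag d} :
    IsPositiveTuple F ↔ ∃ (g : GL (Fin d) ℝ) (M : ℕ → GL (Fin d) ℝ),
      (∀ j, 1 ≤ j → j ≤ m + 1 → IsTotallyPositive (M j).1) ∧ F 0 = g • standard d ∧
      ∀ j : Fin (m + 3), 1 ≤ (j : ℕ) → F j = (g * descProd M j (m + 1)) • opposite d := by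
  constructor
  · rintro ⟨-, B, u, hu, hB, hF⟩
    obtain ⟨g, hg⟩ := exists_frame_of_basis B
    have h0 : F 0 = g • standard d := by
      symm
      refine eq_of_le fun k v hv => ?_
      obtain ⟨w, hw, rfl⟩ := hv
      rw [SetLike.mem_coe, mem_standard_space] at hw
      rw [mulVecLin_apply, ← Finset.univ_sum_single w, mulVec_sum]
      refine Submodule.sum_mem _ fun i _ => ?_
      by_cases hi : (k : ℕ) ≤ i
      · simp [hw i hi]
      · have h1 := (F 0).mono (show i.succ ≤ k by rw [Fin.le_def, Fin.val_succ]; omega) (hB i).1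
        have h2 : Pi.single i (w i) = w i • (Pi.single i 1 : Fin d → ℝ) := by
          rw [← Pi.single_smul, smul_eq_mul, mul_one]
        rw [h2, mulVec_smul, ← hg]
        exact Submodule.smul_mem _ _ h1
    have h1 : F (Fin.last (m + 2)) = g • opposite d := by
      symm
      refine eq_of_le fun k v hv => ?_
      obtain ⟨w, hw, rfl⟩ := hv
      rw [SetLike.mem_coe, mem_opposite_space] at hw
      rw [mulVecLin_apply, ← Finset.univ_sum_single w, mulVec_sum]
      refine Submodule.sum_mem _ fun i _ => ?_
      by_cases hi : (i : ℕ) + k < d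
      · simp [hw i hi]
      · have h1 := (F (Fin.last (m + 2))).mono (show i.castSucc.rev ≤ k by
          rw [Fin.le_def, Fin.val_rev, Fin.val_castSucc]; omega) (hB i).2
        have h2 : Pi.single i (w i) = w i • (Pi.single i 1 : Fin d → ℝ) := by
          rw [← Pi.single_smul, smul_eq_mul, mul_one]
        rw [h2, mulVec_smul, ← hg]
        exact Submodule.smul_mem _ _ h1
    have h2 : ∀ j, ∃ M : GL (Fin d) ℝ, 1 ≤ j → j ≤ m + 1 →
        IsTotallyPositive M.1 ∧ u j = ProjGenLinGroup.mk (g * M * g⁻¹) := by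
      intro j
      by_cases hj : 1 ≤ j ∧ j ≤ m + 1
      · obtain ⟨A, hA, hpos⟩ := hu j hj.1 hj.2
        refine ⟨g⁻¹ * A * g, fun _ _ => ⟨?_, ?_⟩⟩
        · rwa [toMatrix_eq_conj hg] at hpos
        · rw [← hA]
          congr 1
          group
      · exact ⟨1, fun h h' => (hj ⟨h, h'⟩).elim⟩
    choose M hM using h2
    refine ⟨g, M, fun j hj hj' => (hM j hj hj').1, h0, fun j hj => ?_⟩
    rcases (Nat.lt_succ_iff.1 j.is_lt).eq_or_lt with hlast | hlt
    · have hj2 : j = Fin.last (m + 2) := Fin.ext hlast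
      rw [hj2, Fin.val_last, descProd_succ_self, mul_one, h1]
    · rw [hF j hj (by omega), h1]
      change descProd u j (m + 1) • _ = _
      rw [descProd_mk_conj g fun i hi hi' => (hM i (by omega) hi').2]
      change (g * descProd M j (m + 1) * g⁻¹) • g • opposite d = _
      rw [smul_smul, inv_mul_cancel_right]
  · rintro ⟨g, M, hM, h0, hF⟩
    have h1 : F (Fin.last (m + 2)) = g • opposite d := by
      have h := hF (Fin.last (m + 2)) (by simp)
      rwa [Fin.val_last, descProd_succ_self, mul_one] at h
    obtain ⟨B, hB⟩ := exists_basis_of_frame g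
    refine ⟨?_, B, fun j => ProjGenLinGroup.mk (g * M j * g⁻¹), ?_, ?_, ?_⟩
    · rw [h0, h1]
      exact isTransverse_standard_opposite.smul g
    · intro j hj hj'
      refine ⟨_, rfl, ?_⟩
      rw [toMatrix_eq_conj hB, ← Units.val_mul, ← Units.val_mul]
      convert hM j hj hj' using 2
      group
    · intro i
      rw [hB, h0, h1]
      constructor
      · refine mulVec_mem_smul_space (mem_standard_space.2 fun l hl => ?_)
        rw [Fin.val_succ] at hl
        exact Pi.single_eq_of_ne (by rintro rfl; omega) _
      · refine mulVec_mem_smul_space (mem_opposite_space.2 fun l hl => ?_)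
        rw [Fin.val_rev, Fin.val_castSucc] at hl
        exact Pi.single_eq_of_ne (by rintro rfl; omega) _
    · intro j hj hj'
      change F j = descProd (fun j => ProjGenLinGroup.mk (g * M j * g⁻¹)) j (m + 1) • _
      rw [descProd_mk_conj g fun i _ _ => rfl, hF j hj, h1]
      change _ = (g * descProd M j (m + 1) * g⁻¹) • g • opposite d
      rw [smul_smul, inv_mul_cancel_right]

/-! ### A criterion for positivity in the affine chart -/

theorem diag_ne_zero {D : GL (Fin d) ℝ} (hD : ∀ i j, i ≠ j → D i j = 0) (i : Fin d) :
    D i i ≠ 0 := by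
  have h1 : D.1 = diagonal fun i => D i i := by
    ext a b
    rcases eq_or_ne a b with rfl | h
    · rw [diagonal_apply_eq]
    · rw [diagonal_apply_ne _ h, hD a b h]
  have h2 := D.det_ne_zero
  rw [h1, det_diagonal] at h2
  exact Finset.prod_ne_zero_iff.1 h2 i (Finset.mem_univ i)

theorem conj_diagonal_apply {D : GL (Fin d) ℝ} (hD : ∀ i j, i ≠ j → D i j = 0) (v : GL (Fin d) ℝ)
    (i j : Fin d) : (D * v * D⁻¹ : GL (Fin d) ℝ) i j = D i i * v i j * (D j j)⁻¹ := by
  have h1 : ((D * v * D⁻¹ * D : GL (Fin d) ℝ)).1 i j = (D * v : GL (Fin d) ℝ).1 i j := by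
    rw [inv_mul_cancel_right]
  rw [Units.val_mul _ D, mul_apply, Finset.sum_eq_single j (fun l _ hl => by rw [hD l j hl, mul_zero])
    (by simp), Units.val_mul D v, mul_apply,
    Finset.sum_eq_single i (fun l _ hl => by rw [hD i l hl.symm, zero_mul]) (by simp)] at h1
  exact (eq_mul_inv_iff_mul_eq₀ (diag_ne_zero hD j)).2 h1

theorem conj_diagonal_mem {D : GL (Fin d) ℝ} (hD : ∀ i j, i ≠ j → D i j = 0) {v : GL (Fin d) ℝ}
    (hv : v ∈ upperUnipotent d) : D * v * D⁻¹ ∈ upperUnipotent d := by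
  constructor
  · intro i j h
    rw [conj_diagonal_apply hD, hv.1 i j h, mul_zero, zero_mul]
  · intro i
    rw [conj_diagonal_apply hD, hv.2, mul_one, mul_inv_cancel₀ (diag_ne_zero hD i)]

theorem diagonal_smul_standard {D : GL (Fin d) ℝ} (hD : ∀ i j, i ≠ j → D i j = 0) :
    D • standard d = standard d := smul_standard_eq_iff.2 fun i j h => hD i j h.ne'

theorem diagonal_smul_opposite {D : GL (Fin d) ℝ} (hD : ∀ i j, i ≠ j → D i j = 0) :
    D • opposite d = opposite d := smul_opposite_eq_iff.2 fun i j h => hD i j h.ne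

theorem isDiagonal_of_smul {D : GL (Fin d) ℝ} (h1 : D • standard d = standard d)
    (h2 : D • opposite d = opposite d) : ∀ i j, i ≠ j → D i j = 0 := fun i j h =>
  (lt_or_gt_of_ne h).elim (smul_opposite_eq_iff.1 h2 i j) (smul_standard_eq_iff.1 h1 i j)

/-- Conjugation of a matrix by the diagonal matrix with entries `s i = ±1`. -/
def signConj (s : Fin d → ℤˣ) (M : Matrix (Fin d) (Fin d) ℝ) : Matrix (Fin d) (Fin d) ℝ :=
  Matrix.of fun i j => ((s i : ℤ) : ℝ) * M i j * ((s j : ℤ) : ℝ)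

theorem sign_mul_self (s : ℤˣ) : ((s : ℤ) : ℝ) * ((s : ℤ) : ℝ) = 1 := by
  rw [← Int.cast_mul, ← Units.val_mul, Int.units_mul_self]
  simp

theorem _root_.IsTotallyPositive.conj_diagonal {M : Matrix (Fin d) (Fin d) ℝ}
    (hM : IsTotallyPositive M) {p : Fin d → ℝ} (hp : ∀ i, 0 < p i) :
    IsTotallyPositive (Matrix.of fun i j => p i * M i j * (p j)⁻¹) := by
  refine ⟨fun i j h => ?_, fun i => ?_, fun k I J hI hJ hIJ => ?_⟩
  · simp [hM.1 i j h]
  · simp [hM.2.1 i, (hp i).ne']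
  · have h1 : (Matrix.of fun i j => p i * M i j * (p j)⁻¹).submatrix I J =
        Matrix.of fun a b => p (I a) * (Matrix.of fun a b => (p (J b))⁻¹ *
          M.submatrix I J a b) a b := by
      ext a b
      simp only [submatrix_apply, of_apply]
      ring
    rw [h1, det_mul_column, det_mul_row]
    exact mul_pos (Finset.prod_pos fun a _ => hp _)
      (mul_pos (Finset.prod_pos fun a _ => inv_pos.2 (hp _)) (hM.2.2 k I J hI hJ hIJ))

/-- The diagonal matrix with entries `s i = ±1`. -/
def signMatrix (s : Fin d → ℤˣ) : GL (Fin d) ℝ :=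
  have h : (diagonal fun i => ((s i : ℤ) : ℝ)) * (diagonal fun i => ((s i : ℤ) : ℝ)) = 1 := by
    rw [diagonal_mul_diagonal]
    simp only [sign_mul_self]
    exact diagonal_one
  ⟨diagonal fun i => ((s i : ℤ) : ℝ), diagonal fun i => ((s i : ℤ) : ℝ), h, h⟩

theorem signMatrix_apply_of_ne (s : Fin d → ℤˣ) (i j : Fin d) (h : i ≠ j) :
    signMatrix s i j = 0 := diagonal_apply_ne _ h

theorem signMatrix_conj (s : Fin d → ℤˣ) (M : GL (Fin d) ℝ) :
    (signMatrix s * M * (signMatrix s)⁻¹ : GL (Fin d) ℝ).1 = signConj s M.1 := by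
  ext i j
  rw [conj_diagonal_apply (signMatrix_apply_of_ne s)]
  have h : ∀ i, signMatrix s i i = ((s i : ℤ) : ℝ) := fun i => diagonal_apply_eq _ i
  rw [h, h, signConj, of_apply, inv_eq_of_mul_eq_one_left (sign_mul_self (s j))]

/-- In the affine chart of flags transverse to the first one, positivity of a tuple means that
consecutive coordinates differ by totally positive matrices, up to a common change of the signs of
the basis vectors. -/
theorem isPositiveTuple_iff_chart {m : ℕ} {F : Fin (m + 3) → CompleteFlag d} {h : GL (Fin d) ℝ}
    {y : ℕ → GL (Fin d) ℝ} (hy : ∀ j, 1 ≤ j → j ≤ m + 2 → y j ∈ upperUnipotent d)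
    (h0 : F 0 = h • standard d)
    (hF : ∀ j : Fin (m + 3), 1 ≤ (j : ℕ) → F j = (h * y j) • opposite d) :
    IsPositiveTuple F ↔ ∃ s : Fin d → ℤˣ, ∀ j, 1 ≤ j → j ≤ m + 1 →
      IsTotallyPositive (signConj s ((y (j + 1))⁻¹ * y j : GL (Fin d) ℝ).1) := by
  have hylast := hy (m + 2) (by omega) le_rfl
  rw [isPositiveTuple_iff_frame]
  constructor
  · rintro ⟨g, M, hM, hg0, hgF⟩
    have hMU : ∀ j, 1 ≤ j → j ≤ m + 1 → M j ∈ upperUnipotent d := fun j hj hj' =>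
      ⟨(hM j hj hj').1, (hM j hj hj').2.1⟩
    have hv : ∀ j, j ≤ m + 2 → 1 ≤ j → descProd M j (m + 1) ∈ upperUnipotent d := by
      intro j hj
      induction hj using Nat.decreasingInduction with
      | self => intro _; rw [descProd_succ_self]; exact one_mem _
      | of_succ k hk ih =>
        intro h1
        rw [descProd_eq_mul M (by omega)]
        exact mul_mem (ih (by omega)) (hMU k h1 (by omega))
    set D : GL (Fin d) ℝ := (h * y (m + 2))⁻¹ * g with hDdef
    have hgD : g = h * y (m + 2) * D := by rw [hDdef, mul_inv_cancel_left]
    have hD : ∀ i j, i ≠ j → D i j = 0 := by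
      apply isDiagonal_of_smul
      · rw [hDdef, mul_smul, inv_smul_eq_iff, ← hg0, h0, mul_smul, smul_standard_of_mem hylast]
      · have h1 := hgF (Fin.last (m + 2)) (by simp)
        rw [hF _ (by simp), Fin.val_last, descProd_succ_self, mul_one] at h1
        rw [hDdef, mul_smul, inv_smul_eq_iff, h1]
    have hyv : ∀ j, 1 ≤ j → j ≤ m + 2 →
        (y (m + 2))⁻¹ * y j = D * descProd M j (m + 1) * D⁻¹ := by
      intro j hj hj'
      refine eq_of_smul_opposite_eq (mul_mem (inv_mem hylast) (hy j hj hj'))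
        (conj_diagonal_mem hD (hv j hj' hj)) ?_
      have h1 := hgF ⟨j, by omega⟩ hj
      rw [hF _ hj] at h1
      change (h * y j) • opposite d = (g * descProd M j (m + 1)) • opposite d at h1
      have h2 : (D * descProd M j (m + 1) * D⁻¹) • opposite d =
          (D * descProd M j (m + 1)) • opposite d := by
        rw [mul_smul _ D⁻¹, inv_smul_eq_iff.2 (diagonal_smul_opposite hD).symm]
      rw [h2, mul_smul, inv_smul_eq_iff, smul_smul]
      apply MulAction.injective h
      change h • y j • opposite d = h • (y (m + 2) * (D * descProd M j (m + 1))) • opposite d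
      rw [smul_smul, h1, smul_smul, hgD]
      simp only [mul_assoc]
    have hN : ∀ j, 1 ≤ j → j ≤ m + 1 → (y (j + 1))⁻¹ * y j = D * M j * D⁻¹ := by
      intro j hj hj'
      have h1 := hyv j hj (by omega)
      have h2 := hyv (j + 1) (by omega) (by omega)
      rw [descProd_eq_mul M hj'] at h1
      calc (y (j + 1))⁻¹ * y j = ((y (m + 2))⁻¹ * y (j + 1))⁻¹ * ((y (m + 2))⁻¹ * y j) := by group
        _ = _ := by rw [h1, h2]; group
    refine ⟨fun i => if 0 < D i i then 1 else -1, fun j hj hj' => ?_⟩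
    convert (hM j hj hj').conj_diagonal (p := fun i => |D i i|)
      (fun i => abs_pos.2 (diag_ne_zero hD i)) using 1
    ext a b
    rw [hN j hj hj', signConj, of_apply, of_apply, conj_diagonal_apply hD]
    have hs : ∀ i, |D i i| = (((if 0 < D i i then 1 else -1 : ℤˣ) : ℤ) : ℝ) * D i i := by
      intro i
      split_ifs with hi
      · simp [abs_of_pos hi]
      · simp [abs_of_nonpos (not_lt.1 hi)]
    have hs' : ∀ i, |D i i|⁻¹ = (D i i)⁻¹ * (((if 0 < D i i then 1 else -1 : ℤˣ) : ℤ) : ℝ) := by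
      intro i
      rw [hs, mul_inv, mul_comm, inv_eq_of_mul_eq_one_left (sign_mul_self _)]
    rw [hs' b, hs a]
    ring
  · rintro ⟨s, hs⟩
    set D := signMatrix s
    have hD : ∀ i j, i ≠ j → D i j = 0 := signMatrix_apply_of_ne s
    refine ⟨h * y (m + 2) * D⁻¹, fun j => D * ((y (j + 1))⁻¹ * y j) * D⁻¹, ?_, ?_, ?_⟩
    · intro j hj hj'
      rw [signMatrix_conj]
      exact hs j hj hj'
    · rw [mul_smul, inv_smul_eq_iff.2 (diagonal_smul_standard hD).symm, mul_smul,
        smul_standard_of_mem hylast, h0]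
    · intro j hj
      have h1 : ∀ j, j ≤ m + 2 →
          descProd (fun j => D * ((y (j + 1))⁻¹ * y j) * D⁻¹) j (m + 1) =
            D * ((y (m + 2))⁻¹ * y j) * D⁻¹ := by
        intro j hj
        induction hj using Nat.decreasingInduction with
        | self => rw [descProd_succ_self]; group
        | of_succ k hk ih =>
          rw [descProd_eq_mul _ (by omega), ih]
          group
      rw [h1 j (by omega), hF j hj]
      have h2 : h * y (m + 2) * D⁻¹ * (D * ((y (m + 2))⁻¹ * y j) * D⁻¹) = h * y j * D⁻¹ := by group
      rw [h2, mul_smul _ D⁻¹, inv_smul_eq_iff.2 (diagonal_smul_opposite hD).symm]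

end CompleteFlag

/-! ### Positivity is open and closed among pairwise transverse tuples -/

namespace CompleteFlag

open Matrix TotalPositivity

variable {d : ℕ}

theorem mulVec_extend {n : ℕ} (A : Matrix (Fin d) (Fin d) ℝ) {J : Fin n → Fin d}
    (hJ : Function.Injective J) (w : Fin n → ℝ) (i : Fin d) :
    (A *ᵥ Function.extend J w 0) i = ∑ p, A i (J p) * w p := by
  symm
  refine Fintype.sum_of_injective J hJ _ _ (fun l hl => ?_) fun p => ?_
  · rw [Function.extend_apply' _ _ _ (by simpa using hl), Pi.zero_apply, mul_zero]
  · rw [hJ.extend_apply]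

/-- If `u` moves the opposite flag to a flag transverse to it, then the upper right corner minors
of `u` do not vanish. -/
theorem corner_ne_zero {u : GL (Fin d) ℝ} (hu : (opposite d).IsTransverse (u • opposite d))
    {n : ℕ} {I J : Fin n → Fin d} (hI : ∀ p, (I p : ℕ) = p) (hJ : ∀ p, (J p : ℕ) + n = d + p) :
    (u.1.submatrix I J).det ≠ 0 := by
  intro h0
  obtain ⟨w, hw, hGw⟩ := exists_mulVec_eq_zero_iff.2 h0
  have hnd : n ≤ d := by
    have := Fintype.card_le_of_injective I fun p q h => Fin.ext (by rw [← hI, ← hI, h])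
    simpa using this
  have hJinj : Function.Injective J := fun p q h => by
    have hp := hJ p
    have hq := hJ q
    rw [h] at hp
    exact Fin.ext (by omega)
  let W : Fin d → ℝ := Function.extend J w 0
  let k : Fin (d + 1) := ⟨d - n, by omega⟩
  have hW : W ∈ (opposite d).space k.rev := by
    rw [mem_opposite_space]
    intro i hi
    simp only [Fin.val_rev, k] at hi
    refine Function.extend_apply' _ _ _ ?_
    rintro ⟨p, rfl⟩
    have := hJ p
    omega
  have huW : u.1 *ᵥ W ∈ (opposite d).space k := by
    rw [mem_opposite_space]
    intro i hi
    simp only [k] at hi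
    rw [mulVec_extend _ hJinj]
    have hIi : I ⟨i, by omega⟩ = i := Fin.ext (hI _)
    have h := congrFun hGw ⟨i, by omega⟩
    simp only [mulVec, dotProduct, submatrix_apply, hIi, Pi.zero_apply] at h
    exact h
  have h1 := isTransverse_iff.1 hu k _ huW (mulVec_mem_smul_space hW)
  have h2 : W = 0 := by rw [← inv_mulVec_mulVec u W, h1, mulVec_zero]
  apply hw
  funext p
  rw [← hJinj.extend_apply w 0 p]
  exact congrFun h2 (J p)

theorem signConj_of_mem (s : Fin d → ℤˣ) {y : GL (Fin d) ℝ} (hy : y ∈ upperUnipotent d) :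
    (∀ i j, j < i → signConj s y.1 i j = 0) ∧ ∀ i, signConj s y.1 i i = 1 := by
  refine ⟨fun i j h => ?_, fun i => ?_⟩
  · rw [signConj, of_apply, hy.1 i j h, mul_zero, zero_mul]
  · rw [signConj, of_apply, hy.2, mul_one, sign_mul_self]

theorem continuousAt_minor {X : Type*} [TopologicalSpace X] {N : X → GL (Fin d) ℝ} {t : X}
    (hN : ContinuousAt N t) (s : Fin d → ℤˣ) {k : ℕ} (I J : Fin k → Fin d) :
    ContinuousAt (fun t => ((signConj s (N t).1).submatrix I J).det) t := by
  have h : Continuous fun g : GL (Fin d) ℝ => ((signConj s g.1).submatrix I J).det := by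
    refine Continuous.matrix_det (continuous_matrix fun a b => ?_)
    exact (continuous_const.mul (continuous_entry _ _)).mul continuous_const
  exact h.continuousAt.comp hN

/-- Only finitely many minors have to be considered, since those of size larger than `d` have no
strictly increasing families of indices. -/
theorem eventually_isTotallyPositive {X : Type*} [TopologicalSpace X] {N : X → GL (Fin d) ℝ}
    {t₀ : X} (hN : ContinuousAt N t₀) (hU : ∀ᶠ t in 𝓝 t₀, N t ∈ upperUnipotent d)
    {s : Fin d → ℤˣ} (h : IsTotallyPositive (signConj s (N t₀).1)) :
    ∀ᶠ t in 𝓝 t₀, IsTotallyPositive (signConj s (N t).1) := by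
  have h1 : ∀ᶠ t in 𝓝 t₀, ∀ (k : Fin (d + 1)) (I J : Fin k → Fin d), StrictMono I →
      StrictMono J → (∀ p, I p ≤ J p) → 0 < ((signConj s (N t).1).submatrix I J).det := by
    simp only [eventually_all]
    intro k I J hI hJ hIJ
    exact (continuousAt_minor hN s I J).eventually_const_lt (h.2.2 k I J hI hJ hIJ)
  filter_upwards [h1, hU] with t ht htU
  refine ⟨(signConj_of_mem s htU).1, (signConj_of_mem s htU).2, fun k I J hI hJ hIJ => ?_⟩
  have hk : k ≤ d := by
    simpa using Fintype.card_le_of_injective I hI.injective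
  exact ht ⟨k, by omega⟩ I J hI hJ hIJ

/-- Total positivity passes to limits `u` for which `u` moves the opposite flag to a flag transverse
to it: the limit is totally nonnegative, and its corner minors do not vanish. -/
theorem isTotallyPositive_of_frequently {X : Type*} [TopologicalSpace X] {N : X → GL (Fin d) ℝ}
    {t₀ : X} (hN : ContinuousAt N t₀) (hU : N t₀ ∈ upperUnipotent d)
    (htr : (opposite d).IsTransverse (N t₀ • opposite d)) {s : Fin d → ℤˣ}
    (h : ∃ᶠ t in 𝓝 t₀, IsTotallyPositive (signConj s (N t).1)) :
    IsTotallyPositive (signConj s (N t₀).1) := by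
  obtain ⟨hup, hone⟩ := signConj_of_mem s hU
  refine isTotallyPositive_of_corner_ne_zero ?_ hup hone ?_
  · intro n I J hI hJ
    by_cases hIJ : ∀ p, I p ≤ J p
    · exact ge_of_tendsto_of_frequently (continuousAt_minor hN s I J)
        (h.mono fun t ht => (ht.2.2 n I J hI hJ hIJ).le)
    · push Not at hIJ
      obtain ⟨p, hp⟩ := hIJ
      exact (det_submatrix_eq_zero_of_lt hup hI hJ hp).ge
  · intro n I J hI hJ
    have h1 : (signConj s (N t₀).1).submatrix I J = Matrix.of fun a b =>
        ((s (I a) : ℤ) : ℝ) * (Matrix.of fun a b => ((s (J b) : ℤ) : ℝ) *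
          (N t₀).1.submatrix I J a b) a b := by
      ext a b
      simp only [submatrix_apply, of_apply, signConj]
      ring
    rw [h1, det_mul_column, det_mul_row]
    have hs : ∀ i, ((s i : ℤ) : ℝ) ≠ 0 := fun i => left_ne_zero_of_mul_eq_one (sign_mul_self (s i))
    exact mul_ne_zero (Finset.prod_ne_zero_iff.2 fun a _ => hs _)
      (mul_ne_zero (Finset.prod_ne_zero_iff.2 fun a _ => hs _) (corner_ne_zero htr hI hJ))

/-- A continuous family of pairwise transverse tuples has a continuous description in the affine
charts of its first members. -/
theorem exists_local_chart {X : Type*} [TopologicalSpace X] {m : ℕ}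
    {f : Fin (m + 3) → X → CompleteFlag d} (hf : ∀ i, Continuous (f i))
    (htr : ∀ t i j, i ≠ j → (f i t).IsTransverse (f j t)) (t₀ : X) :
    ∃ N : ℕ → X → GL (Fin d) ℝ,
      (∀ j, 1 ≤ j → j ≤ m + 1 → ContinuousAt (N j) t₀) ∧
      ∀ᶠ t in 𝓝 t₀,
        (∀ j, 1 ≤ j → j ≤ m + 1 → N j t ∈ upperUnipotent d ∧
          (opposite d).IsTransverse (N j t • opposite d)) ∧
        (IsPositiveTuple (fun i => f i t) ↔ ∃ s : Fin d → ℤˣ, ∀ j, 1 ≤ j → j ≤ m + 1 →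
          IsTotallyPositive (signConj s (N j t).1)) := by
  obtain ⟨h, hc, hh⟩ := exists_continuousAt_lift (hf 0).continuousAt (x := t₀)
  let y : ℕ → X → GL (Fin d) ℝ := fun j t =>
    if hj : j < m + 3 then chart ((h t)⁻¹ • f ⟨j, hj⟩ t) else 1
  have hy : ∀ j (hj : j < m + 3) t, y j t = chart ((h t)⁻¹ • f ⟨j, hj⟩ t) :=
    fun j hj t => dif_pos hj
  have htr' : ∀ t, h t • standard d = f 0 t → ∀ j (hj : j < m + 3), 1 ≤ j →
      (standard d).IsTransverse ((h t)⁻¹ • f ⟨j, hj⟩ t) := by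
    intro t ht j hj hj1
    rw [← isTransverse_smul_iff (h t), ht, smul_inv_smul]
    exact htr t _ _ (by rw [ne_eq, Fin.ext_iff]; simp; omega)
  have hyc : ∀ j, 1 ≤ j → j < m + 3 → ContinuousAt (y j) t₀ := by
    intro j hj1 hj
    have h1 : ContinuousAt (fun t => (h t)⁻¹ • f ⟨j, hj⟩ t) t₀ :=
      hc.inv.smul (hf _).continuousAt
    have h2 : ContinuousAt (fun t => chart ((h t)⁻¹ • f ⟨j, hj⟩ t)) t₀ :=
      ContinuousAt.comp (f := fun t => (h t)⁻¹ • f ⟨j, hj⟩ t)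
        (continuousAt_chart (htr' t₀ hh.self_of_nhds j hj hj1)) h1
    simpa only [← hy j hj] using h2
  refine ⟨fun j t => (y (j + 1) t)⁻¹ * y j t, fun j hj hj' =>
    (hyc (j + 1) (by omega) (by omega)).inv.mul (hyc j hj (by omega)), ?_⟩
  filter_upwards [hh] with t ht
  have hyU : ∀ j, 1 ≤ j → j ≤ m + 2 → y j t ∈ upperUnipotent d := fun j hj hj' => by
    rw [hy j (by omega)]
    exact chart_mem (htr' t ht j (by omega) hj)
  have hyF : ∀ j : Fin (m + 3), 1 ≤ (j : ℕ) → f j t = (h t * y j t) • opposite d := by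
    intro j hj
    rw [hy j j.is_lt, mul_smul, chart_smul_opposite (htr' t ht j j.is_lt hj), smul_inv_smul]
  have hpos := isPositiveTuple_iff_chart (F := fun i => f i t) (y := fun j => y j t) hyU ht.symm hyF
  refine ⟨fun j hj hj' => ⟨mul_mem (inv_mem (hyU _ (by omega) (by omega)))
    (hyU _ hj (by omega)), ?_⟩, hpos⟩
  rw [← isTransverse_smul_iff (h t * y (j + 1) t), smul_smul]
  have h1 := hyF ⟨j + 1, by omega⟩ (by simp)
  have h2 := hyF ⟨j, by omega⟩ hj
  have h3 := htr t ⟨j + 1, by omega⟩ ⟨j, by omega⟩ (by rw [ne_eq, Fin.ext_iff]; simp)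
  rw [h1, h2] at h3
  convert h3 using 2
  group

/-- In a continuous family of tuples of pairwise transverse flags, positivity is an open and closed
condition. -/
theorem isClopen_isPositiveTuple {X : Type*} [TopologicalSpace X] {m : ℕ}
    {f : Fin (m + 3) → X → CompleteFlag d} (hf : ∀ i, Continuous (f i))
    (htr : ∀ t i j, i ≠ j → (f i t).IsTransverse (f j t)) :
    IsClopen {t | IsPositiveTuple fun i => f i t} := by
  constructor
  · refine isClosed_of_closure_subset fun t₀ ht₀ => ?_
    rw [mem_closure_iff_frequently] at ht₀
    obtain ⟨N, hN, hev⟩ := exists_local_chart hf htr t₀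
    rw [mem_ofPred_eq, hev.self_of_nhds.2]
    have h1 : ∃ᶠ t in 𝓝 t₀, ∃ s : Fin d → ℤˣ, ∀ j, 1 ≤ j → j ≤ m + 1 →
        IsTotallyPositive (signConj s (N j t).1) :=
      (ht₀.and_eventually hev).mono fun t ht => ht.2.2.1 ht.1
    -- there are finitely many choices of signs, so one of them occurs frequently
    obtain ⟨s, hs⟩ : ∃ s : Fin d → ℤˣ, ∃ᶠ t in 𝓝 t₀, ∀ j, 1 ≤ j → j ≤ m + 1 →
        IsTotallyPositive (signConj s (N j t).1) := by
      by_contra hcon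
      refine h1 ?_
      simp only [not_exists] at hcon ⊢
      exact eventually_all.2 fun s => not_frequently.1 (hcon s)
    refine ⟨s, fun j hj hj' => ?_⟩
    have h2 := hev.self_of_nhds.1 j hj hj'
    exact isTotallyPositive_of_frequently (hN j hj hj') h2.1 h2.2 (hs.mono fun t ht => ht j hj hj')
  · rw [isOpen_iff_mem_nhds]
    intro t₀ ht₀
    obtain ⟨N, hN, hev⟩ := exists_local_chart hf htr t₀
    obtain ⟨s, hs⟩ := hev.self_of_nhds.2.1 ht₀
    have h1 : ∀ᶠ t in 𝓝 t₀, ∀ j ∈ Finset.Icc 1 (m + 1),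
        IsTotallyPositive (signConj s (N j t).1) := by
      rw [eventually_all_finset]
      intro j hj
      obtain ⟨hj, hj'⟩ := Finset.mem_Icc.1 hj
      exact eventually_isTotallyPositive (hN j hj hj') (hev.mono fun t ht => (ht.1 j hj hj').1)
        (hs j hj hj')
    filter_upwards [h1, hev] with t ht ht'
    exact ht'.2.2 ⟨s, fun j hj hj' => ht j (Finset.mem_Icc.2 ⟨hj, hj'⟩)⟩

end CompleteFlag

/-! ### Attracting fixed flags and positive triples -/

namespace CompleteFlag

open Matrix TotalPositivity

variable {d : ℕ}

theorem IsTransverse.exists_frame {F G : CompleteFlag d} (h : F.IsTransverse G) :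
    ∃ c : GL (Fin d) ℝ, F = c • opposite d ∧ G = c • standard d := by
  obtain ⟨a, rfl⟩ := exists_smul_standard G
  have h1 : (standard d).IsTransverse (a⁻¹ • F) := by
    rw [← isTransverse_smul_iff a, smul_inv_smul]
    exact h.symm
  refine ⟨a * chart (a⁻¹ • F), ?_, ?_⟩
  · rw [mul_smul, chart_smul_opposite h1, smul_inv_smul]
  · rw [mul_smul, smul_standard_of_mem (chart_mem h1)]

variable (d) in
/-- The upper triangular matrix with all entries on and above the diagonal equal to `1`. -/
noncomputable def upperOnes : GL (Fin d) ℝ :=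
  GeneralLinearGroup.mkOfDetNeZero (Matrix.of fun i j => if i ≤ j then 1 else 0) (by
    rw [det_of_isUpperTriangular]
    · simp
    · intro i j h
      simp only [of_apply]
      exact if_neg (not_le.2 h))

theorem upperOnes_apply_of_le {i j : Fin d} (h : i ≤ j) : upperOnes d i j = 1 := if_pos h

theorem upperOnes_mem : upperOnes d ∈ upperUnipotent d :=
  ⟨fun _ _ h => if_neg (not_le.2 h), fun _ => upperOnes_apply_of_le le_rfl⟩

theorem pow_diagonal_apply {D : GL (Fin d) ℝ} (hD : ∀ i j, i ≠ j → D i j = 0) (n : ℕ) :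
    (∀ i j, i ≠ j → (D ^ n) i j = 0) ∧ ∀ i, (D ^ n) i i = D i i ^ n := by
  have h1 : D.1 = diagonal fun i => D i i := by
    ext a b
    rcases eq_or_ne a b with rfl | h
    · rw [diagonal_apply_eq]
    · rw [diagonal_apply_ne _ h, hD a b h]
  have h2 : (D ^ n : GL (Fin d) ℝ).1 = diagonal fun i => D i i ^ n := by
    rw [Units.val_pow_eq_pow_val, h1, diagonal_pow]
    congr 1
    funext i
    simp
  exact ⟨fun i j h => by rw [h2, diagonal_apply_ne _ h], fun i => by rw [h2, diagonal_apply_eq]⟩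

/-- If the powers of a diagonal matrix attract to the opposite flag all flags transverse to the
standard one, then the diagonal entries are distinct. -/
theorem diagonal_injective_of_tendsto {D : GL (Fin d) ℝ} (hD : ∀ i j, i ≠ j → D i j = 0)
    (h : ∀ F : CompleteFlag d, F.IsTransverse (standard d) →
      Tendsto (fun n : ℕ => D ^ n • F) atTop (𝓝 (opposite d))) :
    Function.Injective fun i => D i i := by
  have key : ∀ i j, i < j → D i i ≠ D j j := by
    intro i j hij heq
    -- if two eigenvalues agree, conjugation by `D ^ n` fixes the corresponding entry of a unipotent
    -- matrix, so a flag whose coordinate has a nonzero entry there is not attracted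
    have h1 := h (upperOnes d • opposite d) (isTransverse_of_mem upperOnes_mem).symm
    have hDn := fun n => pow_diagonal_apply hD n
    have h2 : ∀ n : ℕ, D ^ n • upperOnes d • opposite d =
        (D ^ n * upperOnes d * (D ^ n)⁻¹) • opposite d := by
      intro n
      rw [mul_smul _ (D ^ n)⁻¹, inv_smul_eq_iff.2 (diagonal_smul_opposite (hDn n).1).symm, mul_smul]
    simp only [h2] at h1
    have h3 := (continuousAt_chart isTransverse_standard_opposite).tendsto.comp h1
    have h4 : chart (opposite d) = 1 := by
      have := chart_smul (one_mem (upperUnipotent d))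
      rwa [one_smul] at this
    rw [h4] at h3
    have h5 := ((continuous_entry i j).tendsto _).comp h3
    have h6 : ∀ n : ℕ, ((fun g : GL (Fin d) ℝ => g.1 i j) ∘ chart ∘
        fun n : ℕ => (D ^ n * upperOnes d * (D ^ n)⁻¹) • opposite d) n = 1 := by
      intro n
      simp only [Function.comp_apply]
      rw [chart_smul (conj_diagonal_mem (hDn n).1 upperOnes_mem), conj_diagonal_apply (hDn n).1,
        upperOnes_apply_of_le hij.le, (hDn n).2, (hDn n).2, heq, mul_one, mul_inv_cancel₀]
      exact pow_ne_zero _ (diag_ne_zero hD j)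
    have h7 := tendsto_nhds_unique (h5.congr h6) tendsto_const_nhds
    rw [Units.val_one, one_apply_ne hij.ne] at h7
    exact zero_ne_one h7
  intro i j h
  by_contra hne
  rcases lt_or_gt_of_ne hne with h1 | h1
  · exact key i j h1 h
  · exact key j i h1 h.symm

theorem add_le_of_strictMono {n : ℕ} {I : Fin n → Fin d} (hI : StrictMono I) (a : Fin n) :
    (I a : ℕ) + n ≤ d + a := by
  have h := Finset.card_le_card_of_injOn (s := Finset.Ici a) (t := Finset.Ici (I a)) I
    (fun b hb => by simpa using hI.monotone (by simpa using hb)) hI.injective.injOn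
  rw [Fin.card_Ici, Fin.card_Ici] at h
  omega

/-- A totally positive matrix moves the opposite flag to a flag transverse to all coordinate
flags. These are the images of the standard flag under monomial matrices `P`. -/
theorem isTransverse_monomial {M P : GL (Fin d) ℝ} (hM : IsTotallyPositive M.1)
    {π : Fin d → Fin d} (hπ : Function.Bijective π) (hP : ∀ i j, j ≠ π i → P i j = 0) :
    (M • opposite d).IsTransverse (P • standard d) := by
  rw [isTransverse_iff]
  intro k v hv hv'
  rw [mem_smul_space, mem_standard_space] at hv'
  rw [mem_smul_space, mem_opposite_space] at hv
  set q := (M⁻¹ : GL (Fin d) ℝ).1 *ᵥ v with hq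
  set p := (P⁻¹ : GL (Fin d) ℝ).1 *ᵥ v with hp
  have hvq : v = M.1 *ᵥ q := (mulVec_inv_mulVec M v).symm
  have hvp : v = P.1 *ᵥ p := (mulVec_inv_mulVec P v).symm
  -- `v` vanishes on the `k` coordinates in `S`
  let S : Finset (Fin d) := Finset.univ.filter fun i => d - k ≤ (π i : ℕ)
  let T : Finset (Fin d) := Finset.univ.filter fun i => d - k ≤ (i : ℕ)
  have hvS : ∀ i ∈ S, v i = 0 := by
    intro i hi
    rw [hvp]
    change ∑ j, P.1 i j * p j = 0
    refine Finset.sum_eq_zero fun j _ => ?_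
    by_cases hj : j = π i
    · rw [hv' j, mul_zero]
      simp only [S, Finset.mem_filter, Finset.mem_univ, true_and] at hi
      have := k.is_lt
      rw [hj, Fin.val_rev]
      omega
    · rw [hP i j hj, zero_mul]
  have hST : S.card = T.card := by
    refine Finset.card_bij (fun i _ => π i) (fun i hi => by simpa [S, T] using hi)
      (fun a _ b _ h => hπ.1 h) fun b hb => ?_
    obtain ⟨a, rfl⟩ := hπ.2 b
    exact ⟨a, by simpa [S, T] using hb, rfl⟩
  have hT : T.card = k := by
    have hk := k.is_lt
    have h1 : T = (Finset.univ.filter fun i : Fin d => (i : ℕ) < d - k)ᶜ := by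
      ext i
      simp [T]
    rw [h1, Finset.card_compl, Fin.card_filter_val_lt, Fintype.card_fin]
    omega
  let I := S.orderEmbOfFin (hST.trans hT)
  let J : Fin k → Fin d := fun a => ⟨d - k + a, by omega⟩
  have hJ : StrictMono J := fun a b h => by
    simp only [J, Fin.lt_def] at h ⊢
    omega
  have hIJ : ∀ a, I a ≤ J a := fun a => by
    have := add_le_of_strictMono I.strictMono a
    simp only [J, Fin.le_def]
    omega
  have hdet := hM.2.2 _ I J I.strictMono hJ hIJ
  have hq0 : ∀ j, j ∉ T → q j = 0 := by
    intro j hj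
    apply hv
    simp only [T, Finset.mem_filter, Finset.mem_univ, true_and] at hj
    omega
  have hqJ : q = Function.extend J (q ∘ J) 0 := by
    funext j
    by_cases hj : ∃ a, J a = j
    · obtain ⟨a, rfl⟩ := hj
      rw [hJ.injective.extend_apply, Function.comp_apply]
    · rw [Function.extend_apply' _ _ _ hj, Pi.zero_apply]
      apply hq0
      intro hjT
      simp only [T, Finset.mem_filter, Finset.mem_univ, true_and] at hjT
      exact hj ⟨⟨j - (d - k), by omega⟩, Fin.ext (by simp only [J]; omega)⟩
  have hzero : M.1.submatrix I J *ᵥ (q ∘ J) = 0 := by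
    funext a
    have h1 := hvS (I a) (Finset.orderEmbOfFin_mem _ _ a)
    rw [hvq, hqJ, mulVec_extend _ hJ.injective] at h1
    exact h1
  have h2 : q ∘ J = 0 := by
    by_contra hne
    exact hdet.ne' (exists_mulVec_eq_zero_iff.1 ⟨_, hne, hzero⟩)
  rw [hvq, hqJ, h2]
  have h3 : Function.extend J (0 : Fin k → ℝ) 0 = 0 := by
    funext j
    by_cases hj : ∃ a, J a = j
    · obtain ⟨a, rfl⟩ := hj
      rw [hJ.injective.extend_apply]
      rfl
    · rw [Function.extend_apply' _ _ _ hj]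
  rw [h3, mulVec_zero]

/-- Let `H` have attracting and repelling fixed flags `X` and `Y`, and let it fix the first and the
last flag of a positive triple. The frame of the triple consists of eigenvectors of `H`, so that
`Y` is one of its coordinate flags, and the flag in the middle of the triple is transverse
to it. -/
theorem isTransverse_of_isPositiveTuple {F : Fin (0 + 3) → CompleteFlag d} (hF : IsPositiveTuple F)
    {H : GL (Fin d) ℝ} (h0 : H • F 0 = F 0) (h2 : H • F 2 = F 2) {X Y : CompleteFlag d}
    (hXY : X.IsTransverse Y) (hX : H • X = X) (hY : H • Y = Y)
    (hdyn : ∀ G : CompleteFlag d, G.IsTransverse Y →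
      Tendsto (fun n : ℕ => H ^ n • G) atTop (𝓝 X)) :
    (F 1).IsTransverse Y := by
  obtain ⟨g, M, hM, hF0, hFj⟩ := isPositiveTuple_iff_frame.1 hF
  have hF2 : F 2 = g • opposite d := by
    have h := hFj 2 (by decide)
    change F 2 = (g * descProd M 2 1) • opposite d at h
    rwa [descProd_succ_self, mul_one] at h
  have hF1 : F 1 = (g * M 1) • opposite d := by
    have h := hFj 1 (by decide)
    change F 1 = (g * descProd M 1 1) • opposite d at h
    rwa [descProd_eq_mul M le_rfl, descProd_succ_self, one_mul] at h
  obtain ⟨c, rfl, rfl⟩ := hXY.exists_frame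
  have hD : ∀ i j, i ≠ j → (g⁻¹ * H * g) i j = 0 := by
    apply isDiagonal_of_smul
    · rw [mul_smul, mul_smul, ← hF0, h0, hF0, inv_smul_smul]
    · rw [mul_smul, mul_smul, ← hF2, h2, hF2, inv_smul_smul]
  have hD' : ∀ i j, i ≠ j → (c⁻¹ * H * c) i j = 0 := by
    apply isDiagonal_of_smul
    · rw [mul_smul, mul_smul, hY, inv_smul_smul]
    · rw [mul_smul, mul_smul, hX, inv_smul_smul]
  set D := g⁻¹ * H * g with hDdef
  set D' := c⁻¹ * H * c with hDdef'
  have hinj : Function.Injective fun i => D' i i := by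
    refine diagonal_injective_of_tendsto hD' fun G hG => ?_
    have h1 := (hdyn (c • G) (hG.smul c)).const_smul c⁻¹
    rw [inv_smul_smul] at h1
    refine h1.congr fun n => ?_
    have h2 : D' ^ n = c⁻¹ * H ^ n * c := by
      have := conj_pow (i := n) (a := c⁻¹) (b := H)
      rwa [inv_inv] at this
    rw [h2, mul_smul, mul_smul]
  set P := g⁻¹ * c with hPdef
  have hDP : ∀ i j, D i i * P i j = P i j * D' j j := by
    intro i j
    have h1 : D * P = P * D' := by
      rw [hDdef, hDdef', hPdef]
      group
    replace h1 : (D.1 * P.1) i j = (P.1 * D'.1) i j := by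
      rw [← Units.val_mul, h1, Units.val_mul]
    rwa [mul_apply, mul_apply, Finset.sum_eq_single i,
      Finset.sum_eq_single j] at h1
    · intro l _ hl
      rw [hD' l j hl, mul_zero]
    · simp
    · intro l _ hl
      rw [hD i l hl.symm, zero_mul]
    · simp
  have hne : ∀ i j, P i j ≠ 0 → D i i = D' j j := fun i j h =>
    mul_right_cancel₀ h ((hDP i j).trans (mul_comm _ _))
  have hrow : ∀ i, ∃ j, P i j ≠ 0 := by
    intro i
    by_contra! hcon
    exact P.det_ne_zero (det_eq_zero_of_row_eq_zero i hcon)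
  have hcol : ∀ j, ∃ i, P i j ≠ 0 := by
    intro j
    by_contra! hcon
    exact P.det_ne_zero (det_eq_zero_of_column_eq_zero j hcon)
  choose π hπ using hrow
  have hP : ∀ i j, j ≠ π i → P i j = 0 := by
    intro i j hj
    by_contra hcon
    exact hj (hinj ((hne i j hcon).symm.trans (hne i _ (hπ i))))
  have hsurj : Function.Surjective π := by
    intro j
    obtain ⟨i, hi⟩ := hcol j
    refine ⟨i, ?_⟩
    by_contra hcon
    exact hi (hP i j (Ne.symm hcon))
  have h1 := (isTransverse_monomial (hM 1 le_rfl le_rfl)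
    (Finite.surjective_iff_bijective.1 hsurj) hP).smul g
  rw [hF1, mul_smul]
  rwa [hPdef, mul_smul, smul_inv_smul] at h1

end CompleteFlag

/-! ### Homogeneous coordinates -/

section ProjPoint

open Matrix

/-- The point `[v 0 : v 1]` of the projective line `K ∪ {∞}`. It is the junk value `∞` if
`v = 0`. -/
def projPoint {K : Type*} [Field K] [DecidableEq K] (v : Fin 2 → K) : OnePoint K :=
  if v 1 = 0 then OnePoint.infty else ((v 0 / v 1 : K) : OnePoint K)

theorem ne_zero_fin_two {K : Type*} [Field K] {v : Fin 2 → K} : v ≠ 0 ↔ v 0 ≠ 0 ∨ v 1 ≠ 0 := by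
  rw [Function.ne_iff, Fin.exists_fin_two]
  rfl

variable {K : Type*} [Field K] [DecidableEq K]

theorem projPoint_surjective (x : OnePoint K) : ∃ v : Fin 2 → K, v ≠ 0 ∧ projPoint v = x := by
  cases x with
  | infty => exact ⟨![1, 0], by simp, by simp [projPoint]⟩
  | coe t => exact ⟨![t, 1], by simp, by simp [projPoint]⟩

theorem projPoint_eq_iff {v w : Fin 2 → K} (hv : v ≠ 0) (hw : w ≠ 0) :
    projPoint v = projPoint w ↔ v 0 * w 1 = v 1 * w 0 := by
  rw [ne_zero_fin_two] at hv hw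
  unfold projPoint
  by_cases h1 : v 1 = 0 <;> by_cases h2 : w 1 = 0
  · simp [h1, h2]
  · simp only [h1, h2, if_true, if_false, OnePoint.infty_ne_coe, zero_mul, mul_eq_zero, or_false,
      false_iff]
    simpa [h1] using hv
  · simp only [h1, h2, if_true, if_false, OnePoint.coe_ne_infty, mul_zero, false_iff, zero_eq_mul,
      false_or]
    simpa [h2] using hw
  · simp only [h1, h2, if_false, OnePoint.coe_eq_coe]
    rw [div_eq_div_iff h1 h2, mul_comm (w 0)]

theorem projPoint_smul_vec {c : K} (hc : c ≠ 0) (v : Fin 2 → K) :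
    projPoint (c • v) = projPoint v := by
  unfold projPoint
  simp only [Pi.smul_apply, smul_eq_mul, mul_eq_zero, hc, false_or, mul_div_mul_left _ _ hc]

theorem smul_projPoint (g : GL (Fin 2) K) {v : Fin 2 → K} (hv : v ≠ 0) :
    g • projPoint v = projPoint (g.1 *ᵥ v) := by
  rw [ne_zero_fin_two] at hv
  simp only [mulVec_fin_two]
  unfold projPoint
  by_cases h1 : v 1 = 0
  · have h0 : v 0 ≠ 0 := by simpa [h1] using hv
    simp only [h1, if_true, OnePoint.smul_infty_eq_ite]
    simp [h0, mul_div_mul_right]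
  · simp only [h1, if_false, OnePoint.smul_some_eq_ite]
    have h2 : g 1 0 * (v 0 / v 1) + g 1 1 = (g 1 0 * v 0 + g 1 1 * v 1) / v 1 := by field_simp
    have h3 : g 0 0 * (v 0 / v 1) + g 0 1 = (g 0 0 * v 0 + g 0 1 * v 1) / v 1 := by field_simp
    simp [h2, h3, h1, div_div_div_cancel_right₀]

theorem continuousAt_projPoint {K : Type*} [NormedField K] [ProperSpace K] [DecidableEq K]
    {v : Fin 2 → K} (hv : v ≠ 0) : ContinuousAt (projPoint : (Fin 2 → K) → OnePoint K) v := by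
  by_cases h1 : v 1 = 0
  · have h0 : v 0 ≠ 0 := by simpa [h1, ne_zero_fin_two] using hv
    have hp : projPoint v = OnePoint.infty := by simp [projPoint, h1]
    rw [ContinuousAt, hp, OnePoint.hasBasis_nhds_infty.tendsto_right_iff]
    rintro C ⟨-, hC⟩
    obtain ⟨R, hR⟩ := hC.isBounded.exists_norm_le
    have h2 : ∀ᶠ u : Fin 2 → K in 𝓝 v, R * ‖u 1‖ < ‖u 0‖ := by
      apply (continuousAt_const.mul (continuous_apply 1).continuousAt.norm).eventually_lt
        (continuous_apply 0).continuousAt.norm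
      simpa [h1] using h0
    filter_upwards [h2] with u hu
    unfold projPoint
    by_cases hu1 : u 1 = 0
    · right
      simp [hu1]
    · left
      simp only [hu1, if_false]
      refine mem_image_of_mem _ fun hmem => ?_
      have h3 := hR _ hmem
      rw [norm_div, div_le_iff₀ (norm_pos_iff.2 hu1)] at h3
      exact absurd hu (not_lt.2 h3)
  · have h2 : ∀ᶠ u : Fin 2 → K in 𝓝 v, ((u 0 / u 1 : K) : OnePoint K) = projPoint u := by
      filter_upwards [(continuous_apply 1).continuousAt.eventually_ne h1] with u hu
      simp [projPoint, hu]
    refine ContinuousAt.congr ?_ h2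
    exact OnePoint.continuous_coe.continuousAt.comp (f := fun u : Fin 2 → K => u 0 / u 1)
      ((continuous_apply 0).continuousAt.div (continuous_apply 1).continuousAt h1)

/-- Power iteration: under the powers of a matrix with eigenvectors `v`, `w`, all points but `[w]`
are attracted to the eigenvector `v` of the larger eigenvalue. -/
theorem tendsto_projPoint_pow {K : Type*} [NormedField K] [ProperSpace K] [DecidableEq K]
    {A : Matrix (Fin 2) (Fin 2) K} {v w : Fin 2 → K} {l m : K} (hv : A *ᵥ v = l • v)
    (hw : A *ᵥ w = m • w) (hlm : ‖m‖ < ‖l‖) (hvw : v 0 * w 1 ≠ v 1 * w 0) {u : Fin 2 → K}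
    (hu : u 0 * w 1 ≠ u 1 * w 0) :
    Tendsto (fun n : ℕ => projPoint (A ^ n *ᵥ u)) atTop (𝓝 (projPoint v)) := by
  have hl : l ≠ 0 := norm_pos_iff.1 ((norm_nonneg m).trans_lt hlm)
  have hdet : v 0 * w 1 - v 1 * w 0 ≠ 0 := sub_ne_zero.2 hvw
  have hv0 : v ≠ 0 := by
    rintro rfl
    simp at hvw
  set a := (u 0 * w 1 - u 1 * w 0) / (v 0 * w 1 - v 1 * w 0) with ha
  set b := (v 0 * u 1 - v 1 * u 0) / (v 0 * w 1 - v 1 * w 0) with hb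
  have ha0 : a ≠ 0 := div_ne_zero (sub_ne_zero.2 hu) hdet
  have hdecomp : u = a • v + b • w := by
    rw [funext_iff, Fin.forall_fin_two]
    simp only [Pi.add_apply, Pi.smul_apply, smul_eq_mul, ha, hb]
    constructor <;>
    · rw [div_mul_eq_mul_div, div_mul_eq_mul_div, ← add_div, eq_div_iff hdet]
      ring
  have hAv : ∀ n : ℕ, A ^ n *ᵥ v = l ^ n • v := by
    intro n
    induction n with
    | zero => simp
    | succ n ih => rw [pow_succ, ← mulVec_mulVec, hv, mulVec_smul, ih, smul_smul, pow_succ, mul_comm]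
  have hAw : ∀ n : ℕ, A ^ n *ᵥ w = m ^ n • w := by
    intro n
    induction n with
    | zero => simp
    | succ n ih => rw [pow_succ, ← mulVec_mulVec, hw, mulVec_smul, ih, smul_smul, pow_succ, mul_comm]
  have hpow : ∀ n : ℕ, projPoint (A ^ n *ᵥ u) = projPoint (a • v + ((m / l) ^ n * b) • w) := by
    intro n
    rw [← projPoint_smul_vec (pow_ne_zero n hl) (a • v + ((m / l) ^ n * b) • w)]
    congr 1
    rw [hdecomp, mulVec_add, mulVec_smul, mulVec_smul, hAv, hAw, smul_add, smul_smul, smul_smul,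
      smul_smul, smul_smul, div_pow, mul_comm a]
    congr 2
    field_simp
  simp only [hpow]
  have h1 : Tendsto (fun n : ℕ => a • v + ((m / l) ^ n * b) • w) atTop
      (𝓝 (a • v + ((0 : K) * b) • w)) := by
    have h2 : ‖m / l‖ < 1 := by
      rw [norm_div]
      exact (div_lt_one (norm_pos_iff.2 hl)).2 hlm
    exact tendsto_const_nhds.add
      (((tendsto_pow_atTop_nhds_zero_of_norm_lt_one h2).mul_const b).smul_const w)
  rw [zero_mul, zero_smul, add_zero] at h1
  have h3 := (continuousAt_projPoint (smul_ne_zero ha0 hv0)).tendsto.comp h1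
  rwa [projPoint_smul_vec ha0] at h3

theorem boundaryPoint_projPoint (v : Fin 2 → ℝ) :
    boundaryPoint (projPoint v) = projPoint fun i => (v i : ℂ) := by
  unfold projPoint boundaryPoint
  by_cases h : v 1 = 0 <;> simp [h]

theorem interiorPoint_ne_boundaryPoint (z : UpperHalfPlane) (x : OnePoint ℝ) :
    interiorPoint z ≠ boundaryPoint x := by
  cases x with
  | infty => exact OnePoint.coe_ne_infty _
  | coe t =>
    intro h
    have h1 : (z : ℂ) = (t : ℂ) := OnePoint.coe_injective h
    have h2 := z.im_pos
    rw [← UpperHalfPlane.coe_im, h1, Complex.ofReal_im] at h2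
    exact lt_irrefl _ h2

/-- The vector `A (z, 1)`. -/
def homVec (A : Matrix (Fin 2) (Fin 2) ℝ) (z : ℂ) : Fin 2 → ℂ :=
  ![A 0 0 * z + A 0 1, A 1 0 * z + A 1 1]

theorem homVec_ne_zero {A : Matrix (Fin 2) (Fin 2) ℝ} (hA : A ≠ 0) {z : ℂ} (hz : z.im ≠ 0) :
    homVec A z ≠ 0 := by
  rw [ne_zero_fin_two]
  by_contra! h
  apply hA
  have key : ∀ i, (A i 0 : ℂ) * z + A i 1 = 0 → ∀ j, A i j = 0 := by
    intro i hi
    have h1 := congrArg Complex.im hi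
    simp [hz] at h1
    rw [h1] at hi
    simp at hi
    intro j
    fin_cases j
    · exact h1
    · exact hi
  ext i j
  fin_cases i
  · exact key 0 (by simpa [homVec] using h.1) j
  · exact key 1 (by simpa [homVec] using h.2) j

theorem continuous_homVec (z : ℂ) : Continuous fun A => homVec A z := by
  have h : ∀ i j, Continuous fun A : Matrix (Fin 2) (Fin 2) ℝ => A i j := fun i j =>
    continuous_id.matrix_elem i j
  refine continuous_pi fun i => ?_
  fin_cases i
  · exact ((Complex.continuous_ofReal.comp (h 0 0)).mul continuous_const).add
      (Complex.continuous_ofReal.comp (h 0 1))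
  · exact ((Complex.continuous_ofReal.comp (h 1 0)).mul continuous_const).add
      (Complex.continuous_ofReal.comp (h 1 1))

theorem homVec_smul (c : ℝ) (A : Matrix (Fin 2) (Fin 2) ℝ) (z : ℂ) :
    homVec (c • A) z = (c : ℂ) • homVec A z := by
  funext i
  fin_cases i <;> simp [homVec] <;> ring

open UpperHalfPlane in
theorem interiorPoint_smul (g : GL (Fin 2) ℝ) (z : UpperHalfPlane) :
    interiorPoint (ProjGenLinGroup.mk g • z) = projPoint (homVec g.1 (σ g z)) := by
  rw [ProjGenLinGroup.mk_smul]
  have h1 : denom g (σ g z) ≠ 0 := denom_ne_zero_of_im g (σ_im_ne_zero.2 z.im_ne_zero)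
  rw [interiorPoint, UpperHalfPlane.coe_smul, map_div₀, σ_num, σ_denom, projPoint, if_neg]
  · rfl
  · exact h1

end ProjPoint

/-! ### Limit sets and rank one limits of matrices -/

section LimitSet

open Matrix

/-- The matrices that represent an element of `Γ`, together with their multiples, zero included.
Limit points of `Γ` are images of matrices of rank one in the closure. -/
def matrixCone (Γ : Subgroup (ProjGL 2)) : Set (Matrix (Fin 2) (Fin 2) ℝ) :=
  {A | ∃ (c : ℝ) (g : GL (Fin 2) ℝ), ProjGenLinGroup.mk g ∈ Γ ∧ A = c • g.1}

variable {Γ : Subgroup (ProjGL 2)}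

theorem smul_mem_matrixCone {A : Matrix (Fin 2) (Fin 2) ℝ} (hA : A ∈ matrixCone Γ) (c : ℝ) :
    c • A ∈ matrixCone Γ := by
  obtain ⟨c', g, hg, rfl⟩ := hA
  exact ⟨c * c', g, hg, by rw [smul_smul]⟩

theorem mem_matrixCone {g : GL (Fin 2) ℝ} (hg : ProjGenLinGroup.mk g ∈ Γ) : g.1 ∈ matrixCone Γ :=
  ⟨1, g, hg, by rw [one_smul]⟩

theorem mul_mem_matrixCone {A B : Matrix (Fin 2) (Fin 2) ℝ} (hA : A ∈ matrixCone Γ)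
    (hB : B ∈ matrixCone Γ) : A * B ∈ matrixCone Γ := by
  obtain ⟨a, g, hg, rfl⟩ := hA
  obtain ⟨b, h, hh, rfl⟩ := hB
  exact ⟨a * b, g * h, by rw [map_mul]; exact mul_mem hg hh, by
    rw [Units.val_mul, smul_mul_smul_comm]⟩

theorem mul_mem_closure_matrixCone {A B : Matrix (Fin 2) (Fin 2) ℝ}
    (hA : A ∈ closure (matrixCone Γ)) (hB : B ∈ closure (matrixCone Γ)) :
    A * B ∈ closure (matrixCone Γ) :=
  map_mem_closure₂ continuous_mul hA hB fun _ ha _ hb => mul_mem_matrixCone ha hb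

theorem projPoint_vecMulVec_mulVec {r s u : Fin 2 → ℝ} (hu : vecMulVec r s *ᵥ u ≠ 0) :
    projPoint (vecMulVec r s *ᵥ u) = projPoint r := by
  have h : vecMulVec r s *ᵥ u = (s ⬝ᵥ u) • r := by
    rw [vecMulVec_mulVec, op_smul_eq_smul]
  rw [h] at hu ⊢
  exact projPoint_smul_vec (left_ne_zero_of_smul hu) r

/-- A real matrix moving a non-real point to the boundary has rank one. -/
theorem eq_vecMulVec_of_boundaryPoint {A : Matrix (Fin 2) (Fin 2) ℝ} (hA : A ≠ 0) {z : ℂ}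
    (hz : z.im ≠ 0) {x : OnePoint ℝ} (h : projPoint (homVec A z) = boundaryPoint x) :
    ∃ r s : Fin 2 → ℝ, r ≠ 0 ∧ s ≠ 0 ∧ A = vecMulVec r s ∧ projPoint r = x := by
  obtain ⟨r, hr, rfl⟩ := projPoint_surjective x
  have hr' : (fun i => (r i : ℂ)) ≠ 0 := by
    rw [ne_zero_fin_two] at hr ⊢
    exact_mod_cast hr
  rw [boundaryPoint_projPoint, projPoint_eq_iff (homVec_ne_zero hA hz) hr'] at h
  have h1 := congrArg Complex.im h
  have h2 := congrArg Complex.re h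
  simp [homVec] at h1 h2
  have h3 : A 0 0 * r 1 = A 1 0 * r 0 := by
    have h4 : (A 0 0 * r 1 - A 1 0 * r 0) * z.im = 0 := by linear_combination h1
    exact sub_eq_zero.1 ((mul_eq_zero.1 h4).resolve_right hz)
  have h4 : A 0 1 * r 1 = A 1 1 * r 0 := by linear_combination h2 - z.re * h3
  have hn : r 0 ^ 2 + r 1 ^ 2 ≠ 0 := by
    rw [ne_zero_fin_two] at hr
    rcases hr with hr | hr <;> positivity
  let s : Fin 2 → ℝ := fun j => (r 0 * A 0 j + r 1 * A 1 j) / (r 0 ^ 2 + r 1 ^ 2)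
  have hAs : A = vecMulVec r s := by
    ext i j
    rw [vecMulVec_apply]
    simp only [s]
    rw [← mul_div_assoc, eq_div_iff hn]
    fin_cases i <;> fin_cases j <;> simp only [Fin.zero_eta, Fin.mk_one]
    · linear_combination r 1 * h3
    · linear_combination r 1 * h4
    · linear_combination -r 0 * h3
    · linear_combination -r 0 * h4
  refine ⟨r, s, hr, ?_, hAs, rfl⟩
  intro hs
  exact hA (by rw [hAs, hs, vecMulVec_zero])

open UpperHalfPlane in
/-- The limit points are the images of the rank one matrices in the closure of the matrix cone.
This holds since the matrices with largest entry of absolute value `1` form a compact set. -/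
theorem mem_limitSet_iff {x : OnePoint ℝ} :
    x ∈ limitSet Γ ↔ ∃ r s : Fin 2 → ℝ, r ≠ 0 ∧ s ≠ 0 ∧
      vecMulVec r s ∈ closure (matrixCone Γ) ∧ projPoint r = x := by
  constructor
  · rintro ⟨z, hz⟩
    let C : Set (Matrix (Fin 2) (Fin 2) ℝ) :=
      (Icc (-1 : ℝ) 1).matrix ∩ {A | ∃ i j, |A i j| = 1} ∩ closure (matrixCone Γ)
    have hentry : ∀ i j, Continuous fun A : Matrix (Fin 2) (Fin 2) ℝ => A i j := fun i j =>
      continuous_id.matrix_elem i j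
    have hC : IsCompact C := by
      refine ((isCompact_Icc.matrix).inter_right ?_).inter_right isClosed_closure
      have : {A : Matrix (Fin 2) (Fin 2) ℝ | ∃ i j, |A i j| = 1} = ⋃ i, ⋃ j, {A | |A i j| = 1} := by
        ext A
        simp
      rw [this]
      exact isClosed_iUnion_of_finite fun i => isClosed_iUnion_of_finite fun j =>
        isClosed_eq (hentry i j).abs continuous_const
    have hC0 : ∀ A ∈ C, A ≠ 0 := by
      rintro A ⟨⟨-, i, j, hij⟩, -⟩ rfl
      simp at hij
    have himage : ∀ w : ℂ, w.im ≠ 0 → IsClosed ((fun A => projPoint (homVec A w)) '' C) := by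
      intro w hw
      refine (hC.image_of_continuousOn fun A hA => ?_).isClosed
      exact (ContinuousAt.comp (f := fun A => homVec A w)
        (continuousAt_projPoint (homVec_ne_zero (hC0 A hA) hw))
        (continuous_homVec w).continuousAt).continuousWithinAt
    -- matrices of negative determinant act on the upper half-plane through the conjugate of `z`
    have hz' : ((starRingEnd ℂ) (z : ℂ)).im ≠ 0 := by
      rw [Complex.conj_im]
      exact neg_ne_zero.2 z.im_ne_zero
    have hsub : (range fun γ : Γ => interiorPoint ((γ : ProjGL 2) • z)) ⊆
        ((fun A => projPoint (homVec A (z : ℂ))) '' C) ∪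
        ((fun A => projPoint (homVec A ((starRingEnd ℂ) (z : ℂ)))) '' C) := by
      rintro _ ⟨⟨γ, hγ⟩, rfl⟩
      obtain ⟨g, rfl⟩ := ProjGenLinGroup.mk_surjective γ
      obtain ⟨⟨i, j⟩, hmax⟩ := Finite.exists_max fun p : Fin 2 × Fin 2 => |g.1 p.1 p.2|
      have hpos : 0 < |g.1 i j| := by
        rw [abs_pos]
        intro h0
        have h1 : g.1 = 0 := by
          ext a b
          have := hmax (a, b)
          rw [h0, abs_zero] at this
          exact abs_nonpos_iff.1 this
        have h2 := g.det_ne_zero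
        rw [h1, det_fin_two] at h2
        simp at h2
      have hmem : |g.1 i j|⁻¹ • g.1 ∈ C := by
        refine ⟨⟨fun a b => ?_, i, j, ?_⟩, subset_closure
          (smul_mem_matrixCone (mem_matrixCone hγ) _)⟩
        · rw [mem_Icc, ← abs_le, Matrix.smul_apply, smul_eq_mul, abs_mul, abs_inv, abs_abs,
            inv_mul_le_one₀ hpos]
          exact hmax (a, b)
        · rw [Matrix.smul_apply, smul_eq_mul, abs_mul, abs_inv, abs_abs, inv_mul_cancel₀ hpos.ne']
      have hval : ∀ w, projPoint (homVec (|g.1 i j|⁻¹ • g.1) w) = projPoint (homVec g.1 w) := by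
        intro w
        rw [homVec_smul, projPoint_smul_vec]
        exact_mod_cast inv_ne_zero hpos.ne'
      have hi : interiorPoint (ProjGenLinGroup.mk g • z) = projPoint (homVec g.1 (σ g z)) :=
        interiorPoint_smul g z
      by_cases hdet : 0 < g.det.val
      · left
        refine ⟨_, hmem, ?_⟩
        simp only [hval]
        rw [hi, σ, if_pos hdet]
        rfl
      · right
        refine ⟨_, hmem, ?_⟩
        simp only [hval]
        rw [hi, σ, if_neg hdet]
        rfl
    have hx : boundaryPoint x ∈ closure (range fun γ : Γ => interiorPoint ((γ : ProjGL 2) • z)) :=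
      mem_closure_iff_clusterPt.2 hz.clusterPt
    have hx' := closure_minimal hsub ((himage _ z.im_ne_zero).union (himage _ hz')) hx
    obtain ⟨w, hw, A, hA, hAx⟩ : ∃ w : ℂ, w.im ≠ 0 ∧ ∃ A ∈ C,
        projPoint (homVec A w) = boundaryPoint x := by
      rcases hx' with ⟨A, hA, h⟩ | ⟨A, hA, h⟩
      · exact ⟨_, z.im_ne_zero, A, hA, h⟩
      · exact ⟨_, hz', A, hA, h⟩
    obtain ⟨r, s, hr, hs, rfl, hrx⟩ := eq_vecMulVec_of_boundaryPoint (hC0 A hA) hw hAx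
    exact ⟨r, s, hr, hs, hA.2, hrx⟩
  · rintro ⟨r, s, hr, hs, hA, rfl⟩
    refine ⟨UpperHalfPlane.I, ?_⟩
    set z := UpperHalfPlane.I
    set A := vecMulVec r s with hAdef
    have hA0 : A ≠ 0 := by
      rw [hAdef, Ne, vecMulVec_eq_zero]
      tauto
    have hlimit : ∀ w : ℂ, w.im ≠ 0 → projPoint (homVec A w) = boundaryPoint (projPoint r) := by
      intro w hw
      have h1 : homVec A w = ((s 0 : ℂ) * w + s 1) • fun i => (r i : ℂ) := by
        rw [funext_iff, Fin.forall_fin_two]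
        simp [homVec, hAdef, vecMulVec_apply]
        constructor <;> ring
      have h2 := homVec_ne_zero hA0 hw
      rw [h1] at h2 ⊢
      rw [boundaryPoint_projPoint, projPoint_smul_vec (left_ne_zero_of_smul h2)]
    have hcont : ∀ w : ℂ, w.im ≠ 0 →
        Tendsto (fun B => projPoint (homVec B w)) (𝓝 A) (𝓝 (boundaryPoint (projPoint r))) := by
      intro w hw
      rw [← hlimit w hw]
      exact ContinuousAt.comp (f := fun A => homVec A w)
        (continuousAt_projPoint (homVec_ne_zero hA0 hw)) (continuous_homVec w).continuousAt
    have hz' : ((starRingEnd ℂ) (z : ℂ)).im ≠ 0 := by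
      rw [Complex.conj_im]
      exact neg_ne_zero.2 z.im_ne_zero
    have hcl : boundaryPoint (projPoint r) ∈
        closure (range fun γ : Γ => interiorPoint ((γ : ProjGL 2) • z)) := by
      rw [mem_closure_iff_frequently, frequently_iff]
      intro U hU
      have hev := ((hcont _ z.im_ne_zero).eventually hU).and
        (((hcont _ hz').eventually hU).and (isOpen_ne.mem_nhds hA0))
      obtain ⟨B, ⟨c, g, hg, rfl⟩, hB1, hB2, hB0⟩ :=
        ((mem_closure_iff_frequently.1 hA).and_eventually hev).exists
      have hc : c ≠ 0 := by
        rintro rfl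
        exact hB0 (zero_smul _ _)
      have hval : ∀ w, projPoint (homVec (c • g.1) w) = projPoint (homVec g.1 w) := by
        intro w
        rw [homVec_smul, projPoint_smul_vec]
        exact_mod_cast hc
      rw [hval] at hB1 hB2
      refine ⟨_, ?_, ⟨⟨ProjGenLinGroup.mk g, hg⟩, rfl⟩⟩
      have hi : interiorPoint (ProjGenLinGroup.mk g • z) = projPoint (homVec g.1 (σ g z)) :=
        interiorPoint_smul g z
      change interiorPoint (ProjGenLinGroup.mk g • z) ∈ U
      rw [hi, σ]
      split_ifs
      · exact hB1
      · exact hB2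
    rw [accPt_principal_iff_clusterPt, sdiff_singleton_eq_self, ← mem_closure_iff_clusterPt]
    · exact hcl
    · rintro ⟨γ, hγ⟩
      exact interiorPoint_ne_boundaryPoint _ _ hγ

theorem limitSet_mono {Γ' : Subgroup (ProjGL 2)} (h : Γ' ≤ Γ) : limitSet Γ' ⊆ limitSet Γ := by
  rintro x ⟨z, hz⟩
  refine ⟨z, hz.mono (principal_mono.2 ?_)⟩
  rintro _ ⟨γ, rfl⟩
  exact ⟨⟨γ, h γ.2⟩, rfl⟩

theorem smul_mem_limitSet {γ : ProjGL 2} (hγ : γ ∈ Γ) {x : OnePoint ℝ} (hx : x ∈ limitSet Γ) :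
    γ • x ∈ limitSet Γ := by
  obtain ⟨g, rfl⟩ := ProjGenLinGroup.mk_surjective γ
  rw [mem_limitSet_iff] at hx ⊢
  obtain ⟨r, s, hr, hs, hA, rfl⟩ := hx
  refine ⟨g.1 *ᵥ r, s, ?_, hs, ?_, ?_⟩
  · intro h0
    apply hr
    rw [← CompleteFlag.inv_mulVec_mulVec g r, h0, mulVec_zero]
  · rw [← mul_vecMulVec]
    exact mul_mem_closure_matrixCone (subset_closure (mem_matrixCone hγ)) hA
  · exact (smul_projPoint g hr).symm

/-- A finite invariant set with at least two points contains the limit set. -/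
theorem limitSet_subset_of_finite {E : Set (OnePoint ℝ)} (hfin : E.Finite)
    (hinv : ∀ γ ∈ Γ, ∀ p ∈ E, γ • p ∈ E) (hE : E.Nontrivial) : limitSet Γ ⊆ E := by
  intro x hx
  obtain ⟨r, s, hr, hs, hA, rfl⟩ := mem_limitSet_iff.1 hx
  obtain ⟨p, hp, q, hq, hpq⟩ := hE
  obtain ⟨u, hu, rfl⟩ := projPoint_surjective p
  obtain ⟨v, hv, rfl⟩ := projPoint_surjective q
  have hker : ∀ u : Fin 2 → ℝ, vecMulVec r s *ᵥ u = 0 → s 0 * u 0 + s 1 * u 1 = 0 := by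
    intro u h0
    have h : vecMulVec r s *ᵥ u = (s ⬝ᵥ u) • r := by
      rw [vecMulVec_mulVec, op_smul_eq_smul]
    rw [h, smul_eq_zero, or_iff_left hr, dotProduct, Fin.sum_univ_two] at h0
    exact h0
  obtain ⟨u, hu, huE, huA⟩ : ∃ u : Fin 2 → ℝ, u ≠ 0 ∧ projPoint u ∈ E ∧
      vecMulVec r s *ᵥ u ≠ 0 := by
    by_contra! hcon
    have h1 := hker u (hcon u hu hp)
    have h2 := hker v (hcon v hv hq)
    rw [Ne, projPoint_eq_iff hu hv] at hpq
    rw [ne_zero_fin_two] at hs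
    have h3 : s 0 * (u 0 * v 1 - u 1 * v 0) = 0 := by linear_combination v 1 * h1 - u 1 * h2
    have h4 : s 1 * (u 0 * v 1 - u 1 * v 0) = 0 := by linear_combination u 0 * h2 - v 0 * h1
    have h5 := sub_ne_zero.2 hpq
    rcases hs with hs | hs
    · exact mul_ne_zero hs h5 h3
    · exact mul_ne_zero hs h5 h4
  by_contra hxE
  have hcv : Continuous fun B : Matrix (Fin 2) (Fin 2) ℝ => B *ᵥ u :=
    continuous_id.matrix_mulVec continuous_const
  have hcont : Tendsto (fun B : Matrix (Fin 2) (Fin 2) ℝ => projPoint (B *ᵥ u))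
      (𝓝 (vecMulVec r s)) (𝓝 (projPoint r)) := by
    rw [← projPoint_vecMulVec_mulVec huA]
    exact ContinuousAt.comp (f := fun B : Matrix (Fin 2) (Fin 2) ℝ => B *ᵥ u)
      (continuousAt_projPoint huA) hcv.continuousAt
  have hev := (hcont.eventually (hfin.isClosed.isOpen_compl.mem_nhds hxE)).and
    (hcv.continuousAt.eventually_ne huA)
  obtain ⟨B, ⟨c, g, hg, rfl⟩, hB1, hB2⟩ :=
    ((mem_closure_iff_frequently.1 hA).and_eventually hev).exists
  rw [Matrix.smul_mulVec] at hB1 hB2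
  rw [projPoint_smul_vec (left_ne_zero_of_smul hB2), ← smul_projPoint g hu] at hB1
  exact hB1 (hinv _ hg _ huE)

end LimitSet

/-! ### Hyperbolic elements -/

section Hyperbolic

open Matrix

/-- The matrix `g` has positive determinant and eigenvectors `v`, `w` with eigenvalues
`l > m > 0`. -/
structure IsHyperbolicFrame (g : GL (Fin 2) ℝ) (v w : Fin 2 → ℝ) (l m : ℝ) : Prop where
  det_pos : 0 < g.det.val
  apply_v : g.1 *ᵥ v = l • v
  apply_w : g.1 *ᵥ w = m • w
  pos : 0 < m
  lt : m < l
  ne : v 0 * w 1 ≠ v 1 * w 0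

namespace IsHyperbolicFrame

variable {g : GL (Fin 2) ℝ} {v w : Fin 2 → ℝ} {l m : ℝ}

theorem left_ne_zero (h : IsHyperbolicFrame g v w l m) : v ≠ 0 := by
  rintro rfl
  exact h.ne (by simp)

theorem right_ne_zero (h : IsHyperbolicFrame g v w l m) : w ≠ 0 := by
  rintro rfl
  exact h.ne (by simp)

theorem projPoint_ne (h : IsHyperbolicFrame g v w l m) : projPoint v ≠ projPoint w := by
  rw [Ne, projPoint_eq_iff h.left_ne_zero h.right_ne_zero]
  exact h.ne

theorem inv (h : IsHyperbolicFrame g v w l m) : IsHyperbolicFrame g⁻¹ w v m⁻¹ l⁻¹ where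
  det_pos := by
    rw [map_inv, Units.val_inv_eq_inv_val]
    exact inv_pos.2 h.det_pos
  apply_v := by
    rw [eq_inv_smul_iff₀ h.pos.ne', ← mulVec_smul, ← h.apply_w, CompleteFlag.inv_mulVec_mulVec]
  apply_w := by
    rw [eq_inv_smul_iff₀ (h.pos.trans h.lt).ne', ← mulVec_smul, ← h.apply_v,
      CompleteFlag.inv_mulVec_mulVec]
  pos := inv_pos.2 (h.pos.trans h.lt)
  lt := inv_strictAnti₀ h.pos h.lt
  ne := fun h' => h.ne (by linear_combination -h')

theorem smul_left (h : IsHyperbolicFrame g v w l m) :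
    ProjGenLinGroup.mk g • projPoint v = projPoint v := by
  change g • projPoint v = _
  rw [smul_projPoint g h.left_ne_zero, h.apply_v, projPoint_smul_vec (h.pos.trans h.lt).ne']

theorem tendsto_boundary (h : IsHyperbolicFrame g v w l m) {x : OnePoint ℝ} (hx : x ≠ projPoint w) :
    Tendsto (fun n : ℕ => ProjGenLinGroup.mk g ^ n • x) atTop (𝓝 (projPoint v)) := by
  obtain ⟨u, hu, rfl⟩ := projPoint_surjective x
  rw [Ne, projPoint_eq_iff hu h.right_ne_zero] at hx
  have hlm : ‖m‖ < ‖l‖ := by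
    rw [Real.norm_of_nonneg h.pos.le, Real.norm_of_nonneg (h.pos.trans h.lt).le]
    exact h.lt
  refine (tendsto_projPoint_pow h.apply_v h.apply_w hlm h.ne hx).congr fun n => ?_
  rw [← map_pow]
  change _ = g ^ n • projPoint u
  rw [smul_projPoint _ hu, Units.val_pow_eq_pow_val]

open UpperHalfPlane in
theorem tendsto_interior (h : IsHyperbolicFrame g v w l m) (z : UpperHalfPlane) :
    Tendsto (fun n : ℕ => interiorPoint (ProjGenLinGroup.mk g ^ n • z)) atTop
      (𝓝 (boundaryPoint (projPoint v))) := by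
  have hlm : ‖(m : ℂ)‖ < ‖(l : ℂ)‖ := by
    rw [Complex.norm_real, Complex.norm_real, Real.norm_of_nonneg h.pos.le,
      Real.norm_of_nonneg (h.pos.trans h.lt).le]
    exact h.lt
  let A : Matrix (Fin 2) (Fin 2) ℂ := g.1.map Complex.ofRealHom
  have hmap : ∀ u : Fin 2 → ℝ, A *ᵥ (fun i => (u i : ℂ)) = fun i => ((g.1 *ᵥ u) i : ℂ) := by
    intro u
    funext i
    simp only [mulVec, dotProduct, A, map_apply, Complex.ofReal_sum, Complex.ofReal_mul]
    rfl
  have hv : A *ᵥ (fun i => (v i : ℂ)) = (l : ℂ) • fun i => (v i : ℂ) := by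
    rw [hmap, h.apply_v]
    funext i
    simp
  have hw : A *ᵥ (fun i => (w i : ℂ)) = (m : ℂ) • fun i => (w i : ℂ) := by
    rw [hmap, h.apply_w]
    funext i
    simp
  have hu : ![(z : ℂ), 1] 0 * (w 1 : ℂ) ≠ ![(z : ℂ), 1] 1 * (w 0 : ℂ) := by
    intro h0
    have hw0 := h.right_ne_zero
    rw [ne_zero_fin_two] at hw0
    have h1 := congrArg Complex.im h0
    have h2 := z.im_ne_zero
    simp [h2] at h1
    simp [h1] at h0
    exact hw0.elim (fun h3 => h3 (by exact_mod_cast h0.symm)) fun h3 => h3 h1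
  have key := tendsto_projPoint_pow hv hw hlm (by exact_mod_cast h.ne) hu
  rw [boundaryPoint_projPoint]
  refine key.congr fun n => ?_
  have hdet : 0 < (g ^ n).det.val := by
    rw [map_pow, Units.val_pow_eq_pow_val]
    exact pow_pos h.det_pos n
  have hi : interiorPoint (ProjGenLinGroup.mk (g ^ n) • z) =
    projPoint (homVec (g ^ n).1 (σ (g ^ n) z)) := interiorPoint_smul (g ^ n) z
  have hA : A ^ n = (g ^ n).1.map Complex.ofRealHom := by
    rw [Units.val_pow_eq_pow_val]
    exact (map_pow Complex.ofRealHom.mapMatrix g.1 n).symm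
  rw [← map_pow, hi, σ, if_pos hdet, hA]
  congr 1
  rw [funext_iff, Fin.forall_fin_two]
  simp [homVec, mulVec, dotProduct, Fin.sum_univ_two]

theorem mem_limitSet (h : IsHyperbolicFrame g v w l m) {Γ : Subgroup (ProjGL 2)}
    (hg : ProjGenLinGroup.mk g ∈ Γ) : projPoint v ∈ limitSet Γ := by
  refine ⟨UpperHalfPlane.I, ?_⟩
  have h1 : Tendsto (fun n : ℕ => interiorPoint (ProjGenLinGroup.mk g ^ n • UpperHalfPlane.I)) atTop
      (𝓝[≠] (boundaryPoint (projPoint v)) ⊓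
        𝓟 (range fun γ : Γ => interiorPoint ((γ : ProjGL 2) • UpperHalfPlane.I))) := by
    refine tendsto_inf.2 ⟨tendsto_nhdsWithin_iff.2 ⟨h.tendsto_interior _, ?_⟩, ?_⟩
    · exact Eventually.of_forall fun n => interiorPoint_ne_boundaryPoint _ _
    · rw [tendsto_principal]
      exact Eventually.of_forall fun n => ⟨⟨_, pow_mem hg n⟩, rfl⟩
  exact h1.neBot

end IsHyperbolicFrame

theorem exists_eigenvector {A : Matrix (Fin 2) (Fin 2) ℝ} {l : ℝ}
    (h : l ^ 2 - A.trace * l + A.det = 0) : ∃ v : Fin 2 → ℝ, v ≠ 0 ∧ A *ᵥ v = l • v := by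
  have hdet : (A - l • (1 : Matrix (Fin 2) (Fin 2) ℝ)).det = 0 := by
    rw [trace_fin_two, det_fin_two] at h
    rw [det_fin_two]
    simp
    linear_combination h
  obtain ⟨v, hv, hAv⟩ := exists_mulVec_eq_zero_iff.2 hdet
  refine ⟨v, hv, ?_⟩
  rwa [sub_mulVec, Matrix.smul_mulVec, one_mulVec, sub_eq_zero] at hAv

/-- If the eigenvalues of `g` are real and have different absolute values, then `g ^ 2` is
hyperbolic with positive eigenvalues. -/
theorem exists_isHyperbolicFrame_sq {g : GL (Fin 2) ℝ} (htr : g.1.trace ≠ 0)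
    (hdisc : 4 * g.1.det < g.1.trace ^ 2) :
    ∃ v w l m, IsHyperbolicFrame (g ^ 2) v w l m := by
  set t := g.1.trace
  set D := g.1.det with hD
  have hD0 : D ≠ 0 := g.det_ne_zero
  set q := √(t ^ 2 - 4 * D) with hq
  have hqpos : 0 < q := Real.sqrt_pos.2 (by linarith)
  have hq2 : q ^ 2 = t ^ 2 - 4 * D := Real.sq_sqrt (by linarith)
  obtain ⟨v, hv, hgv⟩ := exists_eigenvector (A := g.1) (l := (t + q) / 2) (by
    linear_combination hq2 / 4)
  obtain ⟨w, hw, hgw⟩ := exists_eigenvector (A := g.1) (l := (t - q) / 2) (by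
    linear_combination hq2 / 4)
  have hprod : (t + q) / 2 * ((t - q) / 2) = D := by linear_combination -hq2 / 4
  have hne1 : (t + q) / 2 ≠ 0 := left_ne_zero_of_mul (hprod.trans_ne hD0)
  have hne2 : (t - q) / 2 ≠ 0 := right_ne_zero_of_mul (hprod.trans_ne hD0)
  have hvw : v 0 * w 1 ≠ v 1 * w 0 := by
    intro h
    rw [← projPoint_eq_iff hv hw] at h
    have e0 := congrFun hgv 0
    have e1 := congrFun hgv 1
    have f0 := congrFun hgw 0
    have f1 := congrFun hgw 1
    rw [projPoint_eq_iff hv hw] at h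
    simp [mulVec_fin_two] at e0 e1 f0 f1
    rw [ne_zero_fin_two] at hv hw
    have k0 : q * (v 0 * w 0) = 0 := by
      linear_combination (-w 0) * e0 + (v 0) * f0 + (-g.1 0 1) * h
    have k1 : q * (v 1 * w 1) = 0 := by
      linear_combination (-w 1) * e1 + (v 1) * f1 + (g.1 1 0) * h
    have k2 : q * (v 0 * w 1) = 0 := by
      linear_combination (-w 1) * e0 + (v 1) * f0 + (g.1 0 0 - (t - q) / 2) * h
    have k3 : q * (v 1 * w 0) = 0 := by linear_combination k2 - q * h
    simp only [mul_eq_zero, hqpos.ne', false_or] at k0 k1 k2 k3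
    tauto
  have hsq : ∀ {u : Fin 2 → ℝ} {a : ℝ}, g.1 *ᵥ u = a • u → (g ^ 2).1 *ᵥ u = a ^ 2 • u := by
    intro u a h
    rw [Units.val_pow_eq_pow_val, pow_two, ← mulVec_mulVec, h, mulVec_smul, h, smul_smul, pow_two]
  have hdet : 0 < (g ^ 2).det.val := by
    rw [map_pow, Units.val_pow_eq_pow_val]
    exact (sq_pos_of_ne_zero hD0 : 0 < D ^ 2)
  have hdiff : ((t + q) / 2) ^ 2 - ((t - q) / 2) ^ 2 = t * q := by ring
  rcases lt_or_gt_of_ne htr with h | h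
  · refine ⟨w, v, _, _, hdet, hsq hgw, hsq hgv, by positivity, ?_, fun h' => hvw ?_⟩
    · have := mul_neg_of_neg_of_pos h hqpos
      linarith
    · linear_combination -h'
  · refine ⟨v, w, _, _, hdet, hsq hgv, hsq hgw, by positivity, ?_, hvw⟩
    have := mul_pos h hqpos
    linarith

/-- The trace of a product of two rank one matrices with different images cannot vanish together
with the traces of both factors, so the closure of the matrix cone contains a matrix of
determinant zero and nonzero trace. The elements of the group close to it are hyperbolic. -/
theorem exists_isHyperbolicFrame {Γ : Subgroup (ProjGL 2)} (hΓ : IsNonElementary Γ) :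
    ∃ g v w l m, ProjGenLinGroup.mk g ∈ Γ ∧ IsHyperbolicFrame g v w l m := by
  obtain ⟨x, hx, y, hy, hxy⟩ := hΓ.nontrivial
  obtain ⟨r, s, hr, hs, hA, rfl⟩ := mem_limitSet_iff.1 hx
  obtain ⟨r', s', hr', hs', hA', rfl⟩ := mem_limitSet_iff.1 hy
  rw [Ne, projPoint_eq_iff hr hr'] at hxy
  obtain ⟨A, hA, hdet, htr⟩ : ∃ A ∈ closure (matrixCone Γ), A.det = 0 ∧ A.trace ≠ 0 := by
    by_contra! hcon
    have hdet : ∀ r s : Fin 2 → ℝ, (vecMulVec r s).det = 0 := fun r s => by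
      rw [det_fin_two]
      simp only [vecMulVec_apply]
      ring
    have h1 := hcon _ hA (hdet r s)
    have h2 := hcon _ hA' (hdet r' s')
    have h3 := hcon _ (mul_mem_closure_matrixCone hA hA') (by rw [det_mul, hdet, zero_mul])
    simp only [trace_fin_two, mul_apply, Fin.sum_univ_two, vecMulVec_apply] at h1 h2 h3
    have h5 : (r 0 * s' 0 + r 1 * s' 1) * (s 0 * r' 0 + s 1 * r' 1) = 0 := by
      linear_combination h3
    have h6 := sub_ne_zero.2 hxy
    rw [ne_zero_fin_two] at hs hs'
    rcases mul_eq_zero.1 h5 with h5 | h5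
    · have e0 : s' 0 * (r 0 * r' 1 - r 1 * r' 0) = 0 := by linear_combination r' 1 * h5 - r 1 * h2
      have e1 : s' 1 * (r 0 * r' 1 - r 1 * r' 0) = 0 := by linear_combination r 0 * h2 - r' 0 * h5
      simp only [mul_eq_zero, h6, or_false] at e0 e1
      tauto
    · have e0 : s 0 * (r 0 * r' 1 - r 1 * r' 0) = 0 := by linear_combination r' 1 * h1 - r 1 * h5
      have e1 : s 1 * (r 0 * r' 1 - r 1 * r' 0) = 0 := by linear_combination r 0 * h5 - r' 0 * h1
      simp only [mul_eq_zero, h6, or_false] at e0 e1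
      tauto
  have hc1 : Continuous fun B : Matrix (Fin 2) (Fin 2) ℝ => B.trace := continuous_id.matrix_trace
  have hc2 : Continuous fun B : Matrix (Fin 2) (Fin 2) ℝ => B.det := continuous_id.matrix_det
  have hev : ∀ᶠ B in 𝓝 A, B.trace ≠ 0 ∧ 4 * B.det < B.trace ^ 2 := by
    refine (hc1.continuousAt.eventually_ne htr).and
      ((continuous_const.mul hc2).continuousAt.eventually_lt (hc1.pow 2).continuousAt ?_)
    change 4 * A.det < A.trace ^ 2
    rw [hdet, mul_zero]
    positivity
  obtain ⟨B, ⟨c, g, hg, rfl⟩, hB1, hB2⟩ :=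
    ((mem_closure_iff_frequently.1 hA).and_eventually hev).exists
  rw [trace_smul, smul_eq_mul] at hB1 hB2
  have hc := left_ne_zero_of_mul hB1
  obtain ⟨v, w, l, m, h⟩ := exists_isHyperbolicFrame_sq (g := g) (right_ne_zero_of_mul hB1) (by
    rw [det_smul, Fintype.card_fin, mul_pow, ← mul_assoc, mul_comm 4, mul_assoc] at hB2
    exact lt_of_mul_lt_mul_left hB2 (sq_nonneg c))
  exact ⟨g ^ 2, v, w, l, m, by rw [map_pow]; exact pow_mem hg 2, h⟩

end Hyperbolic

/-! ### Cyclic order and connectedness of the space of clockwise tuples -/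

section CyclicOrder

open Matrix

/-- The determinant of two vectors in the plane. -/
def planeDet (u v : Fin 2 → ℝ) : ℝ := u 0 * v 1 - u 1 * v 0

/-- The vector `(t, 1)` over a real point `t` and the vector `(1, 0)` over `∞`. -/
noncomputable def normalVec (x : OnePoint ℝ) : Fin 2 → ℝ := x.elim ![1, 0] fun t => ![t, 1]

theorem exists_smul_normalVec {u : Fin 2 → ℝ} (hu : u ≠ 0) :
    ∃ c : ℝ, c ≠ 0 ∧ u = c • normalVec (projPoint u) := by
  by_cases h : u 1 = 0
  · have h0 : u 0 ≠ 0 := by simpa [h, ne_zero_fin_two] using hu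
    refine ⟨u 0, h0, ?_⟩
    rw [funext_iff, Fin.forall_fin_two]
    simp [normalVec, projPoint, h]
  · refine ⟨u 1, h, ?_⟩
    rw [funext_iff, Fin.forall_fin_two]
    simp [normalVec, projPoint, h, mul_div_cancel₀]

theorem isCounterclockwise_iff_normalVec (x y z : OnePoint ℝ) :
    IsCounterclockwise x y z ↔ 0 < planeDet (normalVec x) (normalVec y) *
      planeDet (normalVec y) (normalVec z) * planeDet (normalVec z) (normalVec x) := by
  unfold IsCounterclockwise planeDet
  cases x <;> cases y <;> cases z <;> simp [boundaryPosition, normalVec]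
  rename_i a b c
  constructor
  · rintro (⟨h1, h2⟩ | ⟨h1, h2⟩ | ⟨h1, h2⟩)
    · exact mul_pos (mul_pos_of_neg_of_neg (sub_neg.2 h1) (sub_neg.2 h2)) (sub_pos.2 (h1.trans h2))
    · exact mul_pos_of_neg_of_neg (mul_neg_of_pos_of_neg (sub_pos.2 (h1.trans h2)) (sub_neg.2 h1))
        (sub_neg.2 h2)
    · exact mul_pos_of_neg_of_neg (mul_neg_of_neg_of_pos (sub_neg.2 h2) (sub_pos.2 (h1.trans h2)))
        (sub_neg.2 h1)
  · intro h
    have h0 := h.ne'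
    rw [mul_ne_zero_iff, mul_ne_zero_iff, sub_ne_zero, sub_ne_zero, sub_ne_zero] at h0
    obtain ⟨⟨hab, hbc⟩, hca⟩ := h0
    rcases lt_or_gt_of_ne hab with h1 | h1 <;> rcases lt_or_gt_of_ne hbc with h2 | h2 <;>
    rcases lt_or_gt_of_ne hca with h3 | h3
    · exact Or.inl ⟨h1, h2⟩
    · exact Or.inl ⟨h1, h2⟩
    · exact Or.inr (Or.inr ⟨h3, h1⟩)
    · exact absurd h (mul_neg_of_neg_of_pos (mul_neg_of_neg_of_pos (sub_neg.2 h1) (sub_pos.2 h2))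
        (sub_pos.2 h3)).not_gt
    · exact Or.inr (Or.inl ⟨h2, h3⟩)
    · exact absurd h (mul_neg_of_neg_of_pos (mul_neg_of_pos_of_neg (sub_pos.2 h1) (sub_neg.2 h2))
        (sub_pos.2 h3)).not_gt
    · exact absurd h (mul_neg_of_pos_of_neg (mul_pos (sub_pos.2 h1) (sub_pos.2 h2))
        (sub_neg.2 h3)).not_gt
    · exact absurd (h1.trans h3) h2.not_gt

/-- The cyclic order of three points in homogeneous coordinates. -/
theorem isCounterclockwise_projPoint_iff {u v w : Fin 2 → ℝ} (hu : u ≠ 0) (hv : v ≠ 0)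
    (hw : w ≠ 0) :
    IsCounterclockwise (projPoint u) (projPoint v) (projPoint w) ↔
      0 < planeDet u v * planeDet v w * planeDet w u := by
  obtain ⟨a, ha, hua⟩ := exists_smul_normalVec hu
  obtain ⟨b, hb, hvb⟩ := exists_smul_normalVec hv
  obtain ⟨c, hc, hwc⟩ := exists_smul_normalVec hw
  rw [isCounterclockwise_iff_normalVec]
  set x := normalVec (projPoint u)
  set y := normalVec (projPoint v)
  set z := normalVec (projPoint w)
  have h : planeDet u v * planeDet v w * planeDet w u =
      (a * b * c) ^ 2 * (planeDet x y * planeDet y z * planeDet z x) := by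
    rw [hua, hvb, hwc]
    simp only [planeDet, Pi.smul_apply, smul_eq_mul]
    ring
  rw [h]
  exact (mul_pos_iff_of_pos_left (by positivity)).symm

theorem isCounterclockwise_or {x y z : OnePoint ℝ} (hxy : x ≠ y) (hyz : y ≠ z) (hzx : z ≠ x) :
    IsCounterclockwise x y z ∨ IsCounterclockwise z y x := by
  obtain ⟨u, hu, rfl⟩ := projPoint_surjective x
  obtain ⟨v, hv, rfl⟩ := projPoint_surjective y
  obtain ⟨w, hw, rfl⟩ := projPoint_surjective z
  rw [Ne, projPoint_eq_iff (by assumption) (by assumption), ← sub_eq_zero] at hxy hyz hzx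
  rw [isCounterclockwise_projPoint_iff hu hv hw, isCounterclockwise_projPoint_iff hw hv hu]
  have h : planeDet u v * planeDet v w * planeDet w u ≠ 0 := mul_ne_zero (mul_ne_zero hxy hyz) hzx
  rcases lt_or_gt_of_ne h with h | h
  · right
    unfold planeDet at h ⊢
    linarith
  · exact Or.inl h

theorem IsCounterclockwise.ne {x y z : OnePoint ℝ} (h : IsCounterclockwise x y z) :
    x ≠ y ∧ y ≠ z ∧ z ≠ x := by
  obtain ⟨u, hu, rfl⟩ := projPoint_surjective x
  obtain ⟨v, hv, rfl⟩ := projPoint_surjective y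
  obtain ⟨w, hw, rfl⟩ := projPoint_surjective z
  rw [isCounterclockwise_projPoint_iff hu hv hw] at h
  have h1 := h.ne'
  rw [mul_ne_zero_iff, mul_ne_zero_iff] at h1
  rw [Ne, projPoint_eq_iff hu hv, Ne, projPoint_eq_iff hv hw, Ne, projPoint_eq_iff hw hu]
  exact ⟨sub_ne_zero.1 h1.1.1, sub_ne_zero.1 h1.1.2, sub_ne_zero.1 h1.2⟩

theorem IsClockwiseTuple.injective {m : ℕ} {a : Fin (m + 3) → OnePoint ℝ}
    (ha : IsClockwiseTuple a) : Function.Injective a := by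
  have key : ∀ i j, i < j → a i ≠ a j := by
    intro i j hij
    obtain ⟨k, hki, hkj⟩ : ∃ k, k ≠ i ∧ k ≠ j := by
      obtain ⟨k, hk⟩ := Finset.exists_mem_notMem_of_card_lt_card
        (s := {i, j}) (t := (Finset.univ : Finset (Fin (m + 3))))
        ((Finset.card_le_two).trans_lt (by simp))
      simp only [Finset.mem_insert, Finset.mem_singleton, not_or] at hk
      exact ⟨k, hk.2⟩
    rcases lt_or_gt_of_ne hki with h | h
    · exact (ha k i j h hij).ne.1.symm
    · rcases lt_or_gt_of_ne hkj with h' | h'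
      · exact (ha i k j h h').ne.2.2
      · exact (ha i j k hij h').ne.2.1.symm
  intro i j h
  by_contra hne
  rcases lt_or_gt_of_ne hne with h1 | h1
  · exact key i j h1 h
  · exact key j i h1 h.symm

/-- The point of the circle with coordinates `[cos θ : sin θ]`, that is, `cot θ`. It moves
clockwise when `θ` increases and has period `π`. -/
noncomputable def anglePoint (θ : ℝ) : OnePoint ℝ := projPoint ![Real.cos θ, Real.sin θ]

theorem angleVec_ne_zero (θ : ℝ) : ![Real.cos θ, Real.sin θ] ≠ 0 := by
  rw [ne_zero_fin_two]
  by_contra! h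
  have h1 := Real.sin_sq_add_cos_sq θ
  simp only [Matrix.cons_val_zero, Matrix.cons_val_one] at h
  rw [h.1, h.2] at h1
  norm_num at h1

theorem continuous_anglePoint : Continuous anglePoint := by
  rw [continuous_iff_continuousAt]
  intro θ
  refine ContinuousAt.comp (f := fun θ => ![Real.cos θ, Real.sin θ])
    (continuousAt_projPoint (angleVec_ne_zero θ)) (Continuous.continuousAt ?_)
  refine continuous_pi fun i => ?_
  fin_cases i
  · exact Real.continuous_cos
  · exact Real.continuous_sin

theorem planeDet_angleVec (θ φ : ℝ) :
    planeDet ![Real.cos θ, Real.sin θ] ![Real.cos φ, Real.sin φ] = Real.sin (φ - θ) := by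
  rw [Real.sin_sub]
  simp [planeDet]
  ring

theorem anglePoint_surjective (x : OnePoint ℝ) : ∃ θ, anglePoint θ = x := by
  obtain ⟨v, hv, rfl⟩ := projPoint_surjective x
  refine ⟨Complex.arg ⟨v 0, v 1⟩, ?_⟩
  have hz : (⟨v 0, v 1⟩ : ℂ) ≠ 0 := by
    rw [ne_zero_fin_two] at hv
    intro h
    have h0 := congrArg Complex.re h
    have h1 := congrArg Complex.im h
    simp only [Complex.zero_re, Complex.zero_im] at h0 h1
    tauto
  rw [anglePoint, projPoint_eq_iff (angleVec_ne_zero _) hv]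
  simp [Complex.cos_arg hz, Complex.sin_arg]
  ring

theorem anglePoint_add_zsmul (θ : ℝ) (n : ℤ) : anglePoint (θ + n • Real.pi) = anglePoint θ := by
  rw [anglePoint, anglePoint, projPoint_eq_iff (angleVec_ne_zero _) (angleVec_ne_zero _),
    ← sub_eq_zero]
  change planeDet _ _ = 0
  rw [planeDet_angleVec, zsmul_eq_mul, sub_add_cancel_left, Real.sin_neg, Real.sin_int_mul_pi,
    neg_zero]

/-- The increasing tuples of angles contained in an interval of length less than `π`. -/
def angleTuples (m : ℕ) : Set (Fin (m + 3) → ℝ) :=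
  {θ | ∀ i j, i < j → θ i < θ j ∧ θ j < θ i + Real.pi}

theorem convex_angleTuples (m : ℕ) : Convex ℝ (angleTuples m) := by
  intro θ hθ φ hφ a b ha hb hab i j hij
  obtain ⟨h1, h2⟩ := hθ i j hij
  obtain ⟨h3, h4⟩ := hφ i j hij
  simp only [Pi.add_apply, Pi.smul_apply, smul_eq_mul]
  obtain rfl : a = 1 - b := by linarith
  constructor
  · rcases ha.eq_or_lt with h | h
    · rw [← h]
      have : b = 1 := by linarith
      rw [this]
      linarith
    · have := mul_lt_mul_of_pos_left h1 h
      have := mul_le_mul_of_nonneg_left h3.le hb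
      linarith
  · rcases ha.eq_or_lt with h | h
    · rw [← h]
      have : b = 1 := by linarith
      rw [this]
      linarith
    · have := mul_lt_mul_of_pos_left h2 h
      have := mul_le_mul_of_nonneg_left h4.le hb
      linarith

theorem anglePoint_ne {m : ℕ} {θ : Fin (m + 3) → ℝ} (hθ : θ ∈ angleTuples m) {i j : Fin (m + 3)}
    (hij : i ≠ j) : anglePoint (θ i) ≠ anglePoint (θ j) := by
  have key : ∀ i j, i < j → anglePoint (θ i) ≠ anglePoint (θ j) := by
    intro i j hij
    rw [anglePoint, anglePoint, Ne, projPoint_eq_iff (angleVec_ne_zero _) (angleVec_ne_zero _),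
      ← sub_eq_zero]
    change planeDet _ _ ≠ 0
    rw [planeDet_angleVec]
    obtain ⟨h1, h2⟩ := hθ i j hij
    exact (Real.sin_pos_of_pos_of_lt_pi (by linarith) (by linarith)).ne'
  rcases lt_or_gt_of_ne hij with h | h
  · exact key i j h
  · exact (key j i h).symm

/-- A clockwise tuple lifts to increasing angles in the period that starts at the angle of its first
point. -/
theorem exists_angleTuple {m : ℕ} {a : Fin (m + 3) → OnePoint ℝ} (ha : IsClockwiseTuple a) :
    ∃ θ ∈ angleTuples m, ∀ i, anglePoint (θ i) = a i := by
  obtain ⟨θ₀, hθ₀⟩ := anglePoint_surjective (a 0)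
  have hex : ∀ i, ∃ θ, anglePoint θ = a i ∧ θ₀ ≤ θ ∧ θ < θ₀ + Real.pi ∧ (i = 0 → θ = θ₀) := by
    intro i
    by_cases hi : i = 0
    · subst hi
      exact ⟨θ₀, hθ₀, le_rfl, by linarith [Real.pi_pos], fun _ => rfl⟩
    · obtain ⟨θ, hθ⟩ := anglePoint_surjective (a i)
      obtain ⟨n, hn, -⟩ := existsUnique_add_zsmul_mem_Ico Real.pi_pos θ θ₀
      exact ⟨θ + n • Real.pi, by rw [anglePoint_add_zsmul, hθ], hn.1, hn.2, fun h => (hi h).elim⟩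
  choose θ hθa hθ1 hθ2 hθ0 using hex
  have h0 : ∀ i, i ≠ 0 → θ 0 < θ i := by
    intro i hi
    rw [hθ0 0 rfl]
    refine lt_of_le_of_ne (hθ1 i) fun h => hi ?_
    apply ha.injective
    rw [← hθa i, ← h, hθ₀]
  refine ⟨θ, fun i j hij => ?_, hθa⟩
  have hj0 : j ≠ 0 := (Fin.pos_iff_ne_zero.1 ((Fin.zero_le i).trans_lt hij))
  have hθi := hθ1 i
  have hθj := hθ2 j
  refine ⟨?_, by linarith⟩
  by_cases hi : i = 0
  · rw [hi]
    exact h0 j hj0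
  · have h1 := ha 0 i j (Fin.pos_iff_ne_zero.2 hi) hij
    rw [← hθa, ← hθa, ← hθa, anglePoint, anglePoint, anglePoint,
      isCounterclockwise_projPoint_iff (angleVec_ne_zero _) (angleVec_ne_zero _)
        (angleVec_ne_zero _), planeDet_angleVec, planeDet_angleVec, planeDet_angleVec] at h1
    have h00 := hθ0 0 rfl
    have h2 : Real.sin (θ 0 - θ i) < 0 :=
      Real.sin_neg_of_neg_of_neg_pi_lt (by linarith [h0 i hi]) (by linarith [hθ2 i])
    have h3 : 0 < Real.sin (θ j - θ 0) :=
      Real.sin_pos_of_pos_of_lt_pi (by linarith [h0 j hj0]) (by linarith)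
    by_contra hcon
    have h4 : 0 ≤ Real.sin (θ i - θ j) :=
      Real.sin_nonneg_of_nonneg_of_le_pi (by linarith) (by linarith [hθ2 i, hθ1 j])
    have h5 := mul_nonneg_of_nonpos_of_nonpos
      (mul_nonpos_of_nonneg_of_nonpos h4 h2.le) (neg_nonpos.2 h3.le)
    linarith

end CyclicOrder

/-! ### Positivity of transverse maps of the circle -/

/-- A continuous transverse map of the circle that is positive on one clockwise tuple of each
size is positive. -/
theorem isPositiveMapOn_univ {d : ℕ} {ξ : OnePoint ℝ → CompleteFlag d} (hξ : Continuous ξ)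
    (htr : ∀ x y, x ≠ y → (ξ x).IsTransverse (ξ y))
    (hpos : ∀ m : ℕ, ∃ a : Fin (m + 3) → OnePoint ℝ, IsClockwiseTuple a ∧
      IsPositiveTuple fun i => ξ (a i)) : IsPositiveMapOn ξ univ := by
  intro m b _ hb
  obtain ⟨a, ha, hapos⟩ := hpos m
  obtain ⟨θ, hθ, hθa⟩ := exists_angleTuple ha
  obtain ⟨φ, hφ, hφb⟩ := exists_angleTuple hb
  have hconn : PreconnectedSpace (angleTuples m) :=
    isPreconnected_iff_preconnectedSpace.1 (convex_angleTuples m).isPreconnected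
  have hclopen := CompleteFlag.isClopen_isPositiveTuple
    (f := fun i (t : angleTuples m) => ξ (anglePoint (t.1 i)))
    (fun i => hξ.comp (continuous_anglePoint.comp
      ((continuous_apply i).comp continuous_subtype_val)))
    (fun t i j hij => htr _ _ (anglePoint_ne t.2 hij))
  have huniv := hclopen.eq_univ ⟨⟨θ, hθ⟩, by
    simp only [mem_ofPred_eq, hθa]
    exact hapos⟩
  have hmem : (⟨φ, hφ⟩ : angleTuples m) ∈
      {t : angleTuples m | IsPositiveTuple fun i => ξ (anglePoint (t.1 i))} := by
    rw [huniv]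
    trivial
  simpa only [mem_ofPred_eq, hφb] using hmem

/-- Finite decreasing sequences of real numbers are clockwise. -/
theorem exists_isClockwiseTuple {E : Set (OnePoint ℝ)} (hE : E.Infinite) (m : ℕ) :
    ∃ a : Fin (m + 3) → OnePoint ℝ, (∀ i, a i ∈ E) ∧ IsClockwiseTuple a := by
  have hE' : ((fun t : ℝ => (t : OnePoint ℝ)) ⁻¹' E).Infinite := by
    intro hfin
    apply hE
    refine ((hfin.image fun t : ℝ => (t : OnePoint ℝ)).insert OnePoint.infty).subset fun x hx => ?_
    cases x with
    | infty => exact Or.inl rfl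
    | coe t => exact Or.inr ⟨t, hx, rfl⟩
  obtain ⟨T, hT, hcard⟩ := hE'.exists_subset_card_eq (m + 3)
  refine ⟨fun i => (T.orderEmbOfFin hcard i.rev : ℝ),
    fun i => hT (Finset.orderEmbOfFin_mem T hcard _), fun i j k hij hjk => Or.inl ?_⟩
  simp only [boundaryPosition, OnePoint.elim_some, EReal.coe_lt_coe_iff]
  exact ⟨(T.orderEmbOfFin hcard).strictMono (Fin.rev_lt_rev.2 hjk),
    (T.orderEmbOfFin hcard).strictMono (Fin.rev_lt_rev.2 hij)⟩

/-! ### Comparison of the two limit maps -/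

section Comparison

open Matrix

theorem isClockwiseTuple_triple {x y z : OnePoint ℝ} (h : IsCounterclockwise z y x) :
    IsClockwiseTuple (m := 0) ![x, y, z] := by
  intro i j k hij hjk
  obtain rfl : i = 0 := by ext; simp only [Fin.lt_def] at hij hjk; have := k.is_lt; simp; omega
  obtain rfl : j = 1 := by ext; simp only [Fin.lt_def] at hij hjk; have := k.is_lt; simp at *; omega
  obtain rfl : k = 2 := by ext; simp only [Fin.lt_def] at hij hjk; have := k.is_lt; simp at *; omega
  exact h

variable {d : ℕ} {Γ Γ' : Subgroup (ProjGL 2)}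

/-- The two limit maps agree at the attracting fixed points of hyperbolic elements of the
subgroup: by positivity, `ξ' z` is transverse to the value of `ξ` at the repelling fixed point, so
that the iterates of `ξ' z` tend to the value of `ξ` at the attracting one. -/
theorem limitMap_eq_at_attracting {h : Γ' ≤ Γ} (hΓ' : IsNonElementary Γ') {ρ : Γ →* ProjGL d}
    {ξ ξ' : OnePoint ℝ → CompleteFlag d} (hequiv : IsEquivariantOnLimitSet ρ ξ)
    (htr : ∀ x ∈ limitSet Γ, ∀ y ∈ limitSet Γ, x ≠ y → (ξ x).IsTransverse (ξ y))
    (hdyn : IsStronglyDynamicsPreserving ρ ξ) (hcont' : ContinuousOn ξ' (limitSet Γ'))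
    (hequiv' : IsEquivariantOnLimitSet (ρ.comp (Subgroup.inclusion h)) ξ')
    (hpos' : IsPositiveMapOn ξ' (limitSet Γ')) {g : GL (Fin 2) ℝ} {v w : Fin 2 → ℝ} {l m : ℝ}
    (hg : ProjGenLinGroup.mk g ∈ Γ') (hf : IsHyperbolicFrame g v w l m) :
    ξ (projPoint v) = ξ' (projPoint v) := by
  set x := projPoint v
  set y := projPoint w
  have hg' : ProjGenLinGroup.mk g⁻¹ ∈ Γ' := by
    rw [map_inv]
    exact inv_mem hg
  have hx' : x ∈ limitSet Γ' := hf.mem_limitSet hg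
  have hy' : y ∈ limitSet Γ' := hf.inv.mem_limitSet hg'
  have hx := limitSet_mono h hx'
  have hy := limitSet_mono h hy'
  have hxy : x ≠ y := hf.projPoint_ne
  have hgx : ProjGenLinGroup.mk g • x = x := hf.smul_left
  have hgy : ProjGenLinGroup.mk g • y = y := by
    have h1 := hf.inv.smul_left
    rwa [map_inv, inv_smul_eq_iff, eq_comm] at h1
  obtain ⟨z, hz, hzxy⟩ := (hΓ'.sdiff (toFinite {x, y})).nonempty
  simp only [mem_insert_iff, mem_singleton_iff, not_or] at hzxy
  set γ : Γ := ⟨ProjGenLinGroup.mk g, h hg⟩ with hγ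
  obtain ⟨H, hH⟩ := ProjGenLinGroup.mk_surjective (ρ γ)
  have hfix : ∀ p ∈ limitSet Γ, ProjGenLinGroup.mk g • p = p → H • ξ p = ξ p := by
    intro p hp hgp
    have h1 := hequiv γ p hp
    rw [← hH] at h1
    exact h1.symm.trans (congrArg ξ hgp)
  have hfix' : ∀ p ∈ limitSet Γ', ProjGenLinGroup.mk g • p = p → H • ξ' p = ξ' p := by
    intro p hp hgp
    have h1 : ξ' (ProjGenLinGroup.mk g • p) = ρ γ • ξ' p := hequiv' ⟨_, hg⟩ p hp
    rw [← hH] at h1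
    exact h1.symm.trans (congrArg ξ' hgp)
  have hHn : ∀ (n : ℕ) (F : CompleteFlag d), ρ (γ ^ n) • F = H ^ n • F := by
    intro n F
    rw [map_pow, ← hH, ← map_pow]
    rfl
  have hattr : ∀ F : CompleteFlag d, F.IsTransverse (ξ y) →
      Tendsto (fun n : ℕ => ρ (γ ^ n) • F) atTop (𝓝 (ξ x)) := by
    refine hdyn (fun n => γ ^ n) UpperHalfPlane.I x hx y hy (hf.tendsto_interior _) ?_
    refine (hf.inv.tendsto_interior UpperHalfPlane.I).congr fun n => ?_
    rw [map_inv, inv_pow]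
    rfl
  have hattr' : ∀ F : CompleteFlag d, F.IsTransverse (ξ y) →
      Tendsto (fun n : ℕ => H ^ n • F) atTop (𝓝 (ξ x)) := by
    intro F hF
    simpa only [hHn] using hattr F hF
  have hztr : (ξ' z).IsTransverse (ξ y) := by
    rcases isCounterclockwise_or (Ne.symm hzxy.1) hzxy.2 hxy.symm with hc | hc
    · have hF := hpos' 0 ![y, z, x] (Fin.forall_fin_succ.2 ⟨hy', Fin.forall_fin_succ.2
        ⟨hz, fun i => by rw [Subsingleton.elim i 0]; exact hx'⟩⟩) (isClockwiseTuple_triple hc)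
      exact CompleteFlag.isTransverse_of_isPositiveTuple hF (hfix' y hy' hgy) (hfix' x hx' hgx)
        (htr x hx y hy hxy) (hfix x hx hgx) (hfix y hy hgy) hattr'
    · have hF := hpos' 0 ![x, z, y] (Fin.forall_fin_succ.2 ⟨hx', Fin.forall_fin_succ.2
        ⟨hz, fun i => by rw [Subsingleton.elim i 0]; exact hy'⟩⟩) (isClockwiseTuple_triple hc)
      exact CompleteFlag.isTransverse_of_isPositiveTuple hF (hfix' x hx' hgx) (hfix' y hy' hgy)
        (htr x hx y hy hxy) (hfix x hx hgx) (hfix y hy hgy) hattr'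
  have hlim := hattr _ hztr
  have hzlim : Tendsto (fun n : ℕ => ξ' (ProjGenLinGroup.mk g ^ n • z)) atTop (𝓝 (ξ' x)) := by
    refine (hcont' x hx').tendsto.comp (tendsto_nhdsWithin_iff.2
      ⟨hf.tendsto_boundary hzxy.2, Eventually.of_forall fun n => ?_⟩)
    exact smul_mem_limitSet (pow_mem hg n) hz
  refine tendsto_nhds_unique hlim (hzlim.congr fun n => ?_)
  have h1 : ξ' (ProjGenLinGroup.mk g ^ n • z) = ρ (γ ^ n) • ξ' z :=
    hequiv' ⟨_, pow_mem hg n⟩ z hz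
  exact h1

theorem isHitchin_of_isBorelTransverse (h : Γ' ≤ Γ) (hlim : limitSet Γ = univ)
    (hΓ' : IsNonElementary Γ') {ρ : Γ →* ProjGL d} (hρ : IsBorelTransverse ρ)
    (hρ' : IsHitchin (ρ.comp (Subgroup.inclusion h))) : IsHitchin ρ := by
  obtain ⟨ξ, hcont, hequiv, htr, hdyn⟩ := hρ
  obtain ⟨ξ', hcont', hequiv', hpos'⟩ := hρ'
  refine ⟨ξ, hcont, hequiv, ?_⟩
  let E : Set (OnePoint ℝ) := {x ∈ limitSet Γ' | ξ x = ξ' x}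
  have hE : E.Infinite := by
    intro hfin
    refine hΓ' (hfin.subset (limitSet_subset_of_finite hfin ?_ ?_))
    · rintro γ hγ p ⟨hp, hpE⟩
      refine ⟨smul_mem_limitSet hγ hp, ?_⟩
      have h1 : ξ (γ • p) = ρ ⟨γ, h hγ⟩ • ξ p := hequiv ⟨γ, h hγ⟩ p (limitSet_mono h hp)
      have h2 : ξ' (γ • p) = ρ ⟨γ, h hγ⟩ • ξ' p := hequiv' ⟨γ, hγ⟩ p hp
      rw [h1, h2, hpE]
    · obtain ⟨g, v, w, l, m, hg, hf⟩ := exists_isHyperbolicFrame hΓ'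
      have hg' : ProjGenLinGroup.mk g⁻¹ ∈ Γ' := by
        rw [map_inv]
        exact inv_mem hg
      exact ⟨_, ⟨hf.mem_limitSet hg, limitMap_eq_at_attracting hΓ' hequiv htr hdyn hcont' hequiv'
          hpos' hg hf⟩,
        _, ⟨hf.inv.mem_limitSet hg', limitMap_eq_at_attracting hΓ' hequiv htr hdyn hcont' hequiv'
          hpos' hg' hf.inv⟩, hf.projPoint_ne⟩
  rw [hlim] at hcont htr ⊢
  refine isPositiveMapOn_univ (continuousOn_univ.1 hcont)
    (fun x y hxy => htr x trivial y trivial hxy) fun m => ?_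
  obtain ⟨a, haE, ha⟩ := exists_isClockwiseTuple hE m
  refine ⟨a, ha, ?_⟩
  have h1 : (fun i => ξ (a i)) = fun i => ξ' (a i) := funext fun i => (haE i).2
  rw [h1]
  exact hpos' m a (fun i => (haE i).1) ha

theorem IsHitchin.comp_inclusion (h : Γ' ≤ Γ) {ρ : Γ →* ProjGL d} (hρ : IsHitchin ρ) :
    IsHitchin (ρ.comp (Subgroup.inclusion h)) := by
  obtain ⟨ξ, hcont, hequiv, hpos⟩ := hρ
  have hsub := limitSet_mono h
  exact ⟨ξ, hcont.mono hsub, fun γ x hx => hequiv (Subgroup.inclusion h γ) x (hsub hx),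
    fun m a ha hc => hpos m a (fun i => hsub (ha i)) hc⟩

end Comparison

theorem theorem2 (d : ℕ) (Γ : Subgroup (ProjGL 2)) (hdisc : DiscreteTopology Γ)
    (hlim : limitSet Γ = Set.univ) :
    (∀ (Γ' : Subgroup (ProjGL 2)) (h : Γ' ≤ Γ), IsNonElementary Γ' →
      ∀ ρ : Γ →* ProjGL d, IsBorelTransverse ρ →
        IsHitchin (ρ.comp (Subgroup.inclusion h)) → IsHitchin ρ) ∧
    (∀ (Γ₁ Γ₂ : Subgroup (ProjGL 2)) (h₁ : Γ₁ ≤ Γ) (h₂ : Γ₂ ≤ Γ),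
      IsNonElementary Γ₁ → IsNonElementary Γ₂ →
      ∀ (ρ₁ : Γ₁ →* ProjGL d) (ρ₂ : Γ₂ →* ProjGL d), ¬ IsHitchin ρ₁ → IsHitchin ρ₂ →
        ∀ ρ : Γ →* ProjGL d, ρ.comp (Subgroup.inclusion h₁) = ρ₁ →
          ρ.comp (Subgroup.inclusion h₂) = ρ₂ → ¬ IsBorelTransverse ρ) := by
  have key := fun (Γ' : Subgroup (ProjGL 2)) (h : Γ' ≤ Γ) (hΓ' : IsNonElementary Γ')
    (ρ : Γ →* ProjGL d) hρ hρ' => isHitchin_of_isBorelTransverse h hlim hΓ' (ρ := ρ) hρ hρ'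
  refine ⟨key, ?_⟩
  rintro Γ₁ Γ₂ h₁ h₂ - hΓ₂ ρ₁ ρ₂ hρ₁ hρ₂ ρ rfl rfl hρ
  exact hρ₁ ((key Γ₂ h₂ hΓ₂ ρ hρ hρ₂).comp_inclusion h₁)
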